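/- **Setting.** Fix $d\in\mathbb N$; $e_0,\dots,e_d$ is the canonical basis of $\mathbb N^{d+1}$. A decorated tree is a non-planar rooted tree $\tau = X^{n}\,\Xi^{m}\prod_{j=1}^r I_{a_j}(\tau_j)$ with root decoration $n\in\mathbb N^{d+1}$, $m\in\mathbb N$ terminal noise edges at the root, and subtrees $\tau_j$ attached by edges with decorations $a_j\in\mathbb N^{d+1}$; $N_\tau$ is its set of nodes (leaves of noise edges excluded), $\mathfrak n_v$ the decoration of the node $v$, and $\mathfrak T$ the set of decorated trees. The tree product identifies roots and adds their decorations. Let $\uparrow^i\tau=\sum_{v\in N_\tau}\uparrow_v^{e_i}\tau$ increase a node decoration by $e_i$, and let $$\sigma\,\widehat\curvearrowright^{a}\tau=\sum_{v\in N_\tau}\sum_{\ell}\binom{\mathfrak n_v}{\ell}\,\sigma\curvearrowright_v^{a-\ell}(\uparrow_v^{-\ell}\tau),$$ where $\sigma\curvearrowright_v^{b}\cdot$ grafts $\sigma$ at $v$ by a new edge with decoration $b$, and terms with $\ell\not\le a$ or $\ell\not\le\mathfrak n_v$ vanish. Let $\mathcal V$ be the real vector space with basis $\{I_a(\tau): a\in\mathbb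 N^{d+1},\tau\in\mathfrak T\}\cup\{X_0,\dots,X_d\}$, and $\mathcal V_0$ the Lie algebra $(\mathcal V,[\cdot,\cdot]_0)$ in which planted trees commute, the $X_i$ commute, and $[I_a(\tau),X_i]_0=I_{a-e_i}(\tau)$ ($=0$ if $a_i=0$). The post-Lie product on $\mathcal V$ is $$X_i\,\widehat\triangleright\, I_a(\tau)=I_a(\uparrow^i\tau),\quad I_a(\sigma)\,\widehat\triangleright\, I_b(\tau)=I_b(\sigma\,\widehat\curvearrowright^{a}\tau),\quad I_a(\tau)\,\widehat\triangleright\, X_i=0,\quad X_i\,\widehat\triangleright\, X_j=0 .$$ Let $\Delta$ be the coproduct of $U(\mathcal V_0)$ for which the elements of $\mathcal V$ are primitive, $\Delta A=\sum_{(A)}A^{(1)}\otimes A^{(2)}$. An extension of $\widehat\triangleright$ to $U(\mathcal V_0)$ is a bilinear product that agrees with $\widehat\triangleright$ on $\mathcal V$ and satisfies, for $x,y\in\mathcal V$ and $A,B,C\in U(\mathcal V_0)$: $x\,\widehat\triangleright\,\mathbf 1=0$; $x\,\widehat\triangleright\,\cdot$ is a derivation of $U(\mathcal V_0)$; $\mathbf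 1\,\widehat\triangleright\,A=A$; $xA\,\widehat\triangleright\,y=x\,\widehat\triangleright\,(A\,\widehat\triangleright\,y)-(x\,\widehat\triangleright\,A)\,\widehat\triangleright\,y$; $A\,\widehat\triangleright\,BC=\sum_{(A)}(A^{(1)}\widehat\triangleright B)(A^{(2)}\widehat\triangleright C)$. Put $A*B=\sum_{(A)}A^{(1)}(A^{(2)}\,\widehat\triangleright\,B)$. For $\sigma=X^k\prod_i I_{a_i}(\sigma_i)$ (no noise at the root) and $\tau\in\mathfrak T$, the recentering product $\sigma\star_2\tau$ is obtained by grafting every $I_{a_i}(\sigma_i)$ onto nodes of $\tau$ with the deformed grafting $\widehat\curvearrowright^{a_i}$ (never onto the grafted $\sigma_j$), and then applying $$\tilde\uparrow^{k}_{N_\tau}=\prod_{i=0}^d(\uparrow^i_{N_\tau})^{k_i}=\sum_{k=\sum_{v\in N_\tau}k_v}\frac{k!}{\prod_v k_v!}\prod_v\uparrow_v^{k_v},$$ which acts on the nodes of $\tau$ only; it is extended bilinearly. Let $\mathcal T_+$ be the span of the trees $X^k\prod_i I_{a_i}(\sigma_i)$, and identify such a tree with the ordered monomial $X_0^{k_0}\cdots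 X_d^{k_d}\,I_{a_1}(\sigma_1)\cdots I_{a_r}(\sigma_r)\in U(\mathcal V_0)$. The coproduct $\Delta_2$ is the multiplicative map (with values in formal series) given by $\Delta_2X_i=X_i\otimes1+1\otimes X_i$, $\Delta_2\Xi=\Xi\otimes1$, $$\Delta_2I_a(\tau)=(I_a\otimes\mathrm{id})\Delta_2\tau+\sum_{\ell\in\mathbb N^{d+1}}\frac{X^\ell}{\ell!}\otimes I_{a+\ell}(\tau),$$ and trees are paired by $\langle\sigma,\tau\rangle=\delta_{\sigma,\tau}S(\tau)$ with $S\bigl(X^n\Xi^m\prod_jI_{a_j}(\tau_j)^{\beta_j}\bigr)=n!\,m!\prod_jS(\tau_j)^{\beta_j}\beta_j!$ for pairwise distinct $(a_j,\tau_j)$. **Theorem.** 1. $\widehat\triangleright$ has exactly one extension to $U(\mathcal V_0)$. 2. $\star_2$ is dual to $\Delta_2$: $\langle\rho,\sigma\star_2\tau\rangle=\langle\Delta_2\rho,\tau\otimes\sigma\rangle$ for all trees $\rho,\tau$ and all trees $\sigma\in\mathcal T_+$. 3. The identification $\mathcal T_+\to U(\mathcal V_0)$ is a linear isomorphism, $\mathcal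 T_+$ is closed under $\star_2$, and under it $\star_2$ coincides with $*$. 4. For every $b\in\mathbb N^{d+1}$, every $\sigma\in\mathcal T_+$ (in particular every $\sigma=X^k\prod_iI_{a_i}(\sigma_i)$) and every linear combination $\tau$ of decorated trees, $$I_b(\sigma\star_2\tau)=\sigma\,\widehat\triangleright\,I_b(\tau).$$ -/

import Mathlib

namespace RegTrees

/-! ## Decorated trees -/

/-- Multi-indices in `ℕ^{d+1}`, with coordinates `0, …, d`. -/
abbrev Idx (d : ℕ) : Type := Fin (d + 1) → ℕ

/-- The unit vector `e_i`. -/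
def unitIdx {d : ℕ} (i : Fin (d + 1)) : Idx d := Pi.single i 1

/-- The multi-index binomial coefficient `∏ i, (n_i choose l_i)`; it vanishes unless `l ≤ n`. -/
def idxChoose {d : ℕ} (n l : Idx d) : ℕ := ∏ i, (n i).choose (l i)

/-- The multi-index factorial `∏ i, (n_i)!`. -/
def idxFactorial {d : ℕ} (n : Idx d) : ℕ := ∏ i, (n i).factorial

/-- Planar decorated trees with kernel edges labelled by `E`.
`root n m` is `X^n Ξ^m`: one node with decoration `n`, carrying `m` terminal noise edges;
`graft e σ τ` is `I_e(σ) · τ`: the tree `τ` with one more branch `σ` attached to its root by a new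
edge labelled `e`. -/
inductive PlanarTree (d : ℕ) (E : Type) : Type
  | root (n : Idx d) (m : ℕ) : PlanarTree d E
  | graft (e : E) (σ τ : PlanarTree d E) : PlanarTree d E

/-- Exchanging two neighbouring branches at some node. -/
inductive PlanarTree.Swap {d : ℕ} {E : Type} : PlanarTree d E → PlanarTree d E → Prop
  | swap (e e' : E) (σ σ' τ : PlanarTree d E) :
      PlanarTree.Swap (.graft e σ (.graft e' σ' τ)) (.graft e' σ' (.graft e σ τ))
  | branch (e : E) (σ σ' τ : PlanarTree d E) (h : PlanarTree.Swap σ σ') :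
      PlanarTree.Swap (.graft e σ τ) (.graft e σ' τ)
  | rest (e : E) (σ τ τ' : PlanarTree d E) (h : PlanarTree.Swap τ τ') :
      PlanarTree.Swap (.graft e σ τ) (.graft e σ τ')

/-- Non-planar decorated trees with kernel edges labelled by `E`. -/
def ETree (d : ℕ) (E : Type) : Type := Quot (@PlanarTree.Swap d E)

/-- Decorated trees: every kernel edge `I_a` carries a decoration `a ∈ ℕ^{d+1}`. -/
abbrev Tree (d : ℕ) : Type := ETree d (Idx d)

namespace ETree

/-- The one-node tree `X^n Ξ^m`. -/
def root {d : ℕ} {E : Type} (n : Idx d) (m : ℕ) : ETree d E := Quot.mk _ (.root n m)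

/-- The tree `I_e(σ) · τ`. -/
def graft {d : ℕ} {E : Type} (e : E) (σ τ : ETree d E) : ETree d E :=
  Quot.map₂ (PlanarTree.graft e) (fun σ _ _ h => .rest e σ _ _ h) (fun _ _ τ h => .branch e _ _ τ h)
    σ τ

theorem graft_comm {d : ℕ} {E : Type} (e e' : E) (σ σ' τ : ETree d E) :
    graft e σ (graft e' σ' τ) = graft e' σ' (graft e σ τ) := by
  induction σ using Quot.ind
  induction σ' using Quot.ind
  induction τ using Quot.ind
  exact Quot.sound (.swap _ _ _ _ _)

theorem induct {d : ℕ} {E : Type} {P : ETree d E → Prop} (hr : ∀ n m, P (root n m))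
    (hg : ∀ e σ τ, P σ → P τ → P (graft e σ τ)) (τ : ETree d E) : P τ := by
  induction τ using Quot.ind with
  | mk t =>
    induction t with
    | root n m => exact hr n m
    | graft e s t ihs iht => exact hg e _ _ ihs iht

/-- Recursion on planar representatives. -/
def planarRec {d : ℕ} {E M : Type} (r : Idx d → ℕ → M)
    (g : E → ETree d E → M → ETree d E → M → M) : PlanarTree d E → M
  | .root n m => r n m
  | .graft e σ τ => g e (Quot.mk _ σ) (planarRec r g σ) (Quot.mk _ τ) (planarRec r g τ)

/-- Recursion on non-planar trees: `f (X^n Ξ^m) = r n m` and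
`f (I_e(σ) · τ) = g e σ (f σ) τ (f τ)`, where `g` does not see the order of the branches. -/
def recOn {d : ℕ} {E M : Type} (r : Idx d → ℕ → M)
    (g : E → ETree d E → M → ETree d E → M → M)
    (h : ∀ e σ x e' σ' x' τ z,
      g e σ x (graft e' σ' τ) (g e' σ' x' τ z) = g e' σ' x' (graft e σ τ) (g e σ x τ z)) :
    ETree d E → M :=
  Quot.lift (planarRec r g) (by
    intro p q hpq
    induction hpq with
    | swap e e' σ σ' τ =>
      exact h e (Quot.mk _ σ) (planarRec r g σ) e' (Quot.mk _ σ') (planarRec r g σ') (Quot.mk _ τ)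
        (planarRec r g τ)
    | branch e σ σ' τ hs ih => simp only [planarRec, ih, Quot.sound hs]
    | rest e σ τ τ' hs ih => simp only [planarRec, ih, Quot.sound hs])

@[simp] theorem recOn_root {d : ℕ} {E M : Type} (r : Idx d → ℕ → M)
    (g : E → ETree d E → M → ETree d E → M → M) (h) (n : Idx d) (m : ℕ) :
    recOn r g h (root n m) = r n m := rfl

@[simp] theorem recOn_graft {d : ℕ} {E M : Type} (r : Idx d → ℕ → M)
    (g : E → ETree d E → M → ETree d E → M → M) (h) (e : E) (σ τ : ETree d E) :
    recOn r g h (graft e σ τ) = g e σ (recOn r g h σ) τ (recOn r g h τ) := by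
  induction σ using Quot.ind
  induction τ using Quot.ind
  rfl

/-- Relabelling of the kernel edges. -/
def mapEdges {d : ℕ} {E E' : Type} (f : E → E') : ETree d E → ETree d E' :=
  recOn root (fun e _ x _ z => graft (f e) x z) (fun _ _ _ _ _ _ _ _ => graft_comm _ _ _ _ _)

/-- Multiplication of a tree by `X^n Ξ^m`. -/
def addRoot {d : ℕ} {E : Type} (n : Idx d) (m : ℕ) : ETree d E → ETree d E :=
  recOn (fun n' m' => root (n + n') (m + m')) (fun e σ _ _ z => graft e σ z)
    (fun _ _ _ _ _ _ _ _ => graft_comm _ _ _ _ _)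

/-- The tree product: the roots are identified and their decorations added. -/
def mul {d : ℕ} {E : Type} (σ τ : ETree d E) : ETree d E :=
  recOn (fun n m => addRoot n m τ) (fun e s _ _ z => graft e s z)
    (fun _ _ _ _ _ _ _ _ => graft_comm _ _ _ _ _) σ

@[simp] theorem addRoot_root {d : ℕ} {E : Type} (n n' : Idx d) (m m' : ℕ) :
    addRoot n m (root n' m' : ETree d E) = root (n + n') (m + m') := rfl

@[simp] theorem addRoot_graft {d : ℕ} {E : Type} (n : Idx d) (m : ℕ) (e : E) (σ τ : ETree d E) :
    addRoot n m (graft e σ τ) = graft e σ (addRoot n m τ) := by simp [addRoot]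

@[simp] theorem root_mul {d : ℕ} {E : Type} (n : Idx d) (m : ℕ) (τ : ETree d E) :
    mul (root n m) τ = addRoot n m τ := rfl

@[simp] theorem graft_mul {d : ℕ} {E : Type} (e : E) (σ σ' τ : ETree d E) :
    mul (graft e σ σ') τ = graft e σ (mul σ' τ) := by simp [mul]

theorem mul_graft {d : ℕ} {E : Type} (e : E) (ρ σ τ : ETree d E) :
    mul ρ (graft e σ τ) = graft e σ (mul ρ τ) := by
  induction ρ using induct with
  | hr n m => simp
  | hg e' σ' τ' _ ih => rw [graft_mul, ih, graft_mul, graft_comm]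

theorem mul_addRoot {d : ℕ} {E : Type} (n : Idx d) (m : ℕ) (σ τ : ETree d E) :
    mul (addRoot n m σ) τ = addRoot n m (mul σ τ) := by
  induction σ using induct with
  | hr n' m' =>
    induction τ using induct with
    | hr n'' m'' => simp [add_assoc]
    | hg e σ τ _ ih => simp only [addRoot_root, root_mul, addRoot_graft] at ih ⊢; rw [ih]
  | hg e σ σ' _ ih => simp [ih]

theorem mul_root {d : ℕ} {E : Type} (n : Idx d) (m : ℕ) (τ : ETree d E) :
    mul τ (root n m) = addRoot n m τ := by
  induction τ using induct with
  | hr n' m' => simp [add_comm]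
  | hg e σ τ _ ih => simp [ih]

instance instCommMonoid {d : ℕ} {E : Type} : CommMonoid (ETree d E) where
  mul := mul
  one := root 0 0
  mul_assoc a b c := by
    change mul (mul a b) c = mul a (mul b c)
    induction a using induct with
    | hr n m => simp [mul_addRoot]
    | hg e σ τ _ ih => simp [ih]
  one_mul a := by
    change mul (root 0 0) a = a
    induction a using induct with
    | hr n m => simp
    | hg e σ τ _ ih => rw [root_mul] at ih ⊢; rw [addRoot_graft, ih]
  mul_one a := by
    change mul a (root 0 0) = a
    induction a using induct with
    | hr n m => simp
    | hg e σ τ _ ih => simp [ih]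
  mul_comm a b := by
    change mul a b = mul b a
    induction a using induct with
    | hr n m => simp [mul_root]
    | hg e σ τ _ ih => rw [graft_mul, ih, mul_graft]

/-- The planted tree `I_e(τ)`; its root has decoration `0`. -/
def plant {d : ℕ} {E : Type} (e : E) (τ : ETree d E) : ETree d E := graft e τ (root 0 0)

/-- The number of noise edges at the root. -/
def rootNoise {d : ℕ} {E : Type} : ETree d E → ℕ :=
  recOn (fun _ m => m) (fun _ _ _ _ z => z) (fun _ _ _ _ _ _ _ _ => rfl)

/-- The multiset of the pairs `(e_j, τ_j)` in `τ = X^n Ξ^m ∏_j I_{e_j}(τ_j)`. -/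
def branches {d : ℕ} {E : Type} : ETree d E → Multiset (E × ETree d E) :=
  recOn (fun _ _ => 0) (fun e σ _ _ z => (e, σ) ::ₘ z)
    (fun _ _ _ _ _ _ _ _ => Multiset.cons_swap _ _ _)

open Classical in
/-- The symmetry factor: `S(X^n Ξ^m ∏_j I_{e_j}(τ_j)^{β_j}) = n! m! ∏_j S(τ_j)^{β_j} β_j!`
for pairwise distinct `(e_j, τ_j)`, built up one branch at a time. -/
noncomputable def symFactor {d : ℕ} {E : Type} : ETree d E → ℕ :=
  recOn (fun n m => idxFactorial n * m.factorial)
    (fun e σ x τ z => (1 + (branches τ).count (e, σ)) * x * z)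
    (by
      intro e σ x e' σ' x' τ z
      simp only [branches, recOn_graft]
      by_cases h : (e, σ) = (e', σ')
      · simp only [h, Multiset.count_cons_self]; ring
      · rw [Multiset.count_cons_of_ne h, Multiset.count_cons_of_ne (Ne.symm h)]; ring)

end ETree

open ETree

/-! ## Linear combinations of trees, operations on nodes -/

/-- The real vector space spanned by the trees. -/
abbrev TreeSpan (d : ℕ) (E : Type) : Type := ETree d E →₀ ℝ

/-- Bilinear extension of `(σ, τ) ↦ I_e(σ) · τ`. -/
noncomputable def graftL {d : ℕ} {E : Type} (e : E) :
    TreeSpan d E →ₗ[ℝ] TreeSpan d E →ₗ[ℝ] TreeSpan d E :=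
  Finsupp.linearCombination ℝ (fun σ => Finsupp.lmapDomain ℝ ℝ (graft e σ))

theorem graftL_single {d : ℕ} {E : Type} (e : E) (σ τ : ETree d E) (a b : ℝ) :
    graftL e (Finsupp.single σ a) (Finsupp.single τ b) = Finsupp.single (graft e σ τ) (a * b) := by
  simp [graftL, Finsupp.mapDomain_single]

theorem graftL_comm {d : ℕ} {E : Type} (e e' : E) (x x' z : TreeSpan d E) :
    graftL e x (graftL e' x' z) = graftL e' x' (graftL e x z) := by
  induction x using Finsupp.induction_linear with
  | zero => simp
  | add x y hx hy => simp [hx, hy]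
  | single σ a =>
    induction x' using Finsupp.induction_linear with
    | zero => simp
    | add x y hx hy => simp [hx, hy]
    | single σ' a' =>
      induction z using Finsupp.induction_linear with
      | zero => simp
      | add x y hx hy => simp [hx, hy]
      | single τ b => simp only [graftL_single, graft_comm e e']; congr 1; ring

/-- The sum over the nodes `v` of a tree of a local operation at `v`: if `v` has decoration `n`
and `m` noises, its factor `X^n Ξ^m` is replaced by `φ n m`, and the branches at `v` are kept.
Only the nodes that are joined to the root by edges `e` with `op e = true` are summed over. -/
noncomputable def nodeSum {d : ℕ} {E : Type} (op : E → Bool) (φ : Idx d → ℕ → TreeSpan d E) :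
    ETree d E → TreeSpan d E :=
  recOn φ
    (fun e σ x τ z =>
      (if op e = true then graftL e x (Finsupp.single τ 1) else 0)
        + graftL e (Finsupp.single σ 1) z)
    (by
      intro e σ x e' σ' x' τ z
      have h1 : (Finsupp.single (graft e' σ' τ) 1 : TreeSpan d E)
          = graftL e' (Finsupp.single σ' 1) (Finsupp.single τ 1) := by simp [graftL_single]
      have h2 : (Finsupp.single (graft e σ τ) 1 : TreeSpan d E)
          = graftL e (Finsupp.single σ 1) (Finsupp.single τ 1) := by simp [graftL_single]
      have h3 (y : TreeSpan d E) : (if op e = true then graftL e x y else 0)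
          = graftL e (if op e = true then x else 0) y := by split_ifs <;> simp
      have h4 (y : TreeSpan d E) : (if op e' = true then graftL e' x' y else 0)
          = graftL e' (if op e' = true then x' else 0) y := by split_ifs <;> simp
      rw [h1, h2, h3, h3, h4, h4, map_add, map_add,
        graftL_comm e e' (Finsupp.single σ 1) (Finsupp.single σ' 1)]
      generalize (if op e = true then x else 0) = x
      generalize (if op e' = true then x' else 0) = x'
      rw [graftL_comm e e' x, graftL_comm e e' (Finsupp.single σ 1) x']
      abel)

/-- The local operation of `↑^{e_i}_v`: the decoration of the node is increased by `e_i`. -/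
noncomputable def raiseAt {d : ℕ} {E : Type} (i : Fin (d + 1)) (n : Idx d) (m : ℕ) :
    TreeSpan d E :=
  Finsupp.single (root (n + unitIdx i) m) 1

/-- The local operation of the deformed grafting of `σ` with decoration `a`:
`∑_ℓ (n choose ℓ) I_{a-ℓ}(σ) X^{n-ℓ} Ξ^m`, where `mk b` is the edge label standing for the
decoration `b`, and the terms with `ℓ ≰ a` or `ℓ ≰ n` vanish. -/
noncomputable def graftAt {d : ℕ} {E : Type} (mk : Idx d → E) (a : Idx d) (σ : ETree d E)
    (n : Idx d) (m : ℕ) : TreeSpan d E :=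
  ∑ l ∈ Finset.Iic a,
    (idxChoose n l : ℝ) • Finsupp.single (graft (mk (a - l)) σ (root (n - l) m)) 1

/-- `↑^i τ = ∑_{v ∈ N_τ} ↑^{e_i}_v τ`. -/
noncomputable def raise {d : ℕ} (i : Fin (d + 1)) (τ : Tree d) : TreeSpan d (Idx d) :=
  nodeSum (fun _ => true) (raiseAt i) τ

/-- The deformed grafting product
`σ ↷̂^a τ = ∑_{v ∈ N_τ} ∑_ℓ (n_v choose ℓ) σ ↷_v^{a-ℓ} (↑_v^{-ℓ} τ)`. -/
noncomputable def hatGraft {d : ℕ} (a : Idx d) (σ τ : Tree d) : TreeSpan d (Idx d) :=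
  nodeSum (fun _ => true) (graftAt id a σ) τ

/-! ## The space `𝒱`, its Lie bracket, and the post-Lie product -/

/-- The span `𝒱̃` of the planted trees; the pair `(a, τ)` stands for `I_a(τ)`. -/
abbrev PlantedSpan (d : ℕ) : Type := (Idx d × Tree d) →₀ ℝ

/-- The linear map `τ ↦ I_b(τ)` into `𝒱̃`. -/
noncomputable def plantL {d : ℕ} (b : Idx d) : TreeSpan d (Idx d) →ₗ[ℝ] PlantedSpan d :=
  Finsupp.lmapDomain ℝ ℝ (fun τ => (b, τ))

/-- The linear map `I_a(τ) ↦ I_{a - e_i}(τ)`, which is `0` if `a_i = 0`. -/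
noncomputable def lower {d : ℕ} (i : Fin (d + 1)) : PlantedSpan d →ₗ[ℝ] PlantedSpan d :=
  Finsupp.linearCombination ℝ (fun p : Idx d × Tree d =>
    if p.1 i = 0 then 0 else Finsupp.single (p.1 - unitIdx i, p.2) 1)

/-- The linear map `I_a(τ) ↦ I_a(↑^i τ)`. -/
noncomputable def raisePlanted {d : ℕ} (i : Fin (d + 1)) : PlantedSpan d →ₗ[ℝ] PlantedSpan d :=
  Finsupp.linearCombination ℝ (fun p : Idx d × Tree d => plantL p.1 (raise i p.2))

/-- The deformed pre-Lie product `I_a(σ) ↷̂ I_b(τ) = I_b(σ ↷̂^a τ)` on `𝒱̃`. -/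
noncomputable def hatGraftPlanted {d : ℕ} :
    PlantedSpan d →ₗ[ℝ] PlantedSpan d →ₗ[ℝ] PlantedSpan d :=
  Finsupp.linearCombination ℝ (fun p : Idx d × Tree d =>
    Finsupp.linearCombination ℝ (fun q : Idx d × Tree d =>
      plantL q.1 (hatGraft p.1 p.2 q.2)))

/-- The space `𝒱` spanned by the planted trees and `X_0, …, X_d`, as the direct sum of `𝒱̃` and
the span of the `X_i`. With the bracket below it is the Lie algebra `𝒱_0`. -/
def V (d : ℕ) : Type := PlantedSpan d × (Fin (d + 1) → ℝ)

namespace V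

noncomputable instance (d : ℕ) : AddCommGroup (V d) :=
  inferInstanceAs (AddCommGroup (PlantedSpan d × (Fin (d + 1) → ℝ)))

noncomputable instance (d : ℕ) : Module ℝ (V d) :=
  inferInstanceAs (Module ℝ (PlantedSpan d × (Fin (d + 1) → ℝ)))

/-- The element `f + ∑_i x_i X_i`. -/
def mk {d : ℕ} (f : PlantedSpan d) (x : Fin (d + 1) → ℝ) : V d := (f, x)

/-- The component in `𝒱̃`. -/
noncomputable def tree {d : ℕ} : V d →ₗ[ℝ] PlantedSpan d :=
  LinearMap.fst ℝ (PlantedSpan d) (Fin (d + 1) → ℝ)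

/-- The coefficients of the `X_i`. -/
noncomputable def poly {d : ℕ} : V d →ₗ[ℝ] (Fin (d + 1) → ℝ) :=
  LinearMap.snd ℝ (PlantedSpan d) (Fin (d + 1) → ℝ)

@[simp] theorem tree_mk {d : ℕ} (f : PlantedSpan d) (x : Fin (d + 1) → ℝ) :
    tree (mk f x) = f := rfl

@[simp] theorem poly_mk {d : ℕ} (f : PlantedSpan d) (x : Fin (d + 1) → ℝ) :
    poly (mk f x) = x := rfl

theorem ext' {d : ℕ} {u v : V d} (h1 : tree u = tree v) (h2 : poly u = poly v) : u = v :=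
  Prod.ext h1 h2

/-- The linear map `τ ↦ I_b(τ)` into `𝒱`. -/
noncomputable def planted {d : ℕ} (b : Idx d) : TreeSpan d (Idx d) →ₗ[ℝ] V d :=
  (LinearMap.inl ℝ (PlantedSpan d) (Fin (d + 1) → ℝ)).comp (plantL b)

@[simp] theorem poly_planted {d : ℕ} (b : Idx d) (x : TreeSpan d (Idx d)) :
    poly (planted b x) = 0 := rfl

/-- The element `X_i` of `𝒱`. -/
noncomputable def X {d : ℕ} (i : Fin (d + 1)) : V d := mk 0 (Pi.single i 1)

end V

theorem lower_comm {d : ℕ} (i j : Fin (d + 1)) (f : PlantedSpan d) :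
    lower i (lower j f) = lower j (lower i f) := by
  by_cases hij : i = j
  · subst hij; rfl
  induction f using Finsupp.induction_linear with
  | zero => simp
  | add x y hx hy => simp [hx, hy]
  | single p c =>
    have hji : j ≠ i := fun h => hij h.symm
    by_cases hi : p.1 i = 0 <;> by_cases hj : p.1 j = 0 <;>
      simp [lower, hi, hj, unitIdx, hij, hji, tsub_right_comm]

/-- `∑_i x_i D_i f`, where `D_i = [·, X_i]_0` is `lower i`. -/
noncomputable def lowerSum {d : ℕ} (x : Fin (d + 1) → ℝ) (f : PlantedSpan d) : PlantedSpan d :=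
  ∑ i, x i • lower i f

theorem lowerSum_comm {d : ℕ} (x y : Fin (d + 1) → ℝ) (f : PlantedSpan d) :
    lowerSum x (lowerSum y f) = lowerSum y (lowerSum x f) := by
  simp only [lowerSum, map_sum, map_smul, Finset.smul_sum]
  rw [Finset.sum_comm]
  refine Finset.sum_congr rfl fun i _ => Finset.sum_congr rfl fun j _ => ?_
  rw [lower_comm, smul_comm]

theorem lowerSum_add {d : ℕ} (x : Fin (d + 1) → ℝ) (f g : PlantedSpan d) :
    lowerSum x (f + g) = lowerSum x f + lowerSum x g := by
  simp [lowerSum, Finset.sum_add_distrib]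

theorem lowerSum_sub {d : ℕ} (x : Fin (d + 1) → ℝ) (f g : PlantedSpan d) :
    lowerSum x (f - g) = lowerSum x f - lowerSum x g := by
  simp [lowerSum, Finset.sum_sub_distrib, smul_sub]

theorem lowerSum_smul {d : ℕ} (c : ℝ) (x : Fin (d + 1) → ℝ) (f : PlantedSpan d) :
    lowerSum x (c • f) = c • lowerSum x f := by
  simp only [lowerSum, Finset.smul_sum, map_smul]
  exact Finset.sum_congr rfl fun i _ => smul_comm _ _ _

theorem add_lowerSum {d : ℕ} (x y : Fin (d + 1) → ℝ) (f : PlantedSpan d) :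
    lowerSum (x + y) f = lowerSum x f + lowerSum y f := by
  simp [lowerSum, Finset.sum_add_distrib, add_smul]

theorem smul_lowerSum {d : ℕ} (c : ℝ) (x : Fin (d + 1) → ℝ) (f : PlantedSpan d) :
    lowerSum (c • x) f = c • lowerSum x f := by
  simp [lowerSum, Finset.smul_sum, mul_smul]

theorem zero_lowerSum {d : ℕ} (f : PlantedSpan d) : lowerSum 0 f = 0 := by simp [lowerSum]

/-- The Lie bracket `[·,·]_0`: planted trees commute, the `X_i` commute, and
`[I_a(τ), X_i]_0 = I_{a - e_i}(τ)`. -/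
noncomputable instance (d : ℕ) : Bracket (V d) (V d) where
  bracket u v := V.mk (lowerSum v.poly u.tree - lowerSum u.poly v.tree) 0

theorem V.bracket_def {d : ℕ} (u v : V d) :
    ⁅u, v⁆ = V.mk (lowerSum v.poly u.tree - lowerSum u.poly v.tree) 0 := rfl

noncomputable instance (d : ℕ) : LieRing (V d) where
  add_lie u v w := by
    refine V.ext' ?_ ?_
    · simp only [V.bracket_def, map_add, V.tree_mk, lowerSum_add, add_lowerSum]; abel
    · simp [V.bracket_def]
  lie_add u v w := by
    refine V.ext' ?_ ?_
    · simp only [V.bracket_def, map_add, V.tree_mk, lowerSum_add, add_lowerSum]; abel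
    · simp [V.bracket_def]
  lie_self u := by
    refine V.ext' ?_ ?_ <;> simp [V.bracket_def]
  leibniz_lie u v w := by
    refine V.ext' ?_ ?_
    · simp only [V.bracket_def, map_add, V.tree_mk, V.poly_mk, lowerSum_sub, zero_lowerSum]
      rw [lowerSum_comm (V.poly u) (V.poly w), lowerSum_comm (V.poly v) (V.poly w),
        lowerSum_comm (V.poly v) (V.poly u)]
      abel
    · simp [V.bracket_def]

noncomputable instance (d : ℕ) : LieAlgebra ℝ (V d) where
  lie_smul c u v := by
    refine V.ext' ?_ ?_
    · simp only [V.bracket_def, map_smul, V.tree_mk, lowerSum_smul, smul_lowerSum, smul_sub]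
    · simp [V.bracket_def]

/-- The post-Lie product on `𝒱`: `X_i ▷ I_a(τ) = I_a(↑^i τ)`, `I_a(τ) ▷ X_i = 0`,
`X_i ▷ X_j = 0` and `I_a(σ) ▷ I_b(τ) = I_a(σ) ↷̂ I_b(τ)`. -/
noncomputable def postLie {d : ℕ} (u v : V d) : V d :=
  V.mk (∑ i, u.poly i • raisePlanted i v.tree + hatGraftPlanted u.tree v.tree) 0

/-! ## The enveloping algebra `U(𝒱_0)` and the product `*` -/

attribute [local instance 100] LieRing.ofAssociativeRing

open scoped TensorProduct

/-- The universal enveloping algebra `U(𝒱_0)`. -/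
abbrev U (d : ℕ) : Type := UniversalEnvelopingAlgebra ℝ (V d)

/-- The inclusion of `𝒱` in `U(𝒱_0)`. -/
noncomputable def U.incl {d : ℕ} : V d →ₗ[ℝ] U d :=
  (UniversalEnvelopingAlgebra.ι ℝ : V d →ₗ⁅ℝ⁆ U d)

theorem U.incl_lie {d : ℕ} (u v : V d) :
    U.incl ⁅u, v⁆ = U.incl u * U.incl v - U.incl v * U.incl u := by
  change UniversalEnvelopingAlgebra.ι ℝ ⁅u, v⁆ = _
  rw [LieHom.map_lie, LieRing.of_associative_ring_bracket]
  rfl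

/-- The coproduct of `U(𝒱_0)`: the algebra morphism with `Δ x = x ⊗ 1 + 1 ⊗ x` for `x ∈ 𝒱`. -/
noncomputable def U.comul {d : ℕ} : U d →ₐ[ℝ] U d ⊗[ℝ] U d :=
  UniversalEnvelopingAlgebra.lift ℝ
    { toFun := fun x => U.incl x ⊗ₜ[ℝ] (1 : U d) + (1 : U d) ⊗ₜ[ℝ] U.incl x
      map_add' := fun x y => by
        simp only [map_add, TensorProduct.add_tmul, TensorProduct.tmul_add]; abel
      map_smul' := fun c x => by
        simp only [map_smul, RingHom.id_apply, smul_add, TensorProduct.smul_tmul',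
          TensorProduct.tmul_smul]
      map_lie' := fun {x y} => by
        simp only [U.incl_lie, LieRing.of_associative_ring_bracket, TensorProduct.sub_tmul,
          TensorProduct.tmul_sub, mul_add, add_mul, Algebra.TensorProduct.tmul_mul_tmul, one_mul,
          mul_one]
        abel }

/-- `T` is the extension of the post-Lie product `▷` of `𝒱` to `U(𝒱_0)`: it extends `▷`,
`x ▷ 1 = 0`, `x ▷ ·` is a derivation of `U(𝒱_0)` for `x ∈ 𝒱`, `1 ▷ A = A`,
`(x A) ▷ y = x ▷ (A ▷ y) - (x ▷ A) ▷ y` for `x, y ∈ 𝒱`, and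
`A ▷ (B C) = ∑ (A^{(1)} ▷ B) (A^{(2)} ▷ C)`. -/
structure IsPostLieExtension {d : ℕ} (T : U d →ₗ[ℝ] U d →ₗ[ℝ] U d) : Prop where
  incl_incl : ∀ x y : V d, T (U.incl x) (U.incl y) = U.incl (postLie x y)
  incl_one : ∀ x : V d, T (U.incl x) 1 = 0
  incl_mul : ∀ (x : V d) (B C : U d),
    T (U.incl x) (B * C) = T (U.incl x) B * C + B * T (U.incl x) C
  one_left : ∀ A : U d, T 1 A = A
  mul_left : ∀ (x : V d) (A : U d) (y : V d),
    T (U.incl x * A) (U.incl y) = T (U.incl x) (T A (U.incl y)) - T (T (U.incl x) A) (U.incl y)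
  mul_right : ∀ A B C : U d,
    T A (B * C) = LinearMap.mul' ℝ (U d) (TensorProduct.map (T.flip B) (T.flip C) (U.comul A))

/-- The product `A * B = ∑ A^{(1)} (A^{(2)} ▷ B)`, for the product `T = ▷` on `U(𝒱_0)`. -/
noncomputable def postLieStar {d : ℕ} (T : U d →ₗ[ℝ] U d →ₗ[ℝ] U d) (A B : U d) : U d :=
  LinearMap.mul' ℝ (U d) (TensorProduct.map LinearMap.id (T.flip B) (U.comul A))

/-- The ordered monomial `X_0^{k_0} ⋯ X_d^{k_d} I_{a_1}(σ_1) ⋯ I_{a_r}(σ_r)` in `U(𝒱_0)`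
attached to the tree `X^k ∏_i I_{a_i}(σ_i)` (the noises at the root are ignored). -/
noncomputable def orderedMonomial {d : ℕ} : Tree d → U d :=
  recOn (fun k _ => (List.ofFn fun i => U.incl (V.X i) ^ k i).prod)
    (fun a σ _ _ z => z * U.incl (V.planted a (Finsupp.single σ 1)))
    (by
      intro a σ x b ρ y τ z
      have h : ⁅(V.planted b (Finsupp.single ρ 1) : V d), V.planted a (Finsupp.single σ 1)⁆ = 0 := by
        refine V.ext' ?_ ?_ <;> simp [V.bracket_def, zero_lowerSum]
      have h' := U.incl_lie (V.planted b (Finsupp.single ρ 1) : V d)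
        (V.planted a (Finsupp.single σ 1))
      rw [h, map_zero] at h'
      simp only [mul_assoc]
      rw [sub_eq_zero.mp h'.symm])

/-- The linear extension of `orderedMonomial`. -/
noncomputable def pbw {d : ℕ} : TreeSpan d (Idx d) →ₗ[ℝ] U d :=
  Finsupp.linearCombination ℝ orderedMonomial

/-- The span of the trees `X^k ∏_i I_{a_i}(σ_i)`, which have no noise at the root. -/
noncomputable def positiveSpan (d : ℕ) : Submodule ℝ (TreeSpan d (Idx d)) :=
  Finsupp.supported ℝ ℝ {τ | rootNoise τ = 0}

/-! ## The product `⋆₂` -/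

/-- Trees whose edges carry a flag: `(a, true)` is an edge of decoration `a` created by a
grafting, `(a, false)` an edge of the original trees. -/
abbrev FlagTree (d : ℕ) : Type := ETree d (Idx d × Bool)

/-- The operator `↑^i_{N_τ}` on trees obtained from `τ` by graftings: it sums over the nodes of
`τ`, those that are not above a newly created edge. -/
noncomputable def raiseOld {d : ℕ} (i : Fin (d + 1)) :
    Module.End ℝ (TreeSpan d (Idx d × Bool)) :=
  Finsupp.linearCombination ℝ (nodeSum (fun e => !e.2) (raiseAt i))

/-- The deformed grafting of `σ`, with decoration `a`, onto the nodes in `N_τ` of a tree obtained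
from `τ` by graftings. -/
noncomputable def graftOld {d : ℕ} (a : Idx d) (σ : Tree d) :
    Module.End ℝ (TreeSpan d (Idx d × Bool)) :=
  Finsupp.linearCombination ℝ (nodeSum (fun e => !e.2)
    (graftAt (fun b => (b, true)) a (mapEdges (fun b => (b, false)) σ)))

theorem nodeSum_graftL {d : ℕ} {E : Type} (op : E → Bool) (φ : Idx d → ℕ → TreeSpan d E) (e : E)
    (x y : TreeSpan d E) :
    Finsupp.linearCombination ℝ (nodeSum op φ) (graftL e x y)
      = graftL e (if op e = true then Finsupp.linearCombination ℝ (nodeSum op φ) x else 0) y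
        + graftL e x (Finsupp.linearCombination ℝ (nodeSum op φ) y) := by
  induction x using Finsupp.induction_linear with
  | zero => simp
  | add x x' hx hx' =>
    simp only [map_add, LinearMap.add_apply, hx, hx']
    split_ifs <;> simp only [map_add, map_zero, LinearMap.add_apply, LinearMap.zero_apply] <;> abel
  | single σ a =>
    induction y using Finsupp.induction_linear with
    | zero => simp
    | add y y' hy hy' => simp only [map_add, hy, hy']; abel
    | single τ b =>
      have h (c : ℝ) (ρ : ETree d E) :
          (Finsupp.single ρ c : TreeSpan d E) = c • Finsupp.single ρ 1 := by simp
      rw [graftL_single, Finsupp.linearCombination_single, Finsupp.linearCombination_single,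
        Finsupp.linearCombination_single, nodeSum, recOn_graft, h a σ, h b τ]
      split_ifs <;>
        simp only [map_smul, LinearMap.smul_apply, smul_add, smul_smul, map_zero,
          LinearMap.zero_apply, zero_add, smul_zero, mul_comm a b]

theorem nodeSum_comm {d : ℕ} {E : Type} (op : E → Bool) (φ ψ : Idx d → ℕ → TreeSpan d E)
    (h : ∀ n m, Finsupp.linearCombination ℝ (nodeSum op φ) (ψ n m)
      = Finsupp.linearCombination ℝ (nodeSum op ψ) (φ n m)) (x : TreeSpan d E) :
    Finsupp.linearCombination ℝ (nodeSum op φ) (Finsupp.linearCombination ℝ (nodeSum op ψ) x)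
      = Finsupp.linearCombination ℝ (nodeSum op ψ)
          (Finsupp.linearCombination ℝ (nodeSum op φ) x) := by
  induction x using Finsupp.induction_linear with
  | zero => simp
  | add x x' hx hx' => simp only [map_add, hx, hx']
  | single τ c =>
    rw [← mul_one c, ← smul_eq_mul, ← Finsupp.smul_single, map_smul, map_smul, map_smul, map_smul]
    congr 1
    induction τ using ETree.induct with
    | hr n m => simpa [nodeSum] using h n m
    | hg e σ τ hσ hτ =>
      have h2 : (Finsupp.single (graft e σ τ) 1 : TreeSpan d E)
          = graftL e (Finsupp.single σ 1) (Finsupp.single τ 1) := by simp [graftL_single]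
      rw [h2]
      simp only [nodeSum_graftL, map_add, hτ]
      split_ifs
      · rw [hσ]; abel
      · simp only [map_zero, LinearMap.zero_apply, zero_add]

theorem choose_swap (n l k : ℕ) :
    n.choose l * (n - l).choose k = n.choose k * (n - k).choose l := by
  have h1 := Nat.choose_mul (n := n) (k := l + k) (s := l) (Nat.le_add_right _ _)
  have h2 := Nat.choose_mul (n := n) (k := l + k) (s := k) (Nat.le_add_left _ _)
  rw [Nat.add_sub_cancel_left] at h1
  rw [Nat.add_sub_cancel] at h2
  rw [← h1, ← h2, Nat.choose_symm_add]

theorem graftOld_comm {d : ℕ} (a b : Idx d) (σ ρ : Tree d) :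
    graftOld a σ * graftOld b ρ = graftOld b ρ * graftOld a σ := by
  refine LinearMap.ext fun x => nodeSum_comm _ _ _ (fun n m => ?_) x
  simp only [graftAt, map_sum, map_smul, Finsupp.linearCombination_single, nodeSum,
    recOn_graft, recOn_root, Bool.not_true, Bool.false_eq_true, if_false, zero_add,
    graftL_single, Finset.smul_sum, smul_smul, mul_one]
  rw [Finset.sum_comm]
  refine Finset.sum_congr rfl fun l _ => Finset.sum_congr rfl fun k _ => ?_
  rw [graft_comm, tsub_right_comm]
  congr 1
  rw [one_mul, one_mul, ← Nat.cast_mul, ← Nat.cast_mul, idxChoose, idxChoose, idxChoose, idxChoose,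
    ← Finset.prod_mul_distrib, ← Finset.prod_mul_distrib]
  exact congrArg _ (Finset.prod_congr rfl fun i _ => choose_swap _ _ _)

/-- The operator `τ ↦ ↑̃^k_{N_τ} (∏_i I_{a_i}(σ_i) ↷̂ τ)` attached to `σ = X^k ∏_i I_{a_i}(σ_i)`:
every `I_{a_i}(σ_i)` is grafted onto the nodes of `τ`, then
`↑̃^k_{N_τ} = ∏_i (↑^i_{N_τ})^{k_i} = ∑_{k = ∑_v k_v} (k! / ∏_v k_v!) ∏_v ↑^{k_v}_v` is applied. -/
noncomputable def insertion {d : ℕ} : Tree d → Module.End ℝ (TreeSpan d (Idx d × Bool)) :=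
  recOn (fun k _ => (List.ofFn fun i => raiseOld i ^ k i).prod)
    (fun a σ _ _ z => z * graftOld a σ)
    (by
      intro a σ x b ρ y τ z
      rw [mul_assoc, mul_assoc, graftOld_comm])

/-- The product `⋆₂`: `I_b(σ ⋆₂ τ) = ↑̃^k_{N_τ} (∏_i I_{a_i}(σ_i) ↷̂ I_b(τ))` for
`σ = X^k ∏_i I_{a_i}(σ_i)`; all edges of `τ` are original ones, and the flags are forgotten at the
end. -/
noncomputable def starTwo {d : ℕ} :
    TreeSpan d (Idx d) →ₗ[ℝ] TreeSpan d (Idx d) →ₗ[ℝ] TreeSpan d (Idx d) :=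
  Finsupp.linearCombination ℝ (fun σ : Tree d =>
    (Finsupp.lmapDomain ℝ ℝ (mapEdges Prod.fst)).comp
      ((insertion σ).comp (Finsupp.lmapDomain ℝ ℝ (mapEdges fun b => (b, false)))))

/-! ## The coproduct `Δ₂` -/

/-- The coproduct `Δ₂`, given by `Δ₂(τ τ') = Δ₂(τ) Δ₂(τ')`, `Δ₂ Ξ = Ξ ⊗ 1`,
`Δ₂ X_i = X_i ⊗ 1 + 1 ⊗ X_i` and
`Δ₂ I_a(τ) = (I_a ⊗ id) Δ₂ τ + ∑_{ℓ ∈ ℕ^{d+1}} X^ℓ / ℓ! ⊗ I_{a+ℓ}(τ)`,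
is a formal infinite series. This is its truncation to the `ℓ` with all `ℓ_i ≤ N`. The tensor
product of two copies of the span of the trees is the algebra of the monoid of pairs of trees,
`(τ, σ)` standing for `τ ⊗ σ`. -/
noncomputable def deltaTwo {d : ℕ} (N : ℕ) : Tree d → MonoidAlgebra ℝ (Tree d × Tree d) :=
  recOn
    (fun n m => ∑ j ∈ Finset.Iic n, MonoidAlgebra.single (root j m, root (n - j) 0)
      (idxChoose n j : ℝ))
    (fun a σ x _ z =>
      (MonoidAlgebra.mapDomain (Prod.map (plant a) id) x
        + ∑ l ∈ Finset.Iic (fun _ => N : Idx d),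
            MonoidAlgebra.single (root l 0, plant (a + l) σ) ((idxFactorial l : ℝ)⁻¹)) * z)
    (fun _ _ _ _ _ _ _ _ => mul_left_comm _ _ _)

/-- `m` is dual to `Δ₂` (with trunk as the left leg): `⟨ρ, m(σ, τ)⟩ = ⟨Δ₂ ρ, τ ⊗ σ⟩` for the
pairing `⟨σ, τ⟩ = S(τ)` if `σ = τ` and `0` otherwise. Each coefficient of the truncations of
`Δ₂ ρ` is eventually constant, which gives the coefficient of the formal series. -/
def IsDualToDeltaTwo {d : ℕ}
    (m : TreeSpan d (Idx d) →ₗ[ℝ] TreeSpan d (Idx d) →ₗ[ℝ] TreeSpan d (Idx d)) : Prop :=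
  ∀ σ τ ρ : Tree d, rootNoise σ = 0 → ∀ᶠ N : ℕ in Filter.atTop,
    (symFactor ρ : ℝ) * m (Finsupp.single σ 1) (Finsupp.single τ 1) ρ
      = (symFactor τ : ℝ) * (symFactor σ : ℝ) * (deltaTwo N ρ).coeff (τ, σ)

end RegTrees

namespace RegTrees

open ETree WithConv
open scoped TensorProduct

attribute [local instance 100] LieRing.ofAssociativeRing

variable {d : ℕ} {E E' : Type}

/-! Everything rests on one representation. An element of `𝒱` acts on trees by summing a local
operation over nodes: `X_i` raises a decoration, `I_a(σ)` performs a deformed grafting. The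
commutator of two such sums is again such a sum, determined by one-node trees (`nodeOp_lie`). There,
Pascal's rule and the symmetry of `(n choose l) (n - l choose k)` give exactly the relations of
`𝒱_0`, provided that no operator enters the branches grafted by another. Flagging new edges ensures
this, so `U(𝒱_0)` acts on flagged trees (`oldRep`). Forgetting the flags gives `insertOp A`, and
`⋆₂` is the insertion of ordered monomials (`starTwo_eq_insertOp`).

With the root as the only node acted upon, the same construction gives `rootRep`. Acting on the tree
`1` recovers a tree from its ordered monomial, and a straightening argument shows that these
monomials span; this is the isomorphism `𝒯_+ ≅ U(𝒱_0)`.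

For the extension, `B ↦ (A ↦ A ▷ B)` has to be an algebra morphism from `U(𝒱_0)` to the convolution
algebra of its endomorphisms. The Lie morphism sending `I_b(τ)` to `A ↦ I_b(insertOp A τ)` and `X_i`
to `A ↦ ε(A) X_i` produces it (`extHom`), and statement 4 becomes true by construction. The axiom
for `(xA) ▷ y` says that acting on old nodes is acting on all nodes minus acting on new ones
(`insertOp_incl_mul`). Uniqueness on `𝒱` is an induction on the number of factors of `A`; the value
`A ▷ 1 = ε(A)` then follows by cancelling `X_0`.

For `*`, both `pbw (insertOp A x)` and `A * pbw x` are computed branch by branch: the nodes of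
`I_a(σ) τ` are those of `σ` and those of `τ`, so `A` distributes by its coproduct
(`insertOp_graftL`), and cocommutativity reconciles the orders of the factors (`pbw_insertOp`).

For duality, the coefficients `A ↦ ⟨ρ, insertOp A x⟩` lie in the convolution algebra dual to
`U(𝒱_0)`. The tree product is adjoint to the coproduct `split` (`pairing_mul`), for which `𝒱` acts
by coderivations (`split_oldRep`). So these coefficients, like `Δ₂`, are multiplicative in `ρ`, and
only one-node and planted `ρ` have to be compared (`insertCoeff_root`,
`eventually_insertCoeff_plant`). -/

theorem TreeSpan.hom_ext {W : Type*} [AddCommMonoid W] [Module ℝ W]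
    {f g : TreeSpan d E →ₗ[ℝ] W}
    (h : ∀ τ, f (Finsupp.single τ 1) = g (Finsupp.single τ 1)) : f = g :=
  Finsupp.lhom_ext' fun τ => LinearMap.ext_ring (h τ)

theorem single_graft (e : E) (σ τ : ETree d E) :
    (Finsupp.single (graft e σ τ) 1 : TreeSpan d E)
      = graftL e (Finsupp.single σ 1) (Finsupp.single τ 1) := by
  simp [graftL_single]

/-- Linear maps on the span of trees can be compared by induction on trees. -/
theorem TreeSpan.hom_induct {W : Type*} [AddCommMonoid W] [Module ℝ W]
    {f g : TreeSpan d E →ₗ[ℝ] W}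
    (hr : ∀ n m, f (Finsupp.single (root n m) 1) = g (Finsupp.single (root n m) 1))
    (hg : ∀ e σ τ, f (Finsupp.single σ 1) = g (Finsupp.single σ 1) →
      f (Finsupp.single τ 1) = g (Finsupp.single τ 1) →
      f (graftL e (Finsupp.single σ 1) (Finsupp.single τ 1))
        = g (graftL e (Finsupp.single σ 1) (Finsupp.single τ 1))) : f = g :=
  TreeSpan.hom_ext fun τ => by
    induction τ using ETree.induct with
    | hr n m => exact hr n m
    | hg e σ τ hσ hτ => rw [single_graft]; exact hg e σ τ hσ hτ

/-! ## Operators summing over nodes -/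

/-- The linear operator of `nodeSum op φ`, linear in the local operation `φ`. -/
noncomputable def nodeOp (op : E → Bool) :
    (Idx d → ℕ → TreeSpan d E) →ₗ[ℝ] Module.End ℝ (TreeSpan d E) where
  toFun φ := Finsupp.linearCombination ℝ (nodeSum op φ)
  map_add' φ ψ := by
    refine TreeSpan.hom_induct (fun n m => ?_) fun e σ τ hσ hτ => ?_
    · simp [nodeSum]
    · simp only [nodeSum_graftL, LinearMap.add_apply] at hσ hτ ⊢
      rw [hσ, hτ]
      split_ifs <;> simp only [map_add, map_zero, LinearMap.add_apply, LinearMap.zero_apply] <;> abel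
  map_smul' c φ := by
    refine TreeSpan.hom_induct (fun n m => ?_) fun e σ τ hσ hτ => ?_
    · simp [nodeSum]
    · simp only [nodeSum_graftL, LinearMap.smul_apply, RingHom.id_apply] at hσ hτ ⊢
      rw [hσ, hτ]
      split_ifs <;> simp only [map_smul, map_zero, LinearMap.smul_apply, LinearMap.zero_apply,
        smul_add, smul_zero]

@[simp] theorem nodeOp_single (op : E → Bool) (φ : Idx d → ℕ → TreeSpan d E) (τ : ETree d E) :
    nodeOp op φ (Finsupp.single τ 1) = nodeSum op φ τ := by
  simp [nodeOp]

theorem nodeOp_root (op : E → Bool) (φ : Idx d → ℕ → TreeSpan d E) (n : Idx d) (m : ℕ) :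
    nodeOp op φ (Finsupp.single (root n m) 1) = φ n m := by
  simp [nodeSum]

theorem nodeOp_graftL (op : E → Bool) (φ : Idx d → ℕ → TreeSpan d E) (e : E)
    (x y : TreeSpan d E) :
    nodeOp op φ (graftL e x y)
      = graftL e (if op e = true then nodeOp op φ x else 0) y + graftL e x (nodeOp op φ y) :=
  nodeSum_graftL op φ e x y

theorem nodeOp_graftL_of_false {op : E → Bool} (φ : Idx d → ℕ → TreeSpan d E) {e : E}
    (he : op e = false) (x y : TreeSpan d E) :
    nodeOp op φ (graftL e x y) = graftL e x (nodeOp op φ y) := by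
  simp [nodeOp_graftL, he]

theorem nodeOp_graftL_of_true {op : E → Bool} (φ : Idx d → ℕ → TreeSpan d E) {e : E}
    (he : op e = true) (x y : TreeSpan d E) :
    nodeOp op φ (graftL e x y) = graftL e (nodeOp op φ x) y + graftL e x (nodeOp op φ y) := by
  simp [nodeOp_graftL, he]

/-- The commutator of two operators summing over nodes is given by its values on one-node trees. -/
theorem nodeOp_lie (op op' : E → Bool) (φ ψ χ : Idx d → ℕ → TreeSpan d E)
    (h : ∀ n m, nodeOp op φ (ψ n m) - nodeOp op' ψ (φ n m) = χ n m) :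
    nodeOp op φ * nodeOp op' ψ - nodeOp op' ψ * nodeOp op φ
      = nodeOp (fun e => op e && op' e) χ := by
  refine TreeSpan.hom_induct (fun n m => ?_) fun e σ τ hσ hτ => ?_
  · simp only [LinearMap.sub_apply, Module.End.mul_apply, nodeOp_root, h]
  · simp only [LinearMap.sub_apply, Module.End.mul_apply] at hσ hτ ⊢
    rw [nodeOp_graftL _ χ, ← hσ, ← hτ]
    -- Actions on `σ` and on `τ` commute, so the branch `σ` contributes a commutator exactly when
    -- both operators enter it.
    cases h1 : op e <;> cases h2 : op' e <;>
      simp only [nodeOp_graftL, h1, h2, if_true, if_false, map_add, map_sub, map_zero,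
        LinearMap.zero_apply, LinearMap.sub_apply, Bool.and_true, Bool.and_false,
        Bool.false_eq_true] <;> abel

/-! ## The local operations of the elements of `𝒱` -/

/-- The local operation of the deformed grafting, linear in the grafted tree. -/
noncomputable def graftAtL (mk : Idx d → E) (a : Idx d) :
    TreeSpan d E →ₗ[ℝ] (Idx d → ℕ → TreeSpan d E) where
  toFun s n m := ∑ l ∈ Finset.Iic a,
    (idxChoose n l : ℝ) • graftL (mk (a - l)) s (Finsupp.single (root (n - l) m) 1)
  map_add' s t := by
    ext1 n; ext1 m
    simp [Finset.sum_add_distrib]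
  map_smul' c s := by
    ext1 n; ext1 m
    simp only [map_smul, LinearMap.smul_apply, RingHom.id_apply, Pi.smul_apply, Finset.smul_sum]
    exact Finset.sum_congr rfl fun l _ => smul_comm _ _ _

theorem graftAtL_apply (mk : Idx d → E) (a : Idx d) (s : TreeSpan d E) (n : Idx d) (m : ℕ) :
    graftAtL mk a s n m = ∑ l ∈ Finset.Iic a,
      (idxChoose n l : ℝ) • graftL (mk (a - l)) s (Finsupp.single (root (n - l) m) 1) := rfl

theorem graftAtL_single (mk : Idx d → E) (a : Idx d) (σ : ETree d E) :
    graftAtL mk a (Finsupp.single σ 1) = graftAt mk a σ := by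
  ext1 n; ext1 m
  simp [graftAtL_apply, graftAt, graftL_single]

theorem idxChoose_eq_zero {n l : Idx d} (h : ¬ l ≤ n) : idxChoose n l = 0 := by
  simp only [Pi.le_def, not_forall, not_le] at h
  obtain ⟨i, hi⟩ := h
  exact Finset.prod_eq_zero (Finset.mem_univ i) (Nat.choose_eq_zero_of_lt hi)

theorem idxChoose_zero_right (n : Idx d) : idxChoose n 0 = 1 := by simp [idxChoose]

theorem unitIdx_le {a : Idx d} {i : Fin (d + 1)} : unitIdx i ≤ a ↔ a i ≠ 0 := by
  constructor
  · intro h h0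
    have := h i
    simp [unitIdx, h0] at this
  · intro h j
    by_cases hj : j = i
    · subst hj; simp [unitIdx]; omega
    · simp [unitIdx, hj]

/-- Pascal's rule in the coordinate `i`, the other factors being unchanged. It is the source of the
bracket `[I_a(τ), X_i]_0 = I_{a - e_i}(τ)`. -/
theorem idxChoose_add_unitIdx (n l : Idx d) (i : Fin (d + 1)) :
    idxChoose (n + unitIdx i) (l + unitIdx i) = idxChoose n l + idxChoose n (l + unitIdx i) := by
  have key (f : Fin (d + 1) → ℕ) : ∏ j, f j = f i * ∏ j ∈ Finset.univ.erase i, f j :=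
    (Finset.mul_prod_erase _ _ (Finset.mem_univ i)).symm
  have hc (p q : Idx d) (u v : Idx d) (hu : ∀ j ≠ i, u j = p j) (hv : ∀ j ≠ i, v j = q j) :
      ∏ j ∈ Finset.univ.erase i, (u j).choose (v j)
        = ∏ j ∈ Finset.univ.erase i, (p j).choose (q j) :=
    Finset.prod_congr rfl fun j hj => by
      rw [hu j (Finset.ne_of_mem_erase hj), hv j (Finset.ne_of_mem_erase hj)]
  have hu (p : Idx d) : ∀ j ≠ i, (p + unitIdx i) j = p j := fun j hj => by simp [unitIdx, hj]
  unfold idxChoose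
  rw [key, key (fun j => (n j).choose (l j)), key (fun j => (n j).choose ((l + unitIdx i) j)),
    hc n l _ _ (hu n) (hu l), hc n l _ _ (fun _ _ => rfl) (hu l), ← add_mul]
  simp [unitIdx, Nat.choose_succ_succ]

theorem idxChoose_add_unitIdx_of_eq_zero (n l : Idx d) (i : Fin (d + 1)) (h : l i = 0) :
    idxChoose (n + unitIdx i) l = idxChoose n l :=
  Finset.prod_congr rfl fun j _ => by
    by_cases hj : j = i
    · subst hj; simp [h]
    · simp [unitIdx, hj]

/-- The sum over `l ≤ a` with `l_i ≠ 0` is a sum over `l ≤ a - e_i`. -/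
theorem sum_Iic_unitIdx {W : Type*} [AddCommMonoid W] (a : Idx d) (i : Fin (d + 1))
    (f : Idx d → W) :
    (∑ l ∈ Finset.Iic a, if l i = 0 then 0 else f (l - unitIdx i))
      = if a i = 0 then 0 else ∑ l ∈ Finset.Iic (a - unitIdx i), f l := by
  split_ifs with ha
  · refine Finset.sum_eq_zero fun l hl => if_pos ?_
    have : l i ≤ a i := Finset.mem_Iic.mp hl i
    omega
  · have h : (∑ l ∈ Finset.Iic a, if l i = 0 then 0 else f (l - unitIdx i))
        = ∑ l ∈ (Finset.Iic a).filter (fun l => ¬ l i = 0), f (l - unitIdx i) := by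
      rw [Finset.sum_filter]
      exact Finset.sum_congr rfl fun l _ => by split_ifs <;> rfl
    rw [h]
    have hua := unitIdx_le.mpr ha
    refine Finset.sum_bij' (fun l _ => l - unitIdx i) (fun l _ => l + unitIdx i) ?_ ?_ ?_ ?_ ?_
    · intro l hl
      simp only [Finset.mem_filter, Finset.mem_Iic] at hl ⊢
      exact tsub_le_tsub_right hl.1 _
    · intro l hl
      simp only [Finset.mem_filter, Finset.mem_Iic] at hl ⊢
      exact ⟨(le_tsub_iff_right hua).mp hl, by simp [unitIdx]⟩
    · intro l hl
      exact tsub_add_cancel_of_le (unitIdx_le.mpr (Finset.mem_filter.mp hl).2)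
    · intro l _
      exact add_tsub_cancel_right _ _
    · intro l _; rfl

/-- Raising before grafting produces `(n + e_i choose l)`, raising afterwards `(n choose l)`. By
Pascal's rule the difference is `(n choose l - e_i)`, and shifting `l` turns this into the grafting
with decoration `a - e_i`. The condition on `mk` keeps the raising out of the grafted branch. -/
theorem nodeOp_graftAtL_raiseAt (op op' : E → Bool) (mk : Idx d → E)
    (hmk : ∀ b, op' (mk b) = false) (a : Idx d) (s : TreeSpan d E) (i : Fin (d + 1)) (n : Idx d)
    (m : ℕ) :
    nodeOp op (graftAtL mk a s) (raiseAt i n m) - nodeOp op' (raiseAt i) (graftAtL mk a s n m)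
      = (if a i = 0 then 0 else graftAtL mk (a - unitIdx i) s) n m := by
  have hrhs : (if a i = 0 then 0 else graftAtL mk (a - unitIdx i) s) n m
      = if a i = 0 then 0 else graftAtL mk (a - unitIdx i) s n m := by split_ifs <;> rfl
  rw [hrhs, graftAtL_apply, graftAtL_apply, ← sum_Iic_unitIdx a i (fun l => (idxChoose n l : ℝ) •
    graftL (mk (a - unitIdx i - l)) s (Finsupp.single (root (n - l) m) 1)), raiseAt, nodeOp_root,
    graftAtL_apply, map_sum, ← Finset.sum_sub_distrib]
  refine Finset.sum_congr rfl fun l _ => ?_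
  rw [map_smul, nodeOp_graftL_of_false _ (hmk _), nodeOp_root, raiseAt]
  -- The truncated differences agree only for `l ≤ n`; otherwise the binomial coefficient vanishes.
  have h1 : (idxChoose n l : ℝ) • graftL (mk (a - l)) s
        (Finsupp.single (root (n - l + unitIdx i) m) 1)
      = (idxChoose n l : ℝ) • graftL (mk (a - l)) s
        (Finsupp.single (root (n + unitIdx i - l) m) 1) := by
    by_cases hl : l ≤ n
    · rw [tsub_add_eq_add_tsub hl]
    · simp [idxChoose_eq_zero hl]
  rw [h1, ← sub_smul]
  split_ifs with hli
  · rw [idxChoose_add_unitIdx_of_eq_zero _ _ _ hli, sub_self, zero_smul]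
  · obtain ⟨k, rfl⟩ : ∃ k, l = k + unitIdx i :=
      ⟨l - unitIdx i, (tsub_add_cancel_of_le (unitIdx_le.mpr hli)).symm⟩
    rw [idxChoose_add_unitIdx, add_tsub_cancel_right, add_tsub_add_eq_tsub_right, tsub_tsub,
      add_comm (unitIdx i) k]
    push_cast
    rw [add_sub_cancel_right]

/-- Two graftings at the same node commute, because `(n choose l) (n - l choose k)` is symmetric in
`l` and `k`. What is left is the grafting of `s` onto the nodes of `t`, present only where `op`
crosses the edge that carries `t`. -/
theorem nodeOp_graftAtL_graftAtL (op op' : E → Bool) (mk mk' : Idx d → E)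
    (hmk : ∀ b, op' (mk b) = false) (a b : Idx d) (s t : TreeSpan d E) (n : Idx d) (m : ℕ) :
    nodeOp op (graftAtL mk a s) (graftAtL mk' b t n m)
        - nodeOp op' (graftAtL mk' b t) (graftAtL mk a s n m)
      = ∑ l ∈ Finset.Iic b, (idxChoose n l : ℝ) • graftL (mk' (b - l))
          (if op (mk' (b - l)) = true then nodeOp op (graftAtL mk a s) t else 0)
          (Finsupp.single (root (n - l) m) 1) := by
  have h (mk mk' : Idx d → E) (a b : Idx d) (s t : TreeSpan d E) :
      (∑ l ∈ Finset.Iic b, (idxChoose n l : ℝ) • graftL (mk' (b - l)) t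
          (graftAtL mk a s (n - l) m))
        = ∑ l ∈ Finset.Iic b, ∑ k ∈ Finset.Iic a, ((idxChoose n l * idxChoose (n - l) k : ℕ) : ℝ) •
          graftL (mk' (b - l)) t (graftL (mk (a - k)) s (Finsupp.single (root (n - l - k) m) 1)) := by
    refine Finset.sum_congr rfl fun l _ => ?_
    rw [graftAtL_apply, map_sum, Finset.smul_sum]
    refine Finset.sum_congr rfl fun k _ => ?_
    rw [map_smul, smul_smul, Nat.cast_mul]
  have h1 : nodeOp op (graftAtL mk a s) (graftAtL mk' b t n m)
      = (∑ l ∈ Finset.Iic b, (idxChoose n l : ℝ) • graftL (mk' (b - l))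
          (if op (mk' (b - l)) = true then nodeOp op (graftAtL mk a s) t else 0)
          (Finsupp.single (root (n - l) m) 1))
        + ∑ l ∈ Finset.Iic b, (idxChoose n l : ℝ) • graftL (mk' (b - l)) t
          (graftAtL mk a s (n - l) m) := by
    rw [graftAtL_apply mk' b t n m, map_sum, ← Finset.sum_add_distrib]
    exact Finset.sum_congr rfl fun l _ => by
      rw [map_smul, nodeOp_graftL, nodeOp_root, smul_add]
  have h2 : nodeOp op' (graftAtL mk' b t) (graftAtL mk a s n m)
      = ∑ l ∈ Finset.Iic a, (idxChoose n l : ℝ) • graftL (mk (a - l)) s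
          (graftAtL mk' b t (n - l) m) := by
    rw [graftAtL_apply mk a s n m, map_sum]
    exact Finset.sum_congr rfl fun l _ => by
      rw [map_smul, nodeOp_graftL_of_false _ (hmk _), nodeOp_root]
  rw [h1, h2, h, h, Finset.sum_comm (s := Finset.Iic b), add_sub_assoc, sub_eq_zero.mpr, add_zero]
  refine Finset.sum_congr rfl fun l _ => Finset.sum_congr rfl fun k _ => ?_
  rw [graftL_comm, tsub_right_comm]
  congr 2
  simp only [idxChoose, ← Finset.prod_mul_distrib]
  exact Finset.prod_congr rfl fun i _ => choose_swap _ _ _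

/-- The element `u` of `𝒱` acts at a node: `X_i` raises its decoration, and `I_a(σ)` grafts `σ`,
with its edges relabelled by `inc`, along an edge labelled by `mk`. -/
noncomputable def localOp (mk : Idx d → E) (inc : TreeSpan d (Idx d) →ₗ[ℝ] TreeSpan d E) :
    V d →ₗ[ℝ] (Idx d → ℕ → TreeSpan d E) :=
  (Fintype.linearCombination ℝ (fun i => (raiseAt i : Idx d → ℕ → TreeSpan d E))).comp V.poly
    + (Finsupp.linearCombination ℝ (fun p : Idx d × Tree d =>
        graftAtL mk p.1 (inc (Finsupp.single p.2 1)))).comp V.tree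

@[simp] theorem localOp_X (mk : Idx d → E) (inc : TreeSpan d (Idx d) →ₗ[ℝ] TreeSpan d E)
    (i : Fin (d + 1)) : localOp mk inc (V.X i) = raiseAt i := by
  simp [localOp, V.X, Fintype.linearCombination_apply_single]

@[simp] theorem V.tree_planted (b : Idx d) (x : TreeSpan d (Idx d)) :
    V.tree (V.planted b x) = plantL b x := rfl

@[simp] theorem localOp_planted (mk : Idx d → E) (inc : TreeSpan d (Idx d) →ₗ[ℝ] TreeSpan d E)
    (a : Idx d) (x : TreeSpan d (Idx d)) :
    localOp mk inc (V.planted a x) = graftAtL mk a (inc x) := by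
  have : (localOp mk inc).comp (V.planted a) = (graftAtL mk a).comp inc :=
    TreeSpan.hom_ext fun τ => by simp [localOp, plantL]
  exact LinearMap.congr_fun this x

@[elab_as_elim]
theorem V.induction {P : V d → Prop} (planted : ∀ a σ, P (V.planted a (Finsupp.single σ 1)))
    (X : ∀ i, P (V.X i)) (add : ∀ u v, P u → P v → P (u + v)) (smul : ∀ (c : ℝ) u, P u → P (c • u))
    (u : V d) : P u := by
  have h0 : P 0 := by simpa using smul 0 _ (X 0)
  have h1 (f : PlantedSpan d) : P (V.mk f 0) := by
    induction f using Finsupp.induction_linear with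
    | zero => exact h0
    | add f g hf hg =>
      convert add _ _ hf hg using 1
      exact V.ext' rfl (by simp)
    | single p c =>
      convert smul c _ (planted p.1 p.2) using 1
      exact V.ext' (by simp [plantL]) (by simp)
  have h2 (x : Fin (d + 1) → ℝ) : P (V.mk 0 x) := by
    have : V.mk 0 x = ∑ i, x i • (V.X i : V d) := by
      refine V.ext' ?_ ?_
      · simp [V.X]
      · ext j; simp [V.X, Pi.single_apply]
    rw [this]
    exact Finset.sum_induction _ P add h0 fun i _ => smul _ _ (X i)
  have : u = V.mk u.tree 0 + V.mk 0 u.poly := V.ext' (by simp) (by simp)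
  rw [this]
  exact add _ _ (h1 _) (h2 _)

theorem V.lie_planted_planted (a b : Idx d) (x y : TreeSpan d (Idx d)) :
    ⁅(V.planted a x : V d), V.planted b y⁆ = 0 := by
  refine V.ext' ?_ ?_ <;> simp [V.bracket_def, zero_lowerSum]

theorem V.lie_X_X (i j : Fin (d + 1)) : ⁅(V.X i : V d), V.X j⁆ = 0 := by
  refine V.ext' ?_ ?_ <;> simp [V.bracket_def, V.X, lowerSum]

theorem lower_plantL (a : Idx d) (x : TreeSpan d (Idx d)) (i : Fin (d + 1)) :
    lower i (plantL a x) = if a i = 0 then 0 else plantL (a - unitIdx i) x := by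
  have : (lower i).comp (plantL a) = if a i = 0 then 0 else plantL (a - unitIdx i) :=
    TreeSpan.hom_ext fun τ => by
      by_cases h : a i = 0 <;> simp [lower, plantL, h]
  have := LinearMap.congr_fun this x
  split_ifs at this ⊢ <;> exact this

theorem V.lie_planted_X (a : Idx d) (x : TreeSpan d (Idx d)) (i : Fin (d + 1)) :
    ⁅(V.planted a x : V d), V.X i⁆ = if a i = 0 then 0 else V.planted (a - unitIdx i) x := by
  refine V.ext' ?_ ?_
  · have : V.tree ⁅(V.planted a x : V d), V.X i⁆ = lower i (plantL a x) := by
      simp [V.bracket_def, V.X, lowerSum, Pi.single_apply]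
    rw [this, lower_plantL]
    split_ifs <;> simp
  · split_ifs <;> simp [V.bracket_def]

/-- A linear map on `𝒱_0` that respects the bracket of generators is a Lie morphism. -/
def V.lieHom {A : Type*} [Ring A] [Algebra ℝ A] (r : V d →ₗ[ℝ] A)
    (hpp : ∀ a σ b τ, r (V.planted a (Finsupp.single σ 1)) * r (V.planted b (Finsupp.single τ 1))
      = r (V.planted b (Finsupp.single τ 1)) * r (V.planted a (Finsupp.single σ 1)))
    (hXX : ∀ i j, r (V.X i) * r (V.X j) = r (V.X j) * r (V.X i))
    (hpX : ∀ a σ i, r (V.planted a (Finsupp.single σ 1)) * r (V.X i)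
        - r (V.X i) * r (V.planted a (Finsupp.single σ 1))
      = if a i = 0 then 0 else r (V.planted (a - unitIdx i) (Finsupp.single σ 1))) :
    V d →ₗ⁅ℝ⁆ A where
  toLinearMap := r
  map_lie' {u v} := by
    change r ⁅u, v⁆ = r u * r v - r v * r u
    have hpX' (a σ i) : r ⁅(V.planted a (Finsupp.single σ 1) : V d), V.X i⁆
        = r (V.planted a (Finsupp.single σ 1)) * r (V.X i)
          - r (V.X i) * r (V.planted a (Finsupp.single σ 1)) := by
      rw [hpX, V.lie_planted_X, apply_ite r, map_zero]
    induction u using V.induction with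
    | add u u' hu hu' => rw [add_lie, map_add, hu, hu', map_add, add_mul, mul_add]; abel
    | smul c u hu =>
      rw [smul_lie, map_smul, hu, map_smul, smul_mul_assoc, mul_smul_comm, smul_sub]
    | planted a σ =>
      induction v using V.induction with
      | add v v' hv hv' => rw [lie_add, map_add, hv, hv', map_add, add_mul, mul_add]; abel
      | smul c v hv =>
        rw [lie_smul, map_smul, hv, map_smul, smul_mul_assoc, mul_smul_comm, smul_sub]
      | planted b τ => rw [hpp, sub_self, V.lie_planted_planted, map_zero]
      | X i => exact hpX' a σ i
    | X i =>
      induction v using V.induction with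
      | add v v' hv hv' => rw [lie_add, map_add, hv, hv', map_add, add_mul, mul_add]; abel
      | smul c v hv =>
        rw [lie_smul, map_smul, hv, map_smul, smul_mul_assoc, mul_smul_comm, smul_sub]
      | planted b τ => rw [← lie_skew, map_neg, hpX', neg_sub]
      | X j => rw [hXX, sub_self, V.lie_X_X, map_zero]

theorem nodeOp_raiseAt_raiseAt (op op' : E → Bool) (i j : Fin (d + 1)) (n : Idx d) (m : ℕ) :
    nodeOp op (raiseAt i) (raiseAt j n m) - nodeOp op' (raiseAt j) (raiseAt i n m) = 0 := by
  rw [raiseAt, raiseAt, nodeOp_root, nodeOp_root, raiseAt, raiseAt, add_right_comm, sub_self]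

/-- The representation of `𝒱_0` by operators that sum over the nodes below the edges `mk a`. -/
noncomputable def nodeRep (op : E → Bool) (mk : Idx d → E) (hmk : ∀ b, op (mk b) = false)
    (inc : TreeSpan d (Idx d) →ₗ[ℝ] TreeSpan d E) :
    V d →ₗ⁅ℝ⁆ Module.End ℝ (TreeSpan d E) :=
  V.lieHom ((nodeOp op).comp (localOp mk inc))
    (fun a σ b τ => by
      simp only [LinearMap.comp_apply, localOp_planted]
      rw [← sub_eq_zero, nodeOp_lie op op _ _ 0, map_zero]
      intro n m
      -- The remainder comes from crossing a grafted edge, which `op` forbids.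
      rw [nodeOp_graftAtL_graftAtL _ _ _ _ hmk]
      simp [hmk])
    (fun i j => by
      simp only [LinearMap.comp_apply, localOp_X]
      rw [← sub_eq_zero, nodeOp_lie op op _ _ 0, map_zero]
      exact fun n m => nodeOp_raiseAt_raiseAt _ _ _ _ _ _)
    (fun a σ i => by
      simp only [LinearMap.comp_apply, localOp_X, localOp_planted]
      rw [nodeOp_lie op op _ _ _ (nodeOp_graftAtL_raiseAt op op mk hmk a _ i)]
      simp only [Bool.and_self]
      split_ifs <;> simp)

/-! ## The enveloping algebra as a bialgebra -/

theorem U.lift_incl {A : Type*} [Ring A] [Algebra ℝ A] (f : V d →ₗ⁅ℝ⁆ A) (u : V d) :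
    UniversalEnvelopingAlgebra.lift ℝ f (U.incl u) = f u :=
  UniversalEnvelopingAlgebra.lift_ι_apply ℝ f u

theorem U.algHom_ext {A : Type*} [Ring A] [Algebra ℝ A] {f g : U d →ₐ[ℝ] A}
    (h : ∀ u, f (U.incl u) = g (U.incl u)) : f = g :=
  UniversalEnvelopingAlgebra.hom_ext ℝ (LieHom.ext h)

/-- A submodule of `U(𝒱_0)` that contains `1` and is stable under left multiplication by `𝒱` is
everything. -/
theorem U.submodule_eq_top (S : Submodule ℝ (U d)) (h1 : (1 : U d) ∈ S)
    (hS : ∀ u, ∀ A ∈ S, U.incl u * A ∈ S) : S = ⊤ := by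
  -- The elements whose left multiplication preserves `S` form a subalgebra. The inclusion of `𝒱`
  -- factors through it, so by the universal property it is all of `U(𝒱_0)`; applying its elements
  -- to `1 ∈ S` concludes.
  let T : Subalgebra ℝ (U d) :=
    { carrier := {A | ∀ B ∈ S, A * B ∈ S}
      mul_mem' := fun {A A'} hA hA' B hB => by rw [mul_assoc]; exact hA _ (hA' _ hB)
      add_mem' := fun {A A'} hA hA' B hB => by rw [add_mul]; exact S.add_mem (hA _ hB) (hA' _ hB)
      algebraMap_mem' := fun c B hB => by rw [← Algebra.smul_def]; exact S.smul_mem c hB }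
  let f : V d →ₗ⁅ℝ⁆ T :=
    { toFun := fun u => ⟨U.incl u, hS u⟩
      map_add' := fun u v => Subtype.ext (map_add U.incl u v)
      map_smul' := fun c u => Subtype.ext (map_smul U.incl c u)
      map_lie' := fun {u v} => Subtype.ext (U.incl_lie u v) }
  have hf : T.val.comp (UniversalEnvelopingAlgebra.lift ℝ f) = AlgHom.id ℝ (U d) :=
    U.algHom_ext fun u => by
      rw [AlgHom.comp_apply, U.lift_incl]; rfl
  refine (Submodule.eq_top_iff').mpr fun A => ?_
  have := (UniversalEnvelopingAlgebra.lift ℝ f A).2 1 h1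
  have hA : ((UniversalEnvelopingAlgebra.lift ℝ f A : T) : U d) = A := AlgHom.congr_fun hf A
  rwa [hA, mul_one] at this

@[elab_as_elim]
theorem U.left_induction {P : U d → Prop} (one : P 1) (add : ∀ A B, P A → P B → P (A + B))
    (smul : ∀ (c : ℝ) A, P A → P (c • A)) (incl_mul : ∀ u A, P A → P (U.incl u * A)) (A : U d) :
    P A := by
  let S : Submodule ℝ (U d) :=
    { carrier := {A | P A}
      add_mem' := fun {A B} hA hB => add A B hA hB
      zero_mem' := by have := smul 0 1 one; rwa [zero_smul] at this
      smul_mem' := fun c A hA => smul c A hA }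
  have : A ∈ S := by rw [U.submodule_eq_top S one incl_mul]; trivial
  exact this

theorem U.comul_incl (u : V d) :
    U.comul (U.incl u) = U.incl u ⊗ₜ[ℝ] (1 : U d) + (1 : U d) ⊗ₜ[ℝ] U.incl u :=
  U.lift_incl _ u

/-- The counit of `U(𝒱_0)`. -/
noncomputable def U.counit : U d →ₐ[ℝ] ℝ :=
  UniversalEnvelopingAlgebra.lift ℝ (0 : V d →ₗ⁅ℝ⁆ ℝ)

@[simp] theorem U.counit_incl (u : V d) : U.counit (U.incl u) = 0 := U.lift_incl _ u

/-- Each axiom equates two algebra morphisms, so it is checked on the primitive elements of `𝒱`.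
This structure is what makes the linear maps from `U(𝒱_0)` to an algebra a convolution algebra. -/
noncomputable instance : Bialgebra ℝ (U d) :=
  Bialgebra.ofAlgHom U.comul U.counit
    (U.algHom_ext fun u => by
      simp only [AlgHom.comp_apply, U.comul_incl, map_add, Algebra.TensorProduct.map_tmul,
        map_one, AlgHom.coe_id, id, TensorProduct.add_tmul, TensorProduct.tmul_add,
        Algebra.TensorProduct.one_def]
      abel)
    (U.algHom_ext fun u => by
      simp [U.comul_incl])
    (U.algHom_ext fun u => by
      simp [U.comul_incl])

instance : Coalgebra.IsCocomm ℝ (U d) where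
  comm_comp_comul := by
    have : (Algebra.TensorProduct.comm ℝ (U d) (U d)).toAlgHom.comp U.comul = U.comul :=
      U.algHom_ext fun u => by
        rw [AlgHom.comp_apply, U.comul_incl, map_add, add_comm]
        rfl
    exact LinearMap.ext fun A => AlgHom.congr_fun this A

/-- Intertwiners of the action of `𝒱_0` are intertwiners of the action of `U(𝒱_0)`. -/
theorem U.intertwine {W W' : Type*} [AddCommGroup W] [Module ℝ W] [AddCommGroup W'] [Module ℝ W']
    (f : U d →ₐ[ℝ] Module.End ℝ W) (g : U d →ₐ[ℝ] Module.End ℝ W') (h : W →ₗ[ℝ] W')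
    (H : ∀ u w, h (f (U.incl u) w) = g (U.incl u) (h w)) (A : U d) (w : W) :
    h (f A w) = g A (h w) := by
  induction A using U.left_induction with
  | one => simp
  | add A B hA hB => simp [hA, hB]
  | smul c A hA => simp [hA]
  | incl_mul u A hA => rw [map_mul, map_mul, Module.End.mul_apply, Module.End.mul_apply, H, hA]

/-- The tensor product of two representations of `U(𝒱_0)`. -/
noncomputable def U.tensorRep {W W' : Type*} [AddCommGroup W] [Module ℝ W] [AddCommGroup W']
    [Module ℝ W'] (f : U d →ₐ[ℝ] Module.End ℝ W) (g : U d →ₐ[ℝ] Module.End ℝ W') :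
    U d →ₐ[ℝ] Module.End ℝ (W ⊗[ℝ] W') :=
  (Module.endTensorEndAlgHom (R := ℝ) (A := ℝ)).comp
    ((Algebra.TensorProduct.map f g).comp U.comul)

theorem U.tensorRep_incl {W W' : Type*} [AddCommGroup W] [Module ℝ W] [AddCommGroup W']
    [Module ℝ W'] (f : U d →ₐ[ℝ] Module.End ℝ W) (g : U d →ₐ[ℝ] Module.End ℝ W') (u : V d) :
    U.tensorRep f g (U.incl u)
      = TensorProduct.map (f (U.incl u)) LinearMap.id
        + TensorProduct.map LinearMap.id (g (U.incl u)) := by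
  refine TensorProduct.ext' fun x y => ?_
  simp [U.tensorRep, U.comul_incl, Module.endTensorEndAlgHom_apply]

theorem U.tensorRep_tmul {W W' : Type*} [AddCommGroup W] [Module ℝ W] [AddCommGroup W']
    [Module ℝ W'] (f : U d →ₐ[ℝ] Module.End ℝ W) (g : U d →ₐ[ℝ] Module.End ℝ W') (A : U d)
    (x : W) (y : W') :
    U.tensorRep f g A (x ⊗ₜ y)
      = TensorProduct.map (f.toLinearMap.flip x) (g.toLinearMap.flip y) (U.comul A) := by
  change Module.endTensorEndAlgHom (R := ℝ) (A := ℝ) (Algebra.TensorProduct.map f g (U.comul A))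
    (x ⊗ₜ y) = _
  induction U.comul A using TensorProduct.induction_on with
  | zero => simp
  | add s t hs ht => simp only [map_add, LinearMap.add_apply, hs, ht]
  | tmul B C => simp [Module.endTensorEndAlgHom_apply]

/-! ## The Poincaré–Birkhoff–Witt isomorphism -/

/-- Raising one exponent of an ordered monomial in commuting variables. -/
theorem prod_ofFn_pow_succ {M : Type*} [Monoid M] :
    ∀ {k : ℕ} (f : Fin k → M) (_ : ∀ i j, Commute (f i) (f j)) (n : Fin k → ℕ) (i : Fin k),
      (List.ofFn fun j => f j ^ (n + Pi.single i 1 : Fin k → ℕ) j).prod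
        = (List.ofFn fun j => f j ^ n j).prod * f i
  | 0, _, _, _, i => i.elim0
  | k + 1, f, hf, n, i => by
    rw [List.ofFn_succ, List.ofFn_succ, List.prod_cons, List.prod_cons]
    refine Fin.cases ?_ (fun i => ?_) i
    · have h : Commute (f 0) (List.ofFn fun j : Fin k => f j.succ ^ n j.succ).prod :=
        Commute.list_prod_right _ _ fun x hx => by
          obtain ⟨j, rfl⟩ := (List.mem_ofFn' _ _).mp hx
          exact (hf 0 j.succ).pow_right _
      simp [pow_succ, mul_assoc, h.eq]
    · have := prod_ofFn_pow_succ (fun j => f j.succ) (fun _ _ => hf _ _) (fun j => n j.succ) i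
      have h2 : (fun j : Fin k => f j.succ ^ (n + Pi.single i.succ 1 : Fin (k + 1) → ℕ) j.succ)
          = fun j => f j.succ ^ ((fun j => n j.succ) + Pi.single i 1 : Fin k → ℕ) j := by
        funext j
        simp [Pi.single_apply]
      rw [h2, this, ← mul_assoc]
      simp

@[elab_as_elim]
theorem Idx.induction {P : Idx d → Prop} (zero : P 0) (succ : ∀ n i, P n → P (n + unitIdx i))
    (n : Idx d) : P n := by
  induction hs : ∑ i, n i generalizing n with
  | zero =>
    have : n = 0 := by
      ext i
      exact (Finset.sum_eq_zero_iff.mp hs) i (Finset.mem_univ i)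
    rwa [this]
  | succ s ih =>
    obtain ⟨i, hi⟩ : ∃ i, n i ≠ 0 := by
      by_contra! h
      simp [h] at hs
    have hn := tsub_add_cancel_of_le (unitIdx_le.mpr hi)
    rw [← hn]
    refine succ _ _ (ih _ ?_)
    rw [← hn] at hs
    simpa [Finset.sum_add_distrib, unitIdx] using hs

theorem U.incl_X_commute (i j : Fin (d + 1)) :
    Commute (U.incl (V.X i) : U d) (U.incl (V.X j)) := by
  have := U.incl_lie (V.X i : V d) (V.X j)
  rw [V.lie_X_X, map_zero] at this
  exact sub_eq_zero.mp this.symm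

theorem orderedMonomial_root_zero (m : ℕ) : orderedMonomial (root 0 m : Tree d) = 1 := by
  simp [orderedMonomial]

theorem orderedMonomial_root_add (n : Idx d) (m : ℕ) (i : Fin (d + 1)) :
    orderedMonomial (root (n + unitIdx i) m) = orderedMonomial (root n m) * U.incl (V.X i) :=
  prod_ofFn_pow_succ _ U.incl_X_commute n i

theorem orderedMonomial_root_add' (n : Idx d) (m : ℕ) (i : Fin (d + 1)) :
    orderedMonomial (root (n + unitIdx i) m) = U.incl (V.X i) * orderedMonomial (root n m) := by
  rw [orderedMonomial_root_add]
  refine (Commute.list_prod_right _ _ fun x hx => ?_).eq.symm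
  obtain ⟨j, rfl⟩ := (List.mem_ofFn' _ _).mp hx
  exact (U.incl_X_commute i j).pow_right _

theorem orderedMonomial_graft (a : Idx d) (σ τ : Tree d) :
    orderedMonomial (graft a σ τ)
      = orderedMonomial τ * U.incl (V.planted a (Finsupp.single σ 1)) := by
  simp [orderedMonomial]

@[simp] theorem pbw_single (τ : Tree d) : pbw (Finsupp.single τ 1) = orderedMonomial τ := by
  simp [pbw]

theorem pbw_graftL (a : Idx d) (x y : TreeSpan d (Idx d)) :
    pbw (graftL a x y) = pbw y * U.incl (V.planted a x) := by
  induction x using Finsupp.induction_linear with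
  | zero => simp
  | add x x' hx hx' => simp [hx, hx', mul_add]
  | single σ c =>
    induction y using Finsupp.induction_linear with
    | zero => simp
    | add y y' hy hy' => simp [hy, hy', add_mul]
    | single τ c' =>
      have hc : Finsupp.single σ c = c • Finsupp.single σ (1 : ℝ) := by simp
      have hc' : Finsupp.single τ c' = c' • Finsupp.single τ (1 : ℝ) := by simp
      rw [hc, hc']
      simp only [map_smul, LinearMap.smul_apply, ← single_graft, pbw_single,
        orderedMonomial_graft, smul_mul_assoc, mul_smul_comm]
      rw [smul_comm]

theorem single_mem_positiveSpan {τ : Tree d} (h : rootNoise τ = 0) (c : ℝ) :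
    Finsupp.single τ c ∈ positiveSpan d := Finsupp.single_mem_supported ℝ c h

theorem single_root_mem_positiveSpan (n : Idx d) :
    (Finsupp.single (root n 0) 1 : TreeSpan d (Idx d)) ∈ positiveSpan d :=
  single_mem_positiveSpan rfl 1

/-- The trees without noise at the root are built from the `X^n` by grafting. -/
theorem positiveSpan_induction {P : TreeSpan d (Idx d) → Prop} (zero : P 0)
    (add : ∀ x y, P x → P y → P (x + y)) (smul : ∀ (c : ℝ) x, P x → P (c • x))
    (hr : ∀ n, P (Finsupp.single (root n 0) 1))
    (hg : ∀ a σ τ, Finsupp.single τ 1 ∈ positiveSpan d → P (Finsupp.single τ 1) →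
      P (graftL a (Finsupp.single σ 1) (Finsupp.single τ 1)))
    (x : TreeSpan d (Idx d)) (hx : x ∈ positiveSpan d) : P x := by
  rw [positiveSpan, Finsupp.supported_eq_span_single] at hx
  refine Submodule.span_induction ?_ zero (fun x y _ _ => add x y) (fun c x _ => smul c x) hx
  rintro _ ⟨τ, hτ, rfl⟩
  induction τ using ETree.induct with
  | hr n m =>
    obtain rfl : m = 0 := hτ
    exact hr n
  | hg a σ τ _ ih =>
    have hτ : rootNoise τ = 0 := by simpa [rootNoise] using hτ
    change P (Finsupp.single (graft a σ τ) 1)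
    rw [single_graft]
    exact hg a σ τ (single_mem_positiveSpan hτ 1) (ih hτ)

theorem graftL_mem_positiveSpan (a : Idx d) (x : TreeSpan d (Idx d)) {y : TreeSpan d (Idx d)}
    (hy : y ∈ positiveSpan d) : graftL a x y ∈ positiveSpan d := by
  induction x using Finsupp.induction_linear with
  | zero => simp
  | add x x' hx hx' => rw [map_add, LinearMap.add_apply]; exact add_mem hx hx'
  | single σ c =>
    rw [positiveSpan, Finsupp.supported_eq_span_single] at hy
    refine Submodule.span_induction ?_ (by simp) (fun x y _ _ h h' => ?_) (fun c x _ h => ?_) hy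
    · rintro _ ⟨τ, hτ, rfl⟩
      rw [graftL_single]
      refine single_mem_positiveSpan ?_ _
      simpa [rootNoise] using hτ
    · rw [map_add]; exact add_mem h h'
    · rw [map_smul]; exact Submodule.smul_mem _ _ h

/-- The left regular representation of `U(𝒱_0)`, transported to trees: the elements of `𝒱` act at
the root. -/
noncomputable def rootRep : U d →ₐ[ℝ] Module.End ℝ (TreeSpan d (Idx d)) :=
  UniversalEnvelopingAlgebra.lift ℝ (nodeRep (fun _ => false) id (fun _ => rfl) LinearMap.id)

theorem rootRep_incl (u : V d) :
    rootRep (U.incl u) = nodeOp (fun _ => false) (localOp id LinearMap.id u) :=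
  U.lift_incl _ u

/-- The action at the root never enters a branch, so attaching a branch is an intertwiner. -/
theorem rootRep_graftL (A : U d) (a : Idx d) (x y : TreeSpan d (Idx d)) :
    rootRep A (graftL a x y) = graftL a x (rootRep A y) :=
  (U.intertwine rootRep rootRep (graftL a x) (fun u w => by
    rw [rootRep_incl, nodeOp_graftL_of_false _ rfl]) A y).symm

theorem rootRep_X_root (i : Fin (d + 1)) (n : Idx d) (m : ℕ) :
    rootRep (U.incl (V.X i)) (Finsupp.single (root n m) 1)
      = Finsupp.single (root (n + unitIdx i) m) 1 := by
  rw [rootRep_incl, nodeOp_root, localOp_X, raiseAt]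

/-- At a node of decoration `0` only `l = 0` has a nonzero binomial coefficient: the deformation
disappears. -/
theorem graftAtL_zero (mk : Idx d → E) (a : Idx d) (s : TreeSpan d E) (m : ℕ) :
    graftAtL mk a s 0 m = graftL (mk a) s (Finsupp.single (root 0 m) 1) := by
  rw [graftAtL_apply, Finset.sum_eq_single 0]
  · simp [idxChoose_zero_right]
  · intro l _ hl
    rw [idxChoose_eq_zero (fun h => hl (le_antisymm h zero_le))]
    simp
  · intro h; exact absurd (Finset.mem_Iic.mpr zero_le) h

theorem rootRep_planted_one (a : Idx d) (x : TreeSpan d (Idx d)) :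
    rootRep (U.incl (V.planted a x)) (Finsupp.single (root 0 0) 1)
      = graftL a x (Finsupp.single (root 0 0) 1) := by
  rw [rootRep_incl, nodeOp_root, localOp_planted, graftAtL_zero]; rfl

/-- Acting on the tree `1`, the planted factors of an ordered monomial come first and are attached
without deformation, since the root still has decoration `0`; then the `X_i` raise the root. So the
tree is recovered from its monomial, which makes `pbw` injective on `𝒯_+`. -/
theorem rootRep_pbw (x : TreeSpan d (Idx d)) (hx : x ∈ positiveSpan d) :
    rootRep (pbw x) (Finsupp.single (root 0 0) 1) = x := by
  refine positiveSpan_induction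
    (P := fun x => rootRep (pbw x) (Finsupp.single (root 0 0) 1) = x) ?_ ?_ ?_ ?_ ?_ x hx
  · simp
  · intro x y hx hy; simp [hx, hy]
  · intro c x hx; simp [hx]
  · intro n
    rw [pbw_single]
    induction n using Idx.induction with
    | zero => simp [orderedMonomial_root_zero]
    | succ n i ih =>
      rw [orderedMonomial_root_add', map_mul, Module.End.mul_apply, ih, rootRep_X_root]
  · intro a σ τ _ ih
    rw [pbw_graftL, map_mul, Module.End.mul_apply, rootRep_planted_one, rootRep_graftL, ih]

/-- The span of the ordered monomials is stable under right multiplication by `𝒱`: a planted tree is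
one more factor, and `X_i` is moved to the left through the planted factors, each exchange costing a
commutator `I_{a - e_i}(σ)` that stays in the span. -/
theorem exists_pbw_eq (A : U d) : ∃ x ∈ positiveSpan d, pbw x = A := by
  let S : Submodule ℝ (U d) := (positiveSpan d).map pbw
  have hpl (a : Idx d) (σ : Tree d) {B : U d} (hB : B ∈ S) :
      B * U.incl (V.planted a (Finsupp.single σ 1)) ∈ S := by
    obtain ⟨x, hx, rfl⟩ := hB
    exact ⟨_, graftL_mem_positiveSpan a (Finsupp.single σ 1) hx, pbw_graftL _ _ _⟩
  have hX (i : Fin (d + 1)) {B : U d} (hB : B ∈ S) : B * U.incl (V.X i) ∈ S := by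
    obtain ⟨x, hx, rfl⟩ := hB
    refine positiveSpan_induction
      (P := fun x => pbw x * U.incl (V.X i) ∈ S) ?_ ?_ ?_ ?_ ?_ x hx
    · simp
    · intro x y hx hy; rw [map_add, add_mul]; exact S.add_mem hx hy
    · intro c x hx; rw [map_smul, smul_mul_assoc]; exact S.smul_mem c hx
    · intro n
      rw [pbw_single, ← orderedMonomial_root_add, ← pbw_single]
      exact ⟨_, single_root_mem_positiveSpan _, rfl⟩
    · intro a σ τ hτ ih
      have h := U.incl_lie (V.planted a (Finsupp.single σ 1)) (V.X i)
      rw [V.lie_planted_X, eq_sub_iff_add_eq] at h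
      -- Here `h` reads `[I, X_i]_0 + X_i I = I X_i`; the second summand is covered by the induction
      -- hypothesis.
      rw [pbw_graftL, mul_assoc, ← h, mul_add, ← mul_assoc]
      refine S.add_mem ?_ (hpl a σ ih)
      split_ifs
      · simp
      · exact hpl _ σ ⟨_, hτ, rfl⟩
  have hV (u : V d) {B : U d} (hB : B ∈ S) : B * U.incl u ∈ S := by
    induction u using V.induction with
    | planted a σ => exact hpl a σ hB
    | X i => exact hX i hB
    | add u v hu hv => rw [map_add, mul_add]; exact S.add_mem hu hv
    | smul c u hu => rw [map_smul, mul_smul_comm]; exact S.smul_mem c hu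
  have hall (A : U d) : ∀ B ∈ S, B * A ∈ S := by
    induction A using U.left_induction with
    | one => intro B hB; rwa [mul_one]
    | add A A' h h' => intro B hB; rw [mul_add]; exact S.add_mem (h B hB) (h' B hB)
    | smul c A h => intro B hB; rw [mul_smul_comm]; exact S.smul_mem c (h B hB)
    | incl_mul u A h => intro B hB; rw [← mul_assoc]; exact h _ (hV u hB)
  have h1 : (1 : U d) ∈ S :=
    ⟨_, single_root_mem_positiveSpan 0, by rw [pbw_single, orderedMonomial_root_zero]⟩
  have hA := hall A 1 h1
  rw [one_mul] at hA
  exact hA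

theorem pbw_bijective : Function.Bijective (pbw.domRestrict (positiveSpan d)) := by
  constructor
  · intro x y h
    have h' : pbw (x : TreeSpan d (Idx d)) = pbw (y : TreeSpan d (Idx d)) := h
    exact Subtype.ext (by rw [← rootRep_pbw x.1 x.2, h', rootRep_pbw y.1 y.2])
  · intro A
    obtain ⟨x, hx, h⟩ := exists_pbw_eq A
    exact ⟨⟨x, hx⟩, h⟩

theorem pbw_rootRep_one (A : U d) : pbw (rootRep A (Finsupp.single (root 0 0) 1)) = A := by
  obtain ⟨x, hx, rfl⟩ := exists_pbw_eq A
  rw [rootRep_pbw x hx]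

/-- As `x` is `pbw x` applied to the tree `1`, acting by `A` gives `A * pbw x` applied to `1`. So
`rootRep` on `𝒯_+` is the left regular representation. -/
theorem pbw_rootRep (A : U d) (x : TreeSpan d (Idx d)) (hx : x ∈ positiveSpan d) :
    pbw (rootRep A x) = A * pbw x := by
  conv_lhs => rw [← rootRep_pbw x hx, ← Module.End.mul_apply, ← map_mul]
  exact pbw_rootRep_one _

/-- Lowering the root decoration is a left inverse; truncation does no harm, since the decoration
has just been raised. -/
theorem rootRep_X_injective (i : Fin (d + 1)) :
    Function.Injective (rootRep (d := d) (U.incl (V.X i))) := by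
  let sub : Tree d → Tree d := recOn (fun n m => root (n - unitIdx i) m)
    (fun a σ _ _ z => graft a σ z) (fun _ _ _ _ _ _ _ _ => graft_comm _ _ _ _ _)
  have : (Finsupp.lmapDomain ℝ ℝ sub).comp (rootRep (U.incl (V.X i))) = LinearMap.id := by
    refine TreeSpan.hom_induct (fun n m => ?_) fun a σ τ _ hτ => ?_
    · simp [rootRep_X_root, sub, Finsupp.mapDomain_single]
    · have hs (y : TreeSpan d (Idx d)) :
          Finsupp.lmapDomain ℝ ℝ sub (graftL a (Finsupp.single σ 1) y)
            = graftL a (Finsupp.single σ 1) (Finsupp.lmapDomain ℝ ℝ sub y) := by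
        refine LinearMap.congr_fun (f := (Finsupp.lmapDomain ℝ ℝ sub).comp (graftL a _))
          (g := (graftL a _).comp (Finsupp.lmapDomain ℝ ℝ sub)) (TreeSpan.hom_ext fun τ => ?_) y
        simp [graftL_single, Finsupp.mapDomain_single, sub]
      rw [LinearMap.comp_apply] at hτ ⊢
      rw [rootRep_graftL, hs, hτ]
      rfl
  exact Function.LeftInverse.injective (g := Finsupp.lmapDomain ℝ ℝ sub)
    (LinearMap.congr_fun this)

/-- Left cancellation of `X_i`, by which the uniqueness proof determines `A ▷ 1`. -/
theorem U.incl_X_mul_injective (i : Fin (d + 1)) :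
    Function.Injective fun A : U d => U.incl (V.X i) * A := by
  intro A B h
  have h' := congrArg (fun C => rootRep C (Finsupp.single (root 0 0) 1)) h
  simp only [map_mul, Module.End.mul_apply] at h'
  rw [← pbw_rootRep_one A, rootRep_X_injective i h', pbw_rootRep_one]

/-! ## Relabelling of edges -/

/-- The linear extension of `mapEdges`. -/
noncomputable def mapEdgesL (f : E → E') : TreeSpan d E →ₗ[ℝ] TreeSpan d E' :=
  Finsupp.lmapDomain ℝ ℝ (mapEdges f)

@[simp] theorem mapEdgesL_single (f : E → E') (τ : ETree d E) (c : ℝ) :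
    mapEdgesL f (Finsupp.single τ c) = Finsupp.single (mapEdges f τ) c := by
  simp [mapEdgesL, Finsupp.mapDomain_single]

@[simp] theorem mapEdges_root (f : E → E') (n : Idx d) (m : ℕ) :
    mapEdges f (root n m) = root n m := rfl

@[simp] theorem mapEdges_graft (f : E → E') (e : E) (σ τ : ETree d E) :
    mapEdges f (graft e σ τ) = graft (f e) (mapEdges f σ) (mapEdges f τ) := by
  simp [mapEdges]

theorem graftL_hom_ext {W : Type*} [AddCommMonoid W] [Module ℝ W]
    {f g : TreeSpan d E →ₗ[ℝ] TreeSpan d E →ₗ[ℝ] W}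
    (h : ∀ σ τ, f (Finsupp.single σ 1) (Finsupp.single τ 1)
      = g (Finsupp.single σ 1) (Finsupp.single τ 1)) (x y : TreeSpan d E) : f x y = g x y := by
  have : f = g := TreeSpan.hom_ext fun σ => TreeSpan.hom_ext fun τ => h σ τ
  rw [this]

theorem mapEdgesL_graftL (f : E → E') (e : E) (x y : TreeSpan d E) :
    mapEdgesL f (graftL e x y) = graftL (f e) (mapEdgesL f x) (mapEdgesL f y) :=
  graftL_hom_ext (f := (graftL e).compr₂ (mapEdgesL f))
    (g := (graftL (f e)).compl₁₂ (mapEdgesL f) (mapEdgesL f))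
    (fun σ τ => by simp [graftL_single]) x y

theorem mapEdgesL_mapEdgesL {E'' : Type} (f : E → E') (g : E' → E'') (x : TreeSpan d E) :
    mapEdgesL g (mapEdgesL f x) = mapEdgesL (g ∘ f) x := by
  refine LinearMap.congr_fun (f := (mapEdgesL g).comp (mapEdgesL f)) (g := mapEdgesL (g ∘ f))
    (TreeSpan.hom_induct (fun n m => by simp) fun e σ τ hσ hτ => ?_) x
  simp only [LinearMap.comp_apply, mapEdgesL_graftL] at hσ hτ ⊢
  rw [hσ, hτ]; rfl

theorem mapEdgesL_id (x : TreeSpan d E) : mapEdgesL id x = x := by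
  refine LinearMap.congr_fun (f := mapEdgesL id) (g := LinearMap.id)
    (TreeSpan.hom_induct (fun n m => by simp) fun e σ τ hσ hτ => ?_) x
  rw [mapEdgesL_graftL, hσ, hτ]; rfl

theorem mapEdgesL_nodeOp (f : E → E') (op : E' → Bool) (φ : Idx d → ℕ → TreeSpan d E)
    (φ' : Idx d → ℕ → TreeSpan d E') (h : ∀ n m, mapEdgesL f (φ n m) = φ' n m)
    (x : TreeSpan d E) :
    mapEdgesL f (nodeOp (op ∘ f) φ x) = nodeOp op φ' (mapEdgesL f x) := by
  refine LinearMap.congr_fun (f := (mapEdgesL f).comp (nodeOp (op ∘ f) φ))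
    (g := (nodeOp op φ').comp (mapEdgesL f))
    (TreeSpan.hom_induct (fun n m => ?_) fun e σ τ hσ hτ => ?_) x
  · rw [LinearMap.comp_apply, LinearMap.comp_apply, nodeOp_root, mapEdgesL_single, mapEdges_root,
      nodeOp_root, h]
  · simp only [LinearMap.comp_apply] at hσ hτ ⊢
    rw [nodeOp_graftL, map_add, mapEdgesL_graftL, mapEdgesL_graftL, mapEdgesL_graftL,
      nodeOp_graftL, ← hτ]
    simp only [Function.comp_apply, apply_ite (mapEdgesL f), map_zero, hσ]

/-- As long as the same nodes are summed over, the labels given to the created edges matter only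
through their images under `f`. -/
theorem mapEdgesL_nodeOp_congr (f : E → E') (op : E → Bool) (φ ψ : Idx d → ℕ → TreeSpan d E)
    (h : ∀ n m, mapEdgesL f (φ n m) = mapEdgesL f (ψ n m)) (x : TreeSpan d E) :
    mapEdgesL f (nodeOp op φ x) = mapEdgesL f (nodeOp op ψ x) := by
  refine LinearMap.congr_fun (f := (mapEdgesL f).comp (nodeOp op φ))
    (g := (mapEdgesL f).comp (nodeOp op ψ))
    (TreeSpan.hom_induct (fun n m => ?_) fun e σ τ hσ hτ => ?_) x
  · simp only [LinearMap.comp_apply, nodeOp_root, h]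
  · simp only [LinearMap.comp_apply] at hσ hτ ⊢
    rw [nodeOp_graftL, nodeOp_graftL, map_add, map_add, mapEdgesL_graftL, mapEdgesL_graftL,
      mapEdgesL_graftL, mapEdgesL_graftL, hτ, apply_ite (mapEdgesL f), apply_ite (mapEdgesL f), hσ]

theorem mapEdgesL_localOp (f : E → E') (mk : Idx d → E)
    (inc : TreeSpan d (Idx d) →ₗ[ℝ] TreeSpan d E) (u : V d) (n : Idx d) (m : ℕ) :
    mapEdgesL f (localOp mk inc u n m) = localOp (f ∘ mk) ((mapEdgesL f).comp inc) u n m := by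
  induction u using V.induction with
  | add u v hu hv => simp only [map_add, Pi.add_apply, hu, hv]
  | smul c u hu => simp only [map_smul, Pi.smul_apply, hu]
  | X i => simp [raiseAt]
  | planted a σ =>
    rw [localOp_planted, localOp_planted, graftAtL_apply, graftAtL_apply, map_sum]
    exact Finset.sum_congr rfl fun l _ => by
      rw [map_smul, mapEdgesL_graftL, mapEdgesL_single, mapEdges_root]; rfl

/-! ## The action on old nodes -/

/-- All edges of a tree are flagged as original ones. -/
noncomputable def flagL : TreeSpan d (Idx d) →ₗ[ℝ] TreeSpan d (Idx d × Bool) :=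
  mapEdgesL fun b => (b, false)

/-- The flags are forgotten. -/
noncomputable def forgetL : TreeSpan d (Idx d × Bool) →ₗ[ℝ] TreeSpan d (Idx d) :=
  mapEdgesL Prod.fst

theorem forgetL_flagL (x : TreeSpan d (Idx d)) : forgetL (flagL x) = x := by
  rw [forgetL, flagL, mapEdgesL_mapEdgesL]; exact mapEdgesL_id x

theorem flagL_graftL (a : Idx d) (x y : TreeSpan d (Idx d)) :
    flagL (graftL a x y) = graftL (a, false) (flagL x) (flagL y) := mapEdgesL_graftL _ _ _ _

theorem forgetL_graftL (e : Idx d × Bool) (x y : TreeSpan d (Idx d × Bool)) :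
    forgetL (graftL e x y) = graftL e.1 (forgetL x) (forgetL y) := mapEdgesL_graftL _ _ _ _

theorem flagL_root (n : Idx d) (m : ℕ) :
    flagL (Finsupp.single (root n m) 1) = Finsupp.single (root n m) 1 := mapEdgesL_single _ _ _

/-- The elements of `U(𝒱_0)` act on the nodes that are not above a newly created edge. -/
noncomputable def oldRep : U d →ₐ[ℝ] Module.End ℝ (TreeSpan d (Idx d × Bool)) :=
  UniversalEnvelopingAlgebra.lift ℝ
    (nodeRep (fun e => !e.2) (fun b => (b, true)) (fun _ => rfl) flagL)

theorem oldRep_incl (u : V d) :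
    oldRep (U.incl u) = nodeOp (fun e => !e.2) (localOp (fun b => (b, true)) flagL u) :=
  U.lift_incl _ u

theorem oldRep_X (i : Fin (d + 1)) : oldRep (U.incl (V.X i) : U d) = raiseOld i := by
  rw [oldRep_incl, localOp_X]; rfl

theorem oldRep_planted (a : Idx d) (σ : Tree d) :
    oldRep (U.incl (V.planted a (Finsupp.single σ 1))) = graftOld a σ := by
  rw [oldRep_incl, localOp_planted, flagL, mapEdgesL_single, graftAtL_single]; rfl

/-- In an ordered monomial the planted factors stand on the right and act first, the `X_i` act last:
this is the order in the definition of `⋆₂`. -/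
theorem oldRep_orderedMonomial (σ : Tree d) : oldRep (orderedMonomial σ) = insertion σ := by
  induction σ using ETree.induct with
  | hr n m =>
    change oldRep (List.ofFn fun i => U.incl (V.X i) ^ n i).prod
      = (List.ofFn fun i => raiseOld i ^ n i).prod
    rw [map_list_prod, List.map_ofFn]
    simp only [Function.comp_def, map_pow, oldRep_X]
  | hg a σ τ _ ih =>
    rw [orderedMonomial_graft, map_mul, ih, oldRep_planted]
    simp [insertion]

/-- The operator `τ ↦ A ⋆₂ τ` for `A ∈ U(𝒱_0)`. -/
noncomputable def insertOp : U d →ₗ[ℝ] Module.End ℝ (TreeSpan d (Idx d)) where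
  toFun A := forgetL ∘ₗ oldRep A ∘ₗ flagL
  map_add' A B := LinearMap.ext fun x => by simp
  map_smul' c A := LinearMap.ext fun x => by simp

theorem insertOp_apply (A : U d) (x : TreeSpan d (Idx d)) :
    insertOp A x = forgetL (oldRep A (flagL x)) := rfl

theorem starTwo_single (σ : Tree d) (x : TreeSpan d (Idx d)) :
    starTwo (Finsupp.single σ 1) x = insertOp (orderedMonomial σ) x := by
  rw [insertOp_apply, oldRep_orderedMonomial, starTwo, Finsupp.linearCombination_single, one_smul]
  rfl

/-- This turns every statement about `⋆₂` into one about the action of `U(𝒱_0)`. -/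
theorem starTwo_eq_insertOp (x y : TreeSpan d (Idx d)) : starTwo x y = insertOp (pbw x) y := by
  have : starTwo (d := d) = insertOp.comp pbw :=
    TreeSpan.hom_ext fun σ => LinearMap.ext fun y => by
      rw [starTwo_single, LinearMap.comp_apply, pbw_single]
  rw [this, LinearMap.comp_apply]

theorem insertOp_one (x : TreeSpan d (Idx d)) : insertOp 1 x = x := by
  rw [insertOp_apply, map_one, Module.End.one_apply, forgetL_flagL]

/-- The elements of `𝒱` act on all nodes of a tree. -/
noncomputable def nodeAct (u : V d) : Module.End ℝ (TreeSpan d (Idx d)) :=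
  nodeOp (fun _ => true) (localOp id LinearMap.id u)

theorem flagL_nodeAct (u : V d) (op : Idx d × Bool → Bool) (hop : ∀ b, op (b, false) = true)
    (x : TreeSpan d (Idx d)) :
    nodeOp op (localOp (fun b => (b, false)) flagL u) (flagL x) = flagL (nodeAct u x) := by
  have h := mapEdgesL_nodeOp (fun b : Idx d => (b, false)) op (localOp id LinearMap.id u)
    (localOp (fun b => (b, false)) flagL u) (fun n m => mapEdgesL_localOp _ _ _ _ _ _) x
  have h1 : (op ∘ fun b : Idx d => (b, false)) = fun _ => true := funext hop
  rw [h1] at h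
  exact h.symm

theorem forgetL_nodeOp_true (u : V d) (x : TreeSpan d (Idx d × Bool)) :
    forgetL (nodeOp (fun _ => true) (localOp (fun b => (b, false)) flagL u) x)
      = nodeAct u (forgetL x) := by
  have hid : (mapEdgesL Prod.fst).comp flagL
      = (LinearMap.id : TreeSpan d (Idx d) →ₗ[ℝ] TreeSpan d (Idx d)) :=
    LinearMap.ext forgetL_flagL
  have h (n : Idx d) (m : ℕ) :
      mapEdgesL Prod.fst (localOp (fun b : Idx d => (b, false)) flagL u n m)
        = localOp id LinearMap.id u n m := by
    rw [mapEdgesL_localOp, hid]; rfl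
  exact mapEdgesL_nodeOp Prod.fst (fun _ => true) _ _ h x

theorem forgetL_oldRep_incl (u : V d) (x : TreeSpan d (Idx d × Bool)) :
    forgetL (oldRep (U.incl u) x)
      = forgetL (nodeOp (fun e => !e.2) (localOp (fun b => (b, false)) flagL u) x) := by
  rw [oldRep_incl]
  refine mapEdgesL_nodeOp_congr _ _ _ _ (fun n m => ?_) x
  rw [mapEdgesL_localOp, mapEdgesL_localOp]
  rfl

/-- In a tree without new edges every node is old, so a single element of `𝒱` acts on all nodes. -/
theorem insertOp_incl (u : V d) (x : TreeSpan d (Idx d)) :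
    insertOp (U.incl u) x = nodeAct u x := by
  rw [insertOp_apply, forgetL_oldRep_incl, flagL_nodeAct u _ (fun _ => rfl), forgetL_flagL]

/-! ## The post-Lie product and its extension -/

theorem nodeAct_X (i : Fin (d + 1)) (τ : Tree d) :
    nodeAct (V.X i) (Finsupp.single τ 1) = raise i τ := by
  rw [nodeAct, localOp_X, nodeOp_single]; rfl

theorem nodeAct_planted (a : Idx d) (σ τ : Tree d) :
    nodeAct (V.planted a (Finsupp.single σ 1)) (Finsupp.single τ 1) = hatGraft a σ τ := by
  rw [nodeAct, localOp_planted, nodeOp_single, LinearMap.id_apply, graftAtL_single]; rfl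

/-- The post-Lie product as a bilinear map. -/
noncomputable def postLieL : V d →ₗ[ℝ] V d →ₗ[ℝ] V d :=
  LinearMap.mk₂ ℝ postLie
    (fun u u' v => V.ext'
      (by simp [postLie, add_smul, Finset.sum_add_distrib]; abel) (by simp [postLie]))
    (fun c u v => V.ext'
      (by simp [postLie, mul_smul, Finset.smul_sum]) (by simp [postLie]))
    (fun u v v' => V.ext'
      (by simp [postLie, Finset.sum_add_distrib]; abel) (by simp [postLie]))
    (fun c u v => V.ext'
      (by simp [postLie, Finset.smul_sum, smul_comm c]) (by simp [postLie]))

theorem postLie_X (u : V d) (i : Fin (d + 1)) : postLie u (V.X i) = 0 :=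
  V.ext' (by simp [postLie, V.X]) (by simp [postLie])

/-- The rules for `X_i` and for `I_a(σ)` on the left are one rule: `u` acts on all nodes of the tree
above the planted edge. -/
theorem postLie_planted (u : V d) (b : Idx d) (x : TreeSpan d (Idx d)) :
    postLie u (V.planted b x) = V.planted b (nodeAct u x) := by
  have hs : ∀ τ : Tree d, postLie u (V.planted b (Finsupp.single τ 1))
      = V.planted b (nodeAct u (Finsupp.single τ 1)) := by
    intro τ
    induction u using V.induction with
    | add u v hu hv =>
      have : postLieL (u + v) (V.planted b (Finsupp.single τ 1)) = _ :=
        LinearMap.map_add₂ _ _ _ _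
      refine this.trans ?_
      change postLie _ _ + postLie _ _ = _
      rw [hu, hv]
      simp [nodeAct]
    | smul c u hu =>
      have : postLieL (c • u) (V.planted b (Finsupp.single τ 1)) = _ :=
        LinearMap.map_smul₂ _ _ _ _
      refine this.trans ?_
      change c • postLie _ _ = _
      rw [hu]
      simp [nodeAct]
    | X i =>
      rw [nodeAct_X]
      refine V.ext' ?_ rfl
      simp [postLie, V.X, Pi.single_apply, plantL, raisePlanted]
    | planted a σ =>
      rw [nodeAct_planted]
      refine V.ext' ?_ rfl
      simp [postLie, plantL, hatGraftPlanted]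
  exact LinearMap.congr_fun (f := (postLieL u).comp (V.planted b))
    (g := (V.planted b).comp (nodeAct u)) (TreeSpan.hom_ext hs) x

/-- The map `(v, A) ↦ A ▷ v` for `v ∈ 𝒱` and `A ∈ U(𝒱_0)`. -/
noncomputable def envAct : V d →ₗ[ℝ] U d →ₗ[ℝ] V d :=
  (Finsupp.linearCombination ℝ fun p : Idx d × Tree d =>
      (V.planted p.1).comp (insertOp.flip (Finsupp.single p.2 1))).comp V.tree
    + (Fintype.linearCombination ℝ fun i =>
        (U.counit (d := d)).toLinearMap.smulRight (V.X i)).comp V.poly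

theorem envAct_planted (b : Idx d) (x : TreeSpan d (Idx d)) (A : U d) :
    envAct (V.planted b x) A = V.planted b (insertOp A x) := by
  refine LinearMap.congr_fun (f := (envAct.flip A).comp (V.planted b))
    (g := (V.planted b).comp (insertOp A)) (TreeSpan.hom_ext fun τ => ?_) x
  simp [envAct, plantL]

theorem envAct_X (i : Fin (d + 1)) (A : U d) : envAct (V.X i) A = U.counit A • V.X i := by
  simp [envAct, V.X, Fintype.linearCombination_apply_single]

theorem envAct_one (v : V d) : envAct v 1 = v := by
  induction v using V.induction with
  | add u v hu hv => rw [map_add, LinearMap.add_apply, hu, hv]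
  | smul c u hu => rw [map_smul, LinearMap.smul_apply, hu]
  | planted a σ => rw [envAct_planted, insertOp_one]
  | X i => rw [envAct_X, map_one, one_smul]

theorem envAct_incl (u v : V d) : envAct v (U.incl u) = postLie u v := by
  change _ = postLieL u v
  induction v using V.induction with
  | add v w hv hw => rw [map_add, LinearMap.add_apply, hv, hw, map_add]
  | smul c v hv => rw [map_smul, LinearMap.smul_apply, hv, map_smul]
  | planted a σ => rw [envAct_planted, insertOp_incl]; exact (postLie_planted _ _ _).symm
  | X i => rw [envAct_X, U.counit_incl, zero_smul]; exact (postLie_X u i).symm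

/-! ### Convolution of linear maps out of `U(𝒱_0)` -/

section Convolution

variable {A : Type*} [Ring A] [Algebra ℝ A]

theorem conv_apply (f g : WithConv (U d →ₗ[ℝ] A)) (B : U d) :
    (f * g).ofConv B
      = LinearMap.mul' ℝ A (TensorProduct.map f.ofConv g.ofConv (U.comul B)) := rfl

/-- By the counit axiom, convolution with `B ↦ ε(B) c` is pointwise multiplication by `c`. -/
theorem conv_counit_right (f : WithConv (U d →ₗ[ℝ] A)) (c : A) (B : U d) :
    (f * toConv ((U.counit (d := d)).toLinearMap.smulRight c)).ofConv B = f.ofConv B * c := by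
  have h (z : U d ⊗[ℝ] U d) :
      LinearMap.mul' ℝ A (TensorProduct.map f.ofConv
        ((U.counit (d := d)).toLinearMap.smulRight c) z)
        = f.ofConv (TensorProduct.rid ℝ _ (U.counit.toLinearMap.lTensor _ z)) * c := by
    induction z using TensorProduct.induction_on with
    | zero => simp
    | add z w hz hw => simp only [map_add, hz, hw, add_mul]
    | tmul B C => simp
  rw [conv_apply, ofConv_toConv, h]
  have := Coalgebra.lTensor_counit_comul (R := ℝ) B
  change U.counit.toLinearMap.lTensor _ (U.comul B) = _ at this
  rw [this, TensorProduct.rid_tmul, one_smul]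

/-- Cocommutativity exchanges the two legs of the coproduct, so commuting values suffice. -/
theorem conv_comm (f g : WithConv (U d →ₗ[ℝ] A))
    (h : ∀ B C, f.ofConv B * g.ofConv C = g.ofConv C * f.ofConv B) : f * g = g * f := by
  refine WithConv.ext (LinearMap.ext fun B => ?_)
  have h' (z : U d ⊗[ℝ] U d) : LinearMap.mul' ℝ A (TensorProduct.map f.ofConv g.ofConv z)
      = LinearMap.mul' ℝ A (TensorProduct.map g.ofConv f.ofConv (TensorProduct.comm ℝ _ _ z)) := by
    induction z using TensorProduct.induction_on with
    | zero => simp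
    | add z w hz hw => simp only [map_add, hz, hw]
    | tmul B C => simp [h]
  rw [conv_apply, conv_apply, h']
  congr 2
  exact Coalgebra.comm_comul ℝ B

theorem conv_counit_left (f : WithConv (U d →ₗ[ℝ] A)) (c : A) (B : U d) :
    (toConv ((U.counit (d := d)).toLinearMap.smulRight c) * f).ofConv B = c * f.ofConv B := by
  have h (z : U d ⊗[ℝ] U d) :
      LinearMap.mul' ℝ A (TensorProduct.map
        ((U.counit (d := d)).toLinearMap.smulRight c) f.ofConv z)
        = c * f.ofConv (TensorProduct.lid ℝ _ (U.counit.toLinearMap.rTensor _ z)) := by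
    induction z using TensorProduct.induction_on with
    | zero => simp
    | add z w hz hw => simp only [map_add, hz, hw, mul_add]
    | tmul B C => simp
  rw [conv_apply, ofConv_toConv, h]
  have := Coalgebra.rTensor_counit_comul (R := ℝ) B
  change U.counit.toLinearMap.rTensor _ (U.comul B) = _ at this
  rw [this, TensorProduct.lid_tmul, one_smul]

end Convolution

/-- The map `v ↦ (A ↦ A ▷ v)` into the convolution algebra of `U(𝒱_0)`. -/
noncomputable def envActConv : V d →ₗ[ℝ] WithConv (U d →ₗ[ℝ] U d) :=
  (WithConv.linearEquiv ℝ (U d →ₗ[ℝ] U d)).symm.toLinearMap.comp (envAct.compr₂ U.incl)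

theorem envActConv_apply (v : V d) (A : U d) :
    (envActConv v).ofConv A = U.incl (envAct v A) := rfl

theorem envActConv_X (i : Fin (d + 1)) :
    envActConv (V.X i : V d)
      = toConv ((U.counit (d := d)).toLinearMap.smulRight (U.incl (V.X i))) := by
  refine WithConv.ext (LinearMap.ext fun A => ?_)
  rw [envActConv_apply, envAct_X, map_smul]; rfl

/-- The post-Lie product in its right argument: `B ↦ (A ↦ A ▷ B)` is an algebra morphism into the
convolution algebra. -/
noncomputable def extHom : U d →ₐ[ℝ] WithConv (U d →ₗ[ℝ] U d) :=
  UniversalEnvelopingAlgebra.lift ℝ <| V.lieHom envActConv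
    (fun a σ b τ => conv_comm _ _ fun B C => by
      rw [envActConv_apply, envActConv_apply, envAct_planted, envAct_planted, ← sub_eq_zero,
        ← U.incl_lie, V.lie_planted_planted, map_zero])
    (fun i j => conv_comm _ _ fun B C => by
      rw [envActConv_apply, envActConv_apply, envAct_X, envAct_X, map_smul, map_smul,
        smul_mul_smul_comm, smul_mul_smul_comm, (U.incl_X_commute i j).eq, mul_comm])
    -- Convolution with the image `ε X_i` of `X_i` is multiplication by `X_i`, so at each `A` the
    -- relation is the bracket of `I_a(insertOp A σ)` with `X_i`.
    (fun a σ i => by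
      refine WithConv.ext (LinearMap.ext fun A => ?_)
      have h : (if a i = 0 then 0
          else envActConv (V.planted (a - unitIdx i) (Finsupp.single σ 1))).ofConv A
          = if a i = 0 then 0
            else (envActConv (V.planted (a - unitIdx i) (Finsupp.single σ 1))).ofConv A := by
        split_ifs <;> rfl
      rw [h, envActConv_X, ofConv_sub, LinearMap.sub_apply, conv_counit_right, conv_counit_left,
        envActConv_apply, envAct_planted, ← U.incl_lie, V.lie_planted_X, envActConv_apply,
        envAct_planted, apply_ite U.incl, map_zero])

theorem extHom_incl (v : V d) : extHom (U.incl v) = envActConv v := U.lift_incl _ v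

/-- The extension of the post-Lie product to `U(𝒱_0)`. -/
noncomputable def postLieExt : U d →ₗ[ℝ] U d →ₗ[ℝ] U d :=
  ((WithConv.linearEquiv ℝ (U d →ₗ[ℝ] U d)).toLinearMap.comp extHom.toLinearMap).flip

theorem postLieExt_apply (A B : U d) : postLieExt A B = (extHom B).ofConv A := rfl

theorem postLieExt_incl (A : U d) (v : V d) : postLieExt A (U.incl v) = U.incl (envAct v A) := by
  rw [postLieExt_apply, extHom_incl]; rfl

theorem postLieExt_mul (A B C : U d) :
    postLieExt A (B * C) = LinearMap.mul' ℝ (U d)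
      (TensorProduct.map (postLieExt.flip B) (postLieExt.flip C) (U.comul A)) := by
  rw [postLieExt_apply, map_mul]; rfl

theorem postLieExt_one (A : U d) : postLieExt A 1 = algebraMap ℝ (U d) (U.counit A) := by
  rw [postLieExt_apply, map_one]; rfl

theorem postLieExt_incl_one (u : V d) : postLieExt (U.incl u) 1 = 0 := by
  rw [postLieExt_one, U.counit_incl, map_zero]

theorem postLieExt_incl_incl (u v : V d) :
    postLieExt (U.incl u) (U.incl v) = U.incl (postLie u v) := by
  rw [postLieExt_incl, envAct_incl]

theorem postLieExt_one_left (A : U d) : postLieExt 1 A = A := by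
  induction A using U.left_induction with
  | one => rw [postLieExt_one]; simp
  | add A B hA hB => rw [map_add, hA, hB]
  | smul c A hA => rw [map_smul, hA]
  | incl_mul u A hA =>
    rw [postLieExt_mul, map_one, Algebra.TensorProduct.one_def, TensorProduct.map_tmul]
    simp [hA, postLieExt_incl, envAct_one]

theorem postLieExt_incl_mul (u : V d) (B C : U d) :
    postLieExt (U.incl u) (B * C) = postLieExt (U.incl u) B * C + B * postLieExt (U.incl u) C := by
  rw [postLieExt_mul, U.comul_incl]
  simp [postLieExt_one_left]

/-! ## The action on new nodes -/

/-- The element `u` of `𝒱` acts on the nodes above the newly created edges. -/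
noncomputable def newOp (u : V d) : Module.End ℝ (TreeSpan d (Idx d × Bool)) :=
  nodeOp (fun _ => true) (localOp (fun b => (b, false)) flagL u)
    - nodeOp (fun e => !e.2) (localOp (fun b => (b, false)) flagL u)

theorem newOp_flagL (u : V d) (x : TreeSpan d (Idx d)) : newOp u (flagL x) = 0 := by
  rw [newOp, LinearMap.sub_apply, flagL_nodeAct u _ (fun _ => rfl),
    flagL_nodeAct u _ (fun _ => rfl), sub_self]

theorem forgetL_newOp (u : V d) (x : TreeSpan d (Idx d × Bool)) :
    forgetL (newOp u x) = nodeAct u (forgetL x) - forgetL (oldRep (U.incl u) x) := by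
  rw [newOp, LinearMap.sub_apply, map_sub, forgetL_nodeOp_true, forgetL_oldRep_incl]

/-- The difference of two sums over nodes, commuted with a sum over fewer nodes. -/
theorem nodeOp_sub_lie (op op' : E → Bool) (hop : ∀ e, op' e = true → op e = true)
    (φ ψ χ : Idx d → ℕ → TreeSpan d E)
    (h : ∀ n m, nodeOp op φ (ψ n m) - nodeOp op' φ (ψ n m) = χ n m) :
    (nodeOp op φ - nodeOp op' φ) * nodeOp op' ψ
      = nodeOp op' χ + nodeOp op' ψ * (nodeOp op φ - nodeOp op' φ) := by
  have h1 := nodeOp_lie op op' φ ψ _ (fun _ _ => rfl)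
  have h2 := nodeOp_lie op' op' φ ψ _ (fun _ _ => rfl)
  have hop' : (fun e => op e && op' e) = op' := by
    funext e
    cases he : op' e
    · simp
    · simp [hop e he]
  have hop2 : (fun e => op' e && op' e) = op' := funext fun e => Bool.and_self _
  rw [hop'] at h1
  rw [hop2] at h2
  -- The commutators of `nodeOp op φ` and of `nodeOp op' φ` with `nodeOp op' ψ` are both sums over
  -- the nodes seen by `op'`. In the difference of their local operations the terms `nodeOp op' ψ (φ
  -- n m)` cancel.
  have h3 : χ = (fun n m => nodeOp op φ (ψ n m) - nodeOp op' ψ (φ n m))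
      - fun n m => nodeOp op' φ (ψ n m) - nodeOp op' ψ (φ n m) := by
    funext n m
    simp only [Pi.sub_apply]
    rw [← h]; abel
  rw [h3, map_sub, ← h1, ← h2]
  refine LinearMap.ext fun x => ?_
  simp only [LinearMap.sub_apply, LinearMap.add_apply, Module.End.mul_apply, map_sub]
  abel

/-- The root contributes equally to both node sums and cancels; only the sum over all nodes crosses
the new edge. -/
theorem newOp_graftL_true (u : V d) (a : Idx d) (x : TreeSpan d (Idx d)) (n : Idx d) (m : ℕ) :
    newOp u (graftL (a, true) (flagL x) (Finsupp.single (root n m) 1))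
      = graftL (a, true) (flagL (nodeAct u x)) (Finsupp.single (root n m) 1) := by
  rw [newOp, LinearMap.sub_apply, nodeOp_graftL_of_true _ rfl, nodeOp_graftL_of_false _ rfl,
    nodeOp_root, nodeOp_root, flagL_nodeAct u _ (fun _ => rfl), add_sub_cancel_right]

theorem newOp_root (u : V d) (n : Idx d) (m : ℕ) :
    newOp u (Finsupp.single (root n m) 1) = 0 := by
  rw [newOp, LinearMap.sub_apply, nodeOp_root, nodeOp_root, sub_self]

/-- The nodes created by inserting `I_a(σ)` are those of `σ`, and acting on them replaces `I_a(σ)`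
by `u ▷ I_a(σ)`. Inserting `X_i` creates no node, in accordance with `u ▷ X_i = 0`. -/
theorem newOp_localOp (u v : V d) (n : Idx d) (m : ℕ) :
    newOp u (localOp (fun b => (b, true)) flagL v n m)
      = localOp (fun b => (b, true)) flagL (postLie u v) n m := by
  change _ = localOp (fun b => (b, true)) flagL (postLieL u v) n m
  induction v using V.induction with
  | add v w hv hw => simp only [map_add, Pi.add_apply, hv, hw]
  | smul c v hv => simp only [map_smul, Pi.smul_apply, hv]
  | X i =>
    have h : postLieL u (V.X i) = 0 := postLie_X u i
    rw [h, localOp_X, map_zero, raiseAt, newOp_root]; rfl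
  | planted a σ =>
    have h : postLieL u (V.planted a (Finsupp.single σ 1)) = _ := postLie_planted u a _
    rw [h, localOp_planted, localOp_planted, graftAtL_apply, graftAtL_apply, map_sum]
    exact Finset.sum_congr rfl fun l _ => by rw [map_smul, newOp_graftL_true]

theorem newOp_oldRep_incl (u v : V d) (x : TreeSpan d (Idx d × Bool)) :
    newOp u (oldRep (U.incl v) x)
      = oldRep (U.incl (postLie u v)) x + oldRep (U.incl v) (newOp u x) := by
  have h := nodeOp_sub_lie (fun _ => true) (fun e : Idx d × Bool => !e.2) (fun _ _ => rfl)
    (localOp (fun b => (b, false)) flagL u) (localOp (fun b => (b, true)) flagL v)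
    (localOp (fun b => (b, true)) flagL (postLie u v)) (fun n m => newOp_localOp u v n m)
  have h' := LinearMap.congr_fun h x
  rw [← oldRep_incl, ← oldRep_incl, LinearMap.add_apply, Module.End.mul_apply,
    Module.End.mul_apply] at h'
  exact h'

/-- The commutator with `newOp u` and the map `u ▷ ·` are both derivations, so their agreement on
`𝒱` extends to `U(𝒱_0)`. -/
theorem newOp_oldRep (u : V d) (A : U d) (x : TreeSpan d (Idx d × Bool)) :
    newOp u (oldRep A x) = oldRep (postLieExt (U.incl u) A) x + oldRep A (newOp u x) := by
  induction A using U.left_induction with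
  | one => rw [postLieExt_incl_one]; simp
  | add A B hA hB => simp only [map_add, LinearMap.add_apply, hA, hB]; abel
  | smul c A hA => simp only [map_smul, LinearMap.smul_apply, hA, smul_add]
  | incl_mul v A hA =>
    rw [map_mul, Module.End.mul_apply, newOp_oldRep_incl, hA, postLieExt_incl_mul,
      postLieExt_incl_incl, map_add, map_add, map_mul, map_mul, LinearMap.add_apply,
      Module.End.mul_apply, Module.End.mul_apply, Module.End.mul_apply, add_assoc]

/-- After the insertion of `A`, acting by `u` on the old nodes is acting on all nodes minus acting
on the new ones. The subtracted term is the insertion of `u ▷ A`, because the initial tree has no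
new nodes. -/
theorem insertOp_incl_mul (u : V d) (A : U d) (x : TreeSpan d (Idx d)) :
    insertOp (U.incl u * A) x
      = nodeAct u (insertOp A x) - insertOp (postLieExt (U.incl u) A) x := by
  have h := congrArg forgetL (newOp_oldRep u A (flagL x))
  rw [newOp_flagL, map_zero, add_zero, forgetL_newOp] at h
  rw [insertOp_apply, insertOp_apply, insertOp_apply, ← h, map_mul, Module.End.mul_apply]
  abel

theorem counit_postLieExt_incl (u : V d) (A : U d) : U.counit (postLieExt (U.incl u) A) = 0 := by
  induction A using U.left_induction with
  | one => rw [postLieExt_incl_one, map_zero]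
  | add A B hA hB => rw [map_add, map_add, hA, hB, add_zero]
  | smul c A hA => rw [map_smul, map_smul, hA, smul_zero]
  | incl_mul v A hA =>
    rw [postLieExt_incl_mul, postLieExt_incl_incl, map_add, map_mul, map_mul, U.counit_incl,
      U.counit_incl, zero_mul, zero_mul, add_zero]

theorem envAct_incl_mul (u : V d) (A : U d) (v : V d) :
    envAct v (U.incl u * A) = postLie u (envAct v A) - envAct v (postLieExt (U.incl u) A) := by
  change _ = postLieL u (envAct v A) - _
  induction v using V.induction with
  | add v w hv hw => simp only [map_add, LinearMap.add_apply, hv, hw]; abel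
  | smul c v hv => simp only [map_smul, LinearMap.smul_apply, hv, smul_sub]
  | X i =>
    -- For `v = X_i` every term vanishes: the counit kills both `u A` and `u ▷ A`, and `u ▷ X_i =
    -- 0`.
    have h : postLieL u (V.X i) = 0 := postLie_X u i
    rw [envAct_X, envAct_X, envAct_X, map_mul, U.counit_incl, counit_postLieExt_incl, map_smul, h]
    simp
  | planted a σ =>
    rw [envAct_planted, envAct_planted, envAct_planted, insertOp_incl_mul, map_sub]
    congr 1
    exact (postLie_planted u a _).symm

theorem isPostLieExtension_postLieExt : IsPostLieExtension (postLieExt (d := d)) where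
  incl_incl := postLieExt_incl_incl
  incl_one := postLieExt_incl_one
  incl_mul := postLieExt_incl_mul
  one_left := postLieExt_one_left
  mul_left u A v := by
    rw [postLieExt_incl, postLieExt_incl A, postLieExt_incl_incl, postLieExt_incl, envAct_incl_mul,
      map_sub]
  mul_right := postLieExt_mul

/-! ## Uniqueness of the extension -/

/-- The filtration of `U(𝒱_0)` by the number of factors. -/
noncomputable def U.filtration (n : ℕ) : Submodule ℝ (U d) :=
  LinearMap.range (U.incl (d := d)) ^ n

theorem U.filtration_induction {P : U d → Prop} (add : ∀ A B, P A → P B → P (A + B))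
    (h : ∀ n, ∀ A ∈ U.filtration n, P A) (A : U d) : P A := by
  have hA : A ∈ ⨆ n, U.filtration (d := d) n := by
    induction A using U.left_induction with
    | one => exact Submodule.mem_iSup_of_mem 0 (by rw [U.filtration, pow_zero]; exact Submodule.one_le.mp le_rfl)
    | add A B hA hB => exact add_mem hA hB
    | smul c A hA => exact Submodule.smul_mem _ c hA
    | incl_mul u A hA =>
      induction hA using Submodule.iSup_induction' with
      | mem n A hA =>
        refine Submodule.mem_iSup_of_mem (n + 1) ?_
        rw [U.filtration, pow_succ']
        exact Submodule.mul_mem_mul ⟨u, rfl⟩ hA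
      | zero => rw [mul_zero]; exact zero_mem _
      | add A B _ _ hA hB => rw [mul_add]; exact add_mem hA hB
  induction hA using Submodule.iSup_induction' with
  | mem n A hA => exact h n A hA
  | zero => exact h 0 0 (zero_mem _)
  | add A B _ _ hA hB => exact add A B hA hB

/-- The derivation `u ▷ ·` replaces one factor at a time, so it preserves the number of factors.
This makes the rule for `(uB) ▷ v` a recursion on that number. -/
theorem postLieExt_incl_mem_filtration (u : V d) (n : ℕ) :
    ∀ A ∈ U.filtration n, postLieExt (U.incl u) A ∈ U.filtration n := by
  induction n with
  | zero =>
    intro A hA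
    rw [U.filtration, pow_zero] at hA ⊢
    obtain ⟨c, rfl⟩ := Submodule.mem_one.mp hA
    rw [Algebra.algebraMap_eq_smul_one, map_smul, postLieExt_incl_one, smul_zero]
    exact zero_mem _
  | succ n ih =>
    intro A hA
    rw [U.filtration, pow_succ'] at hA ⊢
    induction hA using Submodule.mul_induction_on' with
    | mem_mul_mem v hv B hB =>
      obtain ⟨v, rfl⟩ := hv
      rw [postLieExt_incl_mul, postLieExt_incl_incl]
      exact add_mem (Submodule.mul_mem_mul ⟨_, rfl⟩ hB)
        (Submodule.mul_mem_mul ⟨_, rfl⟩ (ih B hB))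
    | add A _ B _ hA hB => rw [map_add]; exact add_mem hA hB

namespace IsPostLieExtension

variable {T : U d →ₗ[ℝ] U d →ₗ[ℝ] U d}

theorem apply_incl (hT : IsPostLieExtension T) (u : V d) (A : U d) : T (U.incl u) A = postLieExt (U.incl u) A := by
  induction A using U.left_induction with
  | one => rw [hT.incl_one, postLieExt_incl_one]
  | add A B hA hB => rw [map_add, map_add, hA, hB]
  | smul c A hA => rw [map_smul, map_smul, hA]
  | incl_mul v A hA =>
    rw [hT.incl_mul, postLieExt_incl_mul, hA, hT.incl_incl, postLieExt_incl_incl]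

/-- The rule for `(uB) ▷ v` involves only `B` and `u ▷ B`, which have one factor fewer; induction on
the number of factors leaves no freedom. -/
theorem apply_apply_incl (hT : IsPostLieExtension T) (A : U d) :
    ∀ v : V d, T A (U.incl v) = postLieExt A (U.incl v) := by
  have key (n : ℕ) : ∀ A ∈ U.filtration n, ∀ v : V d,
      T A (U.incl v) = postLieExt A (U.incl v) := by
    induction n with
    | zero =>
      intro A hA v
      rw [U.filtration, pow_zero] at hA
      obtain ⟨c, rfl⟩ := Submodule.mem_one.mp hA
      rw [Algebra.algebraMap_eq_smul_one, map_smul, map_smul, LinearMap.smul_apply,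
        LinearMap.smul_apply, hT.one_left, postLieExt_one_left]
    | succ n ih =>
      intro A hA
      rw [U.filtration, pow_succ'] at hA
      induction hA using Submodule.mul_induction_on' with
      | mem_mul_mem u hu B hB =>
        obtain ⟨u, rfl⟩ := hu
        intro v
        rw [hT.mul_left, isPostLieExtension_postLieExt.mul_left, ih B hB, hT.apply_incl,
          hT.apply_incl, ih _ (postLieExt_incl_mem_filtration u n B hB)]
      | add A _ B _ hA hB =>
        intro v
        rw [map_add, map_add, LinearMap.add_apply, LinearMap.add_apply, hA, hB]
  induction A using U.filtration_induction with
  | add A B hA hB =>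
    intro v
    rw [map_add, map_add, LinearMap.add_apply, LinearMap.add_apply, hA, hB]
  | h n A hA => exact key n A hA

theorem apply_X (hT : IsPostLieExtension T) (A : U d) (i : Fin (d + 1)) :
    T A (U.incl (V.X i)) = U.counit A • U.incl (V.X i) := by
  rw [hT.apply_apply_incl, postLieExt_incl, envAct_X, map_smul]

/-- The axioms give `A ▷ 1` directly only for special `A`. In general, expanding `A ▷ (X_0 · 1)` by
the coproduct gives `X_0 (A ▷ 1)`, while `A ▷ X_0 = ε(A) X_0`; cancelling `X_0` determines `A ▷ 1`.
-/
theorem apply_one (hT : IsPostLieExtension T) (A : U d) :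
    T A 1 = algebraMap ℝ (U d) (U.counit A) := by
  have h := hT.mul_right A (U.incl (V.X 0)) 1
  have hX : T.flip (U.incl (V.X 0)) = U.counit.toLinearMap.smulRight (U.incl (V.X 0)) :=
    LinearMap.ext fun B => hT.apply_X B 0
  rw [mul_one, hT.apply_X, hX] at h
  have h2 := (conv_counit_left (toConv (T.flip 1)) (U.incl (V.X 0)) A).symm.trans h.symm
  refine U.incl_X_mul_injective 0 ?_
  refine h2.trans ?_
  change _ = U.incl (V.X 0) * algebraMap ℝ (U d) (U.counit A)
  rw [← Algebra.commutes, Algebra.smul_def]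

/-- The value at `1` and the product rule say that `B ↦ (A ↦ A ▷ B)` is an algebra morphism into the
convolution algebra, and such a morphism is determined on `𝒱`. -/
theorem eq_postLieExt (hT : IsPostLieExtension T) : T = postLieExt := by
  let f : U d →ₐ[ℝ] WithConv (U d →ₗ[ℝ] U d) :=
    AlgHom.ofLinearMap ((WithConv.linearEquiv ℝ (U d →ₗ[ℝ] U d)).symm.toLinearMap.comp T.flip)
      (WithConv.ext (LinearMap.ext fun A => hT.apply_one A))
      (fun B C => WithConv.ext (LinearMap.ext fun A => hT.mul_right A B C))
  have hf : f = extHom := U.algHom_ext fun v =>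
    WithConv.ext (LinearMap.ext fun A => hT.apply_apply_incl A v)
  refine LinearMap.ext fun A => LinearMap.ext fun B => ?_
  exact congrArg (fun g : U d →ₐ[ℝ] WithConv (U d →ₗ[ℝ] U d) => (g B).ofConv A) hf

end IsPostLieExtension

/-! ## The insertion operators on products and on one-node trees -/

/-- Along an original edge, the old nodes of `I_a(σ) τ` are those of `σ` together with those of `τ`.
So `𝒱` acts by the Leibniz rule, and `U(𝒱_0)` through its coproduct. -/
theorem oldRep_lift_graftL (A : U d) (a : Idx d)
    (z : TreeSpan d (Idx d × Bool) ⊗[ℝ] TreeSpan d (Idx d × Bool)) :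
    oldRep A (TensorProduct.lift (graftL (a, false)) z)
      = TensorProduct.lift (graftL (a, false)) (U.tensorRep oldRep oldRep A z) := by
  refine (U.intertwine (U.tensorRep oldRep oldRep) oldRep _ (fun u w => ?_) A z).symm
  rw [U.tensorRep_incl]
  induction w using TensorProduct.induction_on with
  | zero => simp
  | add z w hz hw => simp only [map_add, hz, hw]
  | tmul x y =>
    rw [TensorProduct.lift.tmul, oldRep_incl, nodeOp_graftL_of_true _ rfl]
    simp

theorem insertOp_graftL (A : U d) (a : Idx d) (x y : TreeSpan d (Idx d)) :
    insertOp A (graftL a x y) = TensorProduct.lift (graftL a)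
      (TensorProduct.map (insertOp.flip x) (insertOp.flip y) (U.comul A)) := by
  rw [insertOp_apply, flagL_graftL, ← TensorProduct.lift.tmul, oldRep_lift_graftL,
    U.tensorRep_tmul]
  induction U.comul A using TensorProduct.induction_on with
  | zero => simp
  | add z w hz hw => simp only [map_add, hz, hw]
  | tmul B C =>
    simp only [TensorProduct.map_tmul, TensorProduct.lift.tmul, forgetL_graftL]
    rfl

/-- The projection to the trees all of whose branches at the root are new. -/
noncomputable def newBranches : Module.End ℝ (TreeSpan d (Idx d × Bool)) :=
  Finsupp.linearCombination ℝ (recOn (fun n m => Finsupp.single (root n m) 1)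
    (fun e σ _ _ z => if e.2 = true then graftL e (Finsupp.single σ 1) z else 0)
    (fun e σ _ e' σ' _ _ _ => by
      cases e.2 <;> cases e'.2 <;> simp [graftL_comm e e']))

theorem newBranches_root (n : Idx d) (m : ℕ) :
    newBranches (Finsupp.single (root n m) 1) = Finsupp.single (root n m) 1 := by
  simp [newBranches]

theorem newBranches_graftL (e : Idx d × Bool) (x y : TreeSpan d (Idx d × Bool)) :
    newBranches (graftL e x y) = if e.2 = true then graftL e x (newBranches y) else 0 := by
  have := graftL_hom_ext (f := (graftL e).compr₂ newBranches)
    (g := if e.2 = true then (graftL e).compl₂ newBranches else 0) (fun σ τ => ?_) x y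
  · refine this.trans ?_
    split_ifs <;> rfl
  · rw [LinearMap.compr₂_apply, graftL_single]
    split_ifs with h <;> simp [newBranches, h]

/-- The representation of `U(𝒱_0)` at the root, the grafted branches being flagged as new. -/
noncomputable def flagRootRep : U d →ₐ[ℝ] Module.End ℝ (TreeSpan d (Idx d × Bool)) :=
  UniversalEnvelopingAlgebra.lift ℝ
    (nodeRep (fun _ => false) (fun b => (b, true)) (fun _ => rfl) flagL)

theorem flagRootRep_incl (u : V d) :
    flagRootRep (U.incl u) = nodeOp (fun _ => false) (localOp (fun b => (b, true)) flagL u) :=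
  U.lift_incl _ u

theorem forgetL_flagRootRep (A : U d) (x : TreeSpan d (Idx d × Bool)) :
    forgetL (flagRootRep A x) = rootRep A (forgetL x) := by
  refine U.intertwine flagRootRep rootRep forgetL (fun u w => ?_) A x
  rw [flagRootRep_incl, rootRep_incl]
  have hid : (mapEdgesL Prod.fst).comp flagL
      = (LinearMap.id : TreeSpan d (Idx d) →ₗ[ℝ] TreeSpan d (Idx d)) :=
    LinearMap.ext forgetL_flagL
  have h (n : Idx d) (m : ℕ) :
      mapEdgesL Prod.fst (localOp (fun b : Idx d => (b, true)) flagL u n m)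
        = localOp id LinearMap.id u n m := by
    rw [mapEdgesL_localOp, hid]; rfl
  exact mapEdgesL_nodeOp Prod.fst (fun _ => false) _ _ h w

theorem newBranches_localOp (u : V d) (n : Idx d) (m : ℕ) :
    newBranches (localOp (fun b => (b, true)) flagL u n m)
      = localOp (fun b => (b, true)) flagL u n m := by
  induction u using V.induction with
  | add u v hu hv => simp only [map_add, Pi.add_apply, hu, hv]
  | smul c u hu => simp only [map_smul, Pi.smul_apply, hu]
  | X i => rw [localOp_X, raiseAt, newBranches_root]
  | planted a σ =>
    rw [localOp_planted, graftAtL_apply, map_sum]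
    exact Finset.sum_congr rfl fun l _ => by
      rw [map_smul, newBranches_graftL, if_pos rfl, newBranches_root]

theorem newBranches_flagRootRep (A : U d) (x : TreeSpan d (Idx d × Bool)) :
    newBranches (flagRootRep A x) = flagRootRep A (newBranches x) := by
  refine U.intertwine flagRootRep flagRootRep newBranches (fun u w => ?_) A x
  rw [flagRootRep_incl]
  refine LinearMap.congr_fun (f := newBranches.comp (nodeOp (fun _ => false)
      (localOp (fun b => (b, true)) flagL u)))
    (g := (nodeOp (fun _ => false) (localOp (fun b => (b, true)) flagL u)).comp newBranches)
    (TreeSpan.hom_induct (fun n m => ?_) fun e σ τ _ hτ => ?_) w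
  · simp only [LinearMap.comp_apply]
    rw [nodeOp_root, newBranches_root, nodeOp_root, newBranches_localOp]
  · simp only [LinearMap.comp_apply] at hτ ⊢
    rw [nodeOp_graftL_of_false _ rfl, newBranches_graftL, newBranches_graftL, hτ]
    split_ifs
    · rw [nodeOp_graftL_of_false _ rfl]
    · rw [map_zero]

/-- If all branches at the root are new, the root is the only old node. This persists under further
insertions, as `newBranches` commutes with the action at the root. -/
theorem oldRep_newBranches (A : U d) (x : TreeSpan d (Idx d × Bool)) :
    oldRep A (newBranches x) = flagRootRep A (newBranches x) := by
  have key (u : V d) (x : TreeSpan d (Idx d × Bool)) :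
      oldRep (U.incl u) (newBranches x) = flagRootRep (U.incl u) (newBranches x) := by
    rw [oldRep_incl, flagRootRep_incl]
    refine LinearMap.congr_fun (f := (nodeOp (fun e => !e.2)
        (localOp (fun b => (b, true)) flagL u)).comp newBranches)
      (g := (nodeOp (fun _ => false) (localOp (fun b => (b, true)) flagL u)).comp newBranches)
      (TreeSpan.hom_induct (fun n m => ?_) fun e σ τ _ hτ => ?_) x
    · simp only [LinearMap.comp_apply]
      rw [newBranches_root, nodeOp_root, nodeOp_root]
    · simp only [LinearMap.comp_apply] at hτ ⊢
      rw [newBranches_graftL]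
      split_ifs with he
      · rw [nodeOp_graftL_of_false (op := fun e : Idx d × Bool => !e.2) _ (by simp [he]),
          nodeOp_graftL_of_false (op := fun _ => false) _ rfl, hτ]
      · rw [map_zero, map_zero]
  induction A using U.left_induction with
  | one => rw [map_one, map_one]
  | add A B hA hB => simp only [map_add, LinearMap.add_apply, hA, hB]
  | smul c A hA => simp only [map_smul, LinearMap.smul_apply, hA]
  | incl_mul u A hA =>
    rw [map_mul, map_mul, Module.End.mul_apply, Module.End.mul_apply, hA,
      ← newBranches_flagRootRep, key]

theorem insertOp_root (A : U d) (n : Idx d) (m : ℕ) :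
    insertOp A (Finsupp.single (root n m) 1) = rootRep A (Finsupp.single (root n m) 1) := by
  rw [insertOp_apply, flagL_root, ← newBranches_root, oldRep_newBranches, newBranches_root,
    forgetL_flagRootRep, ← flagL_root, forgetL_flagL]

/-! ## The products `⋆₂` and `*` coincide -/

theorem localOp_mem_positiveSpan (u : V d) (n : Idx d) :
    localOp id LinearMap.id u n 0 ∈ positiveSpan d := by
  induction u using V.induction with
  | add u v hu hv => rw [map_add]; exact add_mem hu hv
  | smul c u hu => rw [map_smul]; exact Submodule.smul_mem _ c hu
  | X i => rw [localOp_X]; exact single_root_mem_positiveSpan _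
  | planted a σ =>
    rw [localOp_planted, graftAtL_apply]
    exact Submodule.sum_mem _ fun l _ => Submodule.smul_mem _ _
      (graftL_mem_positiveSpan _ _ (single_root_mem_positiveSpan _))

theorem rootRep_mem_positiveSpan (A : U d) (x : TreeSpan d (Idx d)) (hx : x ∈ positiveSpan d) :
    rootRep A x ∈ positiveSpan d := by
  have key (u : V d) : ∀ x ∈ positiveSpan d, rootRep (U.incl u) x ∈ positiveSpan d := by
    rw [rootRep_incl]
    refine positiveSpan_induction ?_ ?_ ?_ ?_ ?_
    · rw [map_zero]; exact zero_mem _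
    · intro x y hx hy; rw [map_add]; exact add_mem hx hy
    · intro c x hx; rw [map_smul]; exact Submodule.smul_mem _ c hx
    · intro n; rw [nodeOp_root]; exact localOp_mem_positiveSpan u n
    · intro a σ τ _ ih
      rw [nodeOp_graftL_of_false _ rfl]
      exact graftL_mem_positiveSpan _ _ ih
  induction A using U.left_induction with
  | one => rwa [map_one]
  | add A B hA hB => rw [map_add]; exact add_mem hA hB
  | smul c A hA => rw [map_smul]; exact Submodule.smul_mem _ c hA
  | incl_mul u A hA => rw [map_mul]; exact key u _ hA

theorem insertOp_mem_positiveSpan (A : U d) (x : TreeSpan d (Idx d)) (hx : x ∈ positiveSpan d) :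
    insertOp A x ∈ positiveSpan d := by
  refine positiveSpan_induction (P := fun x => ∀ A : U d, insertOp A x ∈ positiveSpan d)
    ?_ ?_ ?_ ?_ ?_ x hx A
  · intro A; rw [map_zero]; exact zero_mem _
  · intro x y hx hy A; rw [map_add]; exact add_mem (hx A) (hy A)
  · intro c x hx A; rw [map_smul]; exact Submodule.smul_mem _ c (hx A)
  · intro n A
    rw [insertOp_root]
    exact rootRep_mem_positiveSpan A _ (single_root_mem_positiveSpan n)
  · intro a σ τ _ ih A
    rw [insertOp_graftL]
    induction U.comul A using TensorProduct.induction_on with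
    | zero => simp
    | add z w hz hw => simp only [map_add]; exact add_mem hz hw
    | tmul B C => exact graftL_mem_positiveSpan _ _ (ih C)

/-- Each factor `X_i` sees only the counit of its leg of the coproduct, so the coproduct of `A`
collapses. -/
theorem postLieExt_orderedMonomial_root (A : U d) (n : Idx d) :
    postLieExt A (orderedMonomial (root n 0)) = U.counit A • orderedMonomial (root n 0) := by
  induction n using Idx.induction generalizing A with
  | zero => rw [orderedMonomial_root_zero, postLieExt_one, Algebra.algebraMap_eq_smul_one]
  | succ n i ih =>
    rw [orderedMonomial_root_add, postLieExt_mul]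
    have hX : postLieExt.flip (U.incl (V.X i))
        = (U.counit (d := d)).toLinearMap.smulRight (U.incl (V.X i)) :=
      LinearMap.ext fun B => isPostLieExtension_postLieExt.apply_X B i
    rw [hX]
    refine (conv_counit_right (toConv (postLieExt.flip (orderedMonomial (root n 0))))
      (U.incl (V.X i)) A).trans ?_
    rw [ofConv_toConv, LinearMap.flip_apply, ih, smul_mul_assoc]

theorem postLieStar_eq_conv (A B : U d) :
    postLieStar postLieExt A B
      = (toConv LinearMap.id * toConv (postLieExt.flip B)).ofConv A := rfl

/-- On `X^n` both sides are `A X^n`: insertion is the action at the root, and `A ▷ X^n = ε(A) X^n`.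
For a further branch, associativity of convolution gives `A * (B C) = ∑ (A^{(1)} * B) (A^{(2)} ▷
C)`, which matches the distribution of `A` over `σ` and `τ` in `insertOp_graftL`. -/
theorem pbw_insertOp (A : U d) (x : TreeSpan d (Idx d)) (hx : x ∈ positiveSpan d) :
    pbw (insertOp A x) = postLieStar postLieExt A (pbw x) := by
  refine positiveSpan_induction
    (P := fun x => ∀ A : U d, pbw (insertOp A x) = postLieStar postLieExt A (pbw x))
    ?_ ?_ ?_ ?_ ?_ x hx A
  · intro A; simp [postLieStar]
  · intro x y hx hy A
    rw [map_add, map_add, hx, hy]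
    simp only [postLieStar_eq_conv, map_add, toConv_add, mul_add, ofConv_add, LinearMap.add_apply]
  · intro c x hx A
    rw [map_smul, map_smul, hx]
    simp only [postLieStar_eq_conv, map_smul, toConv_smul, mul_smul_comm, ofConv_smul,
      LinearMap.smul_apply]
  · intro n A
    rw [insertOp_root, pbw_rootRep A _ (single_root_mem_positiveSpan n), pbw_single,
      postLieStar_eq_conv]
    have h : postLieExt.flip (orderedMonomial (root n 0 : Tree d))
        = (U.counit (d := d)).toLinearMap.smulRight (orderedMonomial (root n 0)) :=
      LinearMap.ext fun B => postLieExt_orderedMonomial_root B n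
    rw [h, conv_counit_right]; rfl
  · intro a σ τ _ ih A
    rw [pbw_graftL, postLieStar_eq_conv]
    set B := pbw (Finsupp.single τ 1) with hB
    set C : U d := U.incl (V.planted a (Finsupp.single σ 1)) with hC
    have h1 : toConv (postLieExt.flip (B * C))
        = toConv (postLieExt.flip B) * toConv (postLieExt.flip C) := map_mul extHom B C
    have h2 : toConv LinearMap.id * toConv (postLieExt.flip B)
        = toConv (pbw.comp (insertOp.flip (Finsupp.single τ 1))) :=
      WithConv.ext (LinearMap.ext fun A => (ih A).symm)
    have h3 : postLieExt.flip C
        = (U.incl.comp (V.planted a)).comp (insertOp.flip (Finsupp.single σ 1)) :=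
      LinearMap.ext fun A => by
        rw [LinearMap.flip_apply, hC, postLieExt_incl, envAct_planted]; rfl
    rw [h1, ← mul_assoc, h2, h3, conv_apply, insertOp_graftL]
    -- In a tree the leg acting on the branch comes first, whereas in the ordered monomial the
    -- factor of the branch comes last.
    have hcomm : TensorProduct.comm ℝ (U d) (U d) (U.comul A) = U.comul A :=
      Coalgebra.comm_comul ℝ A
    nth_rw 2 [← hcomm]
    induction U.comul A using TensorProduct.induction_on with
    | zero => simp
    | add z w hz hw => simp only [map_add, hz, hw]
    | tmul B C =>
      rw [TensorProduct.map_tmul, TensorProduct.lift.tmul, pbw_graftL, TensorProduct.comm_tmul,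
        TensorProduct.map_tmul, LinearMap.mul'_apply]
      rfl

/-! ## Trees as root decorations with a multiset of branches -/

/-- The decoration of the root. -/
def ETree.rootDeco : ETree d E → Idx d :=
  recOn (fun n _ => n) (fun _ _ _ _ z => z) (fun _ _ _ _ _ _ _ _ => rfl)

@[simp] theorem ETree.rootDeco_root (n : Idx d) (m : ℕ) : (root n m : ETree d E).rootDeco = n := rfl

@[simp] theorem ETree.rootDeco_graft (e : E) (σ τ : ETree d E) :
    (graft e σ τ).rootDeco = τ.rootDeco := by simp [rootDeco]

@[simp] theorem ETree.rootNoise_root (n : Idx d) (m : ℕ) :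
    (root n m : ETree d E).rootNoise = m := rfl

@[simp] theorem ETree.rootNoise_graft (e : E) (σ τ : ETree d E) :
    (graft e σ τ).rootNoise = τ.rootNoise := by simp [rootNoise]

@[simp] theorem ETree.branches_root (n : Idx d) (m : ℕ) :
    (root n m : ETree d E).branches = 0 := rfl

@[simp] theorem ETree.branches_graft (e : E) (σ τ : ETree d E) :
    (graft e σ τ).branches = (e, σ) ::ₘ τ.branches := by simp [branches]

instance : LeftCommutative fun (p : E × ETree d E) τ => graft p.1 p.2 τ :=
  ⟨fun _ _ _ => graft_comm _ _ _ _ _⟩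

/-- The tree with the given root decoration, noises at the root and branches. -/
def ETree.ofBranches (n : Idx d) (m : ℕ) (B : Multiset (E × ETree d E)) : ETree d E :=
  B.foldr (fun p τ => graft p.1 p.2 τ) (root n m)

@[simp] theorem ETree.ofBranches_zero (n : Idx d) (m : ℕ) :
    (ofBranches n m 0 : ETree d E) = root n m := rfl

@[simp] theorem ETree.ofBranches_cons (n : Idx d) (m : ℕ) (p : E × ETree d E)
    (B : Multiset (E × ETree d E)) : ofBranches n m (p ::ₘ B) = graft p.1 p.2 (ofBranches n m B) :=
  Multiset.foldr_cons _ _ _ _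

theorem ETree.ofBranches_branches (τ : ETree d E) :
    ofBranches τ.rootDeco τ.rootNoise τ.branches = τ := by
  induction τ using ETree.induct with
  | hr n m => rfl
  | hg e σ τ _ ih => simp [ih]

theorem ETree.branches_ofBranches (n : Idx d) (m : ℕ) (B : Multiset (E × ETree d E)) :
    (ofBranches n m B).branches = B := by
  induction B using Multiset.induction_on with
  | empty => rfl
  | cons p B ih => simp [ih]

theorem ETree.rootDeco_ofBranches (n : Idx d) (m : ℕ) (B : Multiset (E × ETree d E)) :
    (ofBranches n m B).rootDeco = n := by
  induction B using Multiset.induction_on with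
  | empty => rfl
  | cons p B ih => simp [ih]

theorem ETree.rootNoise_ofBranches (n : Idx d) (m : ℕ) (B : Multiset (E × ETree d E)) :
    (ofBranches n m B).rootNoise = m := by
  induction B using Multiset.induction_on with
  | empty => rfl
  | cons p B ih => simp [ih]

theorem ETree.ext_iff' {σ τ : ETree d E} : σ = τ ↔
    σ.rootDeco = τ.rootDeco ∧ σ.rootNoise = τ.rootNoise ∧ σ.branches = τ.branches := by
  refine ⟨fun h => h ▸ ⟨rfl, rfl, rfl⟩, fun ⟨h1, h2, h3⟩ => ?_⟩
  rw [← ofBranches_branches σ, h1, h2, h3, ofBranches_branches]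

theorem ETree.graft_ne_root (e : E) (σ τ : ETree d E) (n : Idx d) (m : ℕ) :
    graft e σ τ ≠ root n m := fun h => by
  have := congrArg branches h
  simp at this

theorem ETree.root_inj (n n' : Idx d) (m m' : ℕ) :
    (root n m : ETree d E) = root n' m' ↔ n = n' ∧ m = m' := by
  rw [ext_iff']; simp

theorem ETree.graft_eq_plant (b a : E) (s t τ : ETree d E) :
    graft b s t = plant a τ ↔ b = a ∧ s = τ ∧ t = root 0 0 := by
  rw [ext_iff', ext_iff' (σ := t), plant]
  simp only [rootDeco_graft, rootNoise_graft, branches_graft, rootDeco_root, rootNoise_root,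
    branches_root]
  constructor
  · rintro ⟨h1, h2, h3⟩
    have hc := congrArg Multiset.card h3
    simp only [Multiset.card_cons, Multiset.card_zero, Nat.add_right_cancel_iff,
      Multiset.card_eq_zero] at hc
    rw [hc, Multiset.cons_inj_left, Prod.mk.injEq] at h3
    exact ⟨h3.1, h3.2, h1, h2, hc⟩
  · rintro ⟨rfl, rfl, h1, h2, h3⟩
    exact ⟨h1, h2, by rw [h3]⟩

/-! ## The pairing -/

/-- The pairing `⟨ρ, ·⟩`. -/
noncomputable def pairing (ρ : ETree d E) : TreeSpan d E →ₗ[ℝ] ℝ :=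
  (symFactor ρ : ℝ) • Finsupp.lapply ρ

theorem pairing_apply (ρ : ETree d E) (x : TreeSpan d E) : pairing ρ x = symFactor ρ * x ρ := rfl

open Classical in
/-- The derivative with respect to the branch `p`. -/
noncomputable def deriv (p : E × ETree d E) : Module.End ℝ (TreeSpan d E) :=
  Finsupp.linearCombination ℝ fun τ => (τ.branches.count p : ℝ) •
    Finsupp.single (ofBranches τ.rootDeco τ.rootNoise (τ.branches.erase p)) 1

theorem deriv_root (p : E × ETree d E) (n : Idx d) (m : ℕ) :
    deriv p (Finsupp.single (root n m) 1) = 0 := by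
  simp [deriv]

open Classical in
theorem deriv_graft (p : E × ETree d E) (e : E) (σ τ : ETree d E) :
    deriv p (Finsupp.single (graft e σ τ) 1)
      = (if (e, σ) = p then Finsupp.single τ 1 else 0)
        + graftL e (Finsupp.single σ 1) (deriv p (Finsupp.single τ 1)) := by
  simp only [deriv, Finsupp.linearCombination_single, one_smul, branches_graft, rootDeco_graft,
    rootNoise_graft, map_smul, graftL_single, mul_one]
  split_ifs with h
  · subst h
    rw [Multiset.count_cons_self, Multiset.erase_cons_head, ofBranches_branches]
    by_cases hm : (e, σ) ∈ τ.branches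
    · rw [← ofBranches_cons τ.rootDeco τ.rootNoise (e, σ), Multiset.cons_erase hm,
        ofBranches_branches]
      push_cast
      rw [add_smul, one_smul, add_comm]
    · simp [Multiset.count_eq_zero_of_notMem hm]
  · rw [Multiset.count_cons_of_ne (Ne.symm h), Multiset.erase_cons_tail _ h, ofBranches_cons,
      zero_add]

/-- Attaching the branch `p` multiplies the symmetry factor by `S(p.2)` and by the new multiplicity
of `p`, which is the coefficient produced by `deriv p`. So attaching a branch is adjoint to `deriv`,
up to `S(p.2)`. -/
theorem deriv_apply (p : E × ETree d E) (x : TreeSpan d E) (ρ : ETree d E) :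
    (symFactor (graft p.1 p.2 ρ) : ℝ) * x (graft p.1 p.2 ρ)
      = symFactor p.2 * (symFactor ρ * deriv p x ρ) := by
  classical
  induction x using Finsupp.induction_linear with
  | zero => simp
  | add x y hx hy => rw [map_add, Finsupp.add_apply, Finsupp.add_apply, mul_add, hx, hy]; ring
  | single τ c =>
    have hs : symFactor (graft p.1 p.2 ρ)
        = (1 + ρ.branches.count p) * symFactor p.2 * symFactor ρ := by
      simp only [symFactor, recOn_graft]
    have hd : deriv p (Finsupp.single τ c) = (c * (τ.branches.count p : ℝ)) •
        Finsupp.single (ofBranches τ.rootDeco τ.rootNoise (τ.branches.erase p)) 1 := by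
      rw [deriv, Finsupp.linearCombination_single, mul_smul]
    rw [hs, hd, Finsupp.smul_apply, Finsupp.single_apply, Finsupp.single_apply, smul_eq_mul]
    by_cases hm : p ∈ τ.branches
    · have hiff : τ = graft p.1 p.2 ρ
          ↔ ofBranches τ.rootDeco τ.rootNoise (τ.branches.erase p) = ρ := by
        rw [ext_iff', ext_iff' (τ := ρ), rootDeco_ofBranches, rootNoise_ofBranches,
          branches_ofBranches, rootDeco_graft, rootNoise_graft, branches_graft]
        constructor
        · rintro ⟨h1, h2, h3⟩
          exact ⟨h1, h2, by rw [h3]; exact Multiset.erase_cons_head _ _⟩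
        · rintro ⟨h1, h2, h3⟩
          exact ⟨h1, h2, by rw [← h3]; exact (Multiset.cons_erase hm).symm⟩
      by_cases h : τ = graft p.1 p.2 ρ
      · rw [if_pos h, if_pos (hiff.mp h)]
        have hc : τ.branches.count p = 1 + ρ.branches.count p := by
          rw [h, branches_graft]
          exact (Multiset.count_cons_self p _).trans (add_comm _ _)
        rw [hc]
        push_cast
        ring
      · rw [if_neg h, if_neg (fun h' => h (hiff.mpr h'))]
        simp
    · have h : τ ≠ graft p.1 p.2 ρ := fun h => hm (by rw [h, branches_graft]; simp)
      rw [if_neg h, Multiset.count_eq_zero_of_notMem hm]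
      simp

theorem pairing_graft (e : E) (σ ρ : ETree d E) (x : TreeSpan d E) :
    pairing (graft e σ ρ) x = symFactor σ * pairing ρ (deriv (e, σ) x) :=
  deriv_apply (e, σ) x ρ

theorem pairing_root_graftL (n : Idx d) (m : ℕ) (e : E) (x y : TreeSpan d E) :
    pairing (root n m) (graftL e x y) = 0 :=
  graftL_hom_ext (f := (graftL e).compr₂ (pairing (root n m))) (g := 0)
    (fun σ τ => by
      simp [graftL_single, pairing_apply, graft_ne_root]) x y

/-! ## Operators at the root -/

/-- Multiplication by `X_i`. -/
noncomputable def mulX (i : Fin (d + 1)) : Module.End ℝ (TreeSpan d E) :=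
  nodeOp (fun _ => false) (raiseAt i)

/-- Multiplication by `Ξ`. -/
noncomputable def mulXi : Module.End ℝ (TreeSpan d E) :=
  nodeOp (fun _ => false) fun n m => Finsupp.single (root n (m + 1)) 1

theorem mulX_root (i : Fin (d + 1)) (n : Idx d) (m : ℕ) :
    mulX i (Finsupp.single (root n m : ETree d E) 1)
      = Finsupp.single (root (n + unitIdx i) m) 1 := nodeOp_root _ _ _ _

theorem mulXi_root (n : Idx d) (m : ℕ) :
    mulXi (Finsupp.single (root n m : ETree d E) 1) = Finsupp.single (root n (m + 1)) 1 :=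
  nodeOp_root _ _ _ _

theorem mulX_graftL (i : Fin (d + 1)) (e : E) (x y : TreeSpan d E) :
    mulX i (graftL e x y) = graftL e x (mulX i y) := nodeOp_graftL_of_false _ rfl _ _

theorem mulXi_graftL (e : E) (x y : TreeSpan d E) :
    mulXi (graftL e x y) = graftL e x (mulXi y) := nodeOp_graftL_of_false _ rfl _ _

/-- The trees are generated from `1` by the multiplications by `X_i` and `Ξ`, and by grafting. -/
theorem TreeSpan.hom_induct' {W : Type*} [AddCommMonoid W] [Module ℝ W]
    {f g : TreeSpan d E →ₗ[ℝ] W}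
    (h1 : f (Finsupp.single (root 0 0) 1) = g (Finsupp.single (root 0 0) 1))
    (hΞ : ∀ m, f (Finsupp.single (root 0 m) 1) = g (Finsupp.single (root 0 m) 1) →
      f (mulXi (Finsupp.single (root 0 m) 1)) = g (mulXi (Finsupp.single (root 0 m) 1)))
    (hX : ∀ i n m, f (Finsupp.single (root n m) 1) = g (Finsupp.single (root n m) 1) →
      f (mulX i (Finsupp.single (root n m) 1)) = g (mulX i (Finsupp.single (root n m) 1)))
    (hg : ∀ e σ τ, f (Finsupp.single σ 1) = g (Finsupp.single σ 1) →
      f (Finsupp.single τ 1) = g (Finsupp.single τ 1) →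
      f (graftL e (Finsupp.single σ 1) (Finsupp.single τ 1))
        = g (graftL e (Finsupp.single σ 1) (Finsupp.single τ 1))) : f = g := by
  refine TreeSpan.hom_induct (fun n m => ?_) hg
  induction n using Idx.induction with
  | zero =>
    induction m with
    | zero => exact h1
    | succ m ih => rw [← mulXi_root]; exact hΞ m ih
  | succ n i ih => rw [← mulX_root]; exact hX i n m ih

theorem idxFactorial_add_unitIdx (n : Idx d) (i : Fin (d + 1)) :
    idxFactorial (n + unitIdx i) = (n i + 1) * idxFactorial n := by
  rw [idxFactorial, idxFactorial, ← Finset.mul_prod_erase _ _ (Finset.mem_univ i),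
    ← Finset.mul_prod_erase _ (fun j => (n j).factorial) (Finset.mem_univ i), ← mul_assoc]
  congr 1
  · simp [unitIdx, Nat.factorial_succ]
  · exact Finset.prod_congr rfl fun j hj => by simp [unitIdx, Finset.ne_of_mem_erase hj]

theorem symFactor_root (n : Idx d) (m : ℕ) :
    symFactor (root n m : ETree d E) = idxFactorial n * m.factorial := rfl

theorem add_unitIdx_eq_iff (k n : Idx d) (i : Fin (d + 1)) :
    k + unitIdx i = n ↔ n i ≠ 0 ∧ k = n - unitIdx i := by
  constructor
  · rintro rfl
    exact ⟨by simp [unitIdx], (add_tsub_cancel_right _ _).symm⟩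
  · rintro ⟨h, rfl⟩
    exact tsub_add_cancel_of_le (unitIdx_le.mpr h)

/-- Multiplication by `X_i` is adjoint to the partial derivative, since `n! = n_i (n - e_i)!`. If
`n_i = 0`, the factor `n_i` kills the truncated term. -/
theorem pairing_root_mulX (n : Idx d) (m : ℕ) (i : Fin (d + 1)) (x : TreeSpan d E) :
    pairing (root n m) (mulX i x) = (n i : ℝ) * pairing (root (n - unitIdx i) m) x := by
  refine LinearMap.congr_fun (f := (pairing (root n m)).comp (mulX i))
    (g := (n i : ℝ) • pairing (root (n - unitIdx i) m))
    (TreeSpan.hom_induct (fun k p => ?_) fun e σ τ _ _ => ?_) x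
  · classical
    simp only [LinearMap.comp_apply, mulX_root, LinearMap.smul_apply, pairing_apply,
      symFactor_root, Finsupp.single_apply, root_inj, add_unitIdx_eq_iff]
    by_cases hn : n i = 0
    · simp [hn]
    · obtain ⟨k', rfl⟩ : ∃ k', n = k' + unitIdx i :=
        ⟨_, (tsub_add_cancel_of_le (unitIdx_le.mpr hn)).symm⟩
      rw [add_tsub_cancel_right, idxFactorial_add_unitIdx]
      by_cases h : k = k' ∧ p = m
      · rw [if_pos ⟨⟨hn, h.1⟩, h.2⟩, if_pos h]
        simp [unitIdx]
        ring
      · rw [if_neg (fun h' => h ⟨h'.1.2, h'.2⟩), if_neg h]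
        simp
  · rw [LinearMap.comp_apply, mulX_graftL, LinearMap.smul_apply, pairing_root_graftL,
      pairing_root_graftL, smul_zero]

theorem pairing_root_mulXi (n : Idx d) (m : ℕ) (x : TreeSpan d E) :
    pairing (root n m) (mulXi x) = (m : ℝ) * pairing (root n (m - 1)) x := by
  refine LinearMap.congr_fun (f := (pairing (root n m)).comp mulXi)
    (g := (m : ℝ) • pairing (root n (m - 1)))
    (TreeSpan.hom_induct (fun k p => ?_) fun e σ τ _ _ => ?_) x
  · classical
    simp only [LinearMap.comp_apply, mulXi_root, LinearMap.smul_apply, pairing_apply,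
      symFactor_root, Finsupp.single_apply, root_inj]
    cases m with
    | zero => simp
    | succ m =>
      simp only [Nat.add_sub_cancel, Nat.add_right_cancel_iff, Nat.factorial_succ]
      by_cases h : k = n ∧ p = m
      · simp only [if_pos h]
        push_cast
        rw [smul_eq_mul]
        ring
      · simp [if_neg h]
  · rw [LinearMap.comp_apply, mulXi_graftL, LinearMap.smul_apply, pairing_root_graftL,
      pairing_root_graftL, smul_zero]

/-! ## The coproduct for which the `X_i`, `Ξ` and the planted trees are primitive -/

/-- The operator `A ⊗ 1 + 1 ⊗ A`. -/
noncomputable def leibniz {W : Type*} [AddCommGroup W] [Module ℝ W] (A : Module.End ℝ W) :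
    Module.End ℝ (W ⊗[ℝ] W) :=
  TensorProduct.map A LinearMap.id + TensorProduct.map LinearMap.id A

section Leibniz

variable {W W' : Type*} [AddCommGroup W] [Module ℝ W] [AddCommGroup W'] [Module ℝ W']

theorem leibniz_tmul (A : Module.End ℝ W) (x y : W) :
    leibniz A (x ⊗ₜ y) = A x ⊗ₜ y + x ⊗ₜ A y := rfl

theorem leibniz_add (A B : Module.End ℝ W) : leibniz (A + B) = leibniz A + leibniz B := by
  refine TensorProduct.ext' fun x y => ?_
  simp only [leibniz_tmul, LinearMap.add_apply, TensorProduct.add_tmul, TensorProduct.tmul_add]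
  abel

theorem leibniz_smul (c : ℝ) (A : Module.End ℝ W) : leibniz (c • A) = c • leibniz A := by
  refine TensorProduct.ext' fun x y => ?_
  simp only [leibniz_tmul, LinearMap.smul_apply, smul_add, TensorProduct.smul_tmul',
    TensorProduct.tmul_smul]

/-- The actions of `A` and `B` on different legs commute, so only the commutators within one leg
survive. -/
theorem leibniz_lie {A B C : Module.End ℝ W} (h : ∀ x, A (B x) = B (A x) + C x) (z : W ⊗[ℝ] W) :
    leibniz A (leibniz B z) = leibniz B (leibniz A z) + leibniz C z := by
  induction z using TensorProduct.induction_on with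
  | zero => simp
  | add z w hz hw => simp only [map_add, hz, hw]; abel
  | tmul x y =>
    simp only [leibniz_tmul, map_add, h, TensorProduct.add_tmul, TensorProduct.tmul_add]
    abel

theorem leibniz_comm {A B : Module.End ℝ W} (h : ∀ x, A (B x) = B (A x)) (z : W ⊗[ℝ] W) :
    leibniz A (leibniz B z) = leibniz B (leibniz A z) := by
  rw [leibniz_lie (C := 0) (fun x => by rw [h]; simp)]
  simp [leibniz]

theorem leibniz_intertwine {A : Module.End ℝ W} {B : Module.End ℝ W'} {f : W →ₗ[ℝ] W'}
    (h : ∀ x, f (A x) = B (f x)) (z : W ⊗[ℝ] W) :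
    TensorProduct.map f f (leibniz A z) = leibniz B (TensorProduct.map f f z) := by
  induction z using TensorProduct.induction_on with
  | zero => simp
  | add z w hz hw => simp only [map_add, hz, hw]
  | tmul x y => simp only [leibniz_tmul, map_add, TensorProduct.map_tmul, h]

theorem comm_leibniz (A : Module.End ℝ W) (z : W ⊗[ℝ] W) :
    TensorProduct.comm ℝ W W (leibniz A z) = leibniz A (TensorProduct.comm ℝ W W z) := by
  induction z using TensorProduct.induction_on with
  | zero => simp
  | add z w hz hw => simp only [map_add, hz, hw]
  | tmul x y => simp only [leibniz_tmul, map_add, TensorProduct.comm_tmul]; abel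

end Leibniz

theorem mulX_mulX (i j : Fin (d + 1)) (x : TreeSpan d E) :
    mulX i (mulX j x) = mulX j (mulX i x) :=
  LinearMap.congr_fun (f := (mulX i).comp (mulX j)) (g := (mulX j).comp (mulX i))
    (TreeSpan.hom_induct (fun n m => by
      simp only [LinearMap.comp_apply, mulX_root, add_right_comm])
      fun e σ τ _ hτ => by
        simp only [LinearMap.comp_apply, mulX_graftL] at hτ ⊢
        rw [hτ]) x

theorem mulX_mulXi (i : Fin (d + 1)) (x : TreeSpan d E) :
    mulX i (mulXi x) = mulXi (mulX i x) :=
  LinearMap.congr_fun (f := (mulX i).comp mulXi) (g := mulXi.comp (mulX i))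
    (TreeSpan.hom_induct (fun n m => by
      simp only [LinearMap.comp_apply, mulX_root, mulXi_root])
      fun e σ τ _ hτ => by
        simp only [LinearMap.comp_apply, mulX_graftL, mulXi_graftL] at hτ ⊢
        rw [hτ]) x

/-- The coproduct for which the `X_i`, `Ξ` and the planted trees are primitive, and which is
multiplicative for the tree product. -/
noncomputable def split : TreeSpan d E →ₗ[ℝ] TreeSpan d E ⊗[ℝ] TreeSpan d E :=
  Finsupp.linearCombination ℝ <| recOn
    (fun n m => (List.ofFn fun i => leibniz (mulX i) ^ n i).prod
      ((leibniz mulXi ^ m) (Finsupp.single (root 0 0) 1 ⊗ₜ Finsupp.single (root 0 0) 1)))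
    (fun e σ _ _ z => leibniz (graftL e (Finsupp.single σ 1)) z)
    (fun e _ _ e' _ _ _ z => leibniz_comm (graftL_comm e e' _ _) z)

theorem split_one : split (Finsupp.single (root 0 0) 1 : TreeSpan d E)
    = Finsupp.single (root 0 0) 1 ⊗ₜ Finsupp.single (root 0 0) 1 := by
  simp [split]

theorem split_graftL (e : E) (x y : TreeSpan d E) :
    split (graftL e x y) = leibniz (graftL e x) (split y) := by
  let L : TreeSpan d E →ₗ[ℝ] Module.End ℝ (TreeSpan d E ⊗[ℝ] TreeSpan d E) :=
    { toFun := fun x => leibniz (graftL e x)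
      map_add' := fun x x' => by rw [map_add, leibniz_add]
      map_smul' := fun c x => by rw [map_smul, leibniz_smul]; rfl }
  refine graftL_hom_ext (f := (graftL e).compr₂ split) (g := L.compl₂ split) (fun σ τ => ?_) x y
  simp [L, split, graftL_single]

theorem split_mulX (i : Fin (d + 1)) (x : TreeSpan d E) :
    split (mulX i x) = leibniz (mulX i) (split x) := by
  refine LinearMap.congr_fun (f := split.comp (mulX i)) (g := (leibniz (mulX i)).comp split)
    (TreeSpan.hom_induct (fun n m => ?_) fun e σ τ _ hτ => ?_) x
  · have hc (i j : Fin (d + 1)) :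
        Commute (leibniz (mulX (E := E) i)) (leibniz (mulX (d := d) j)) :=
      LinearMap.ext fun z => leibniz_comm (mulX_mulX i j) z
    have hp : leibniz (mulX (E := E) i) * (List.ofFn fun j => leibniz (mulX j) ^ n j).prod
        = (List.ofFn fun j => leibniz (mulX j) ^ n j).prod * leibniz (mulX i) := by
      refine Commute.list_prod_right _ _ fun y hy => ?_
      obtain ⟨j, rfl⟩ := (List.mem_ofFn' _ _).mp hy
      exact (hc i j).pow_right _
    have hs := (prod_ofFn_pow_succ (fun j => leibniz (mulX (E := E) j)) hc n i).trans hp.symm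
    simp only [LinearMap.comp_apply, mulX_root, split, Finsupp.linearCombination_single, one_smul,
      recOn_root]
    exact LinearMap.congr_fun hs _
  · simp only [LinearMap.comp_apply] at hτ ⊢
    rw [mulX_graftL, split_graftL, hτ, split_graftL,
      leibniz_comm (fun x => mulX_graftL i e _ x)]

theorem split_mulXi (x : TreeSpan d E) : split (mulXi x) = leibniz mulXi (split x) := by
  refine LinearMap.congr_fun (f := split.comp mulXi) (g := (leibniz mulXi).comp split)
    (TreeSpan.hom_induct' ?_ ?_ ?_ ?_) x
  · simp [mulXi_root, split]
  · intro m _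
    simp only [LinearMap.comp_apply, mulXi_root, split, Finsupp.linearCombination_single,
      one_smul, recOn_root]
    simp [pow_succ']
  · intro i n m h
    simp only [LinearMap.comp_apply] at h ⊢
    rw [← mulX_mulXi, split_mulX, h, split_mulX, leibniz_comm (fun x => mulX_mulXi i x)]
  · intro e σ τ _ hτ
    simp only [LinearMap.comp_apply] at hτ ⊢
    rw [mulXi_graftL, split_graftL, hτ, split_graftL, leibniz_comm (fun x => mulXi_graftL e _ x)]

theorem comm_split (x : TreeSpan d E) : TensorProduct.comm ℝ _ _ (split x) = split x := by
  refine LinearMap.congr_fun (f := (TensorProduct.comm ℝ _ _).toLinearMap.comp split) (g := split)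
    (TreeSpan.hom_induct' ?_ ?_ ?_ ?_) x
  · simp [split_one]
  · intro m h
    simp only [LinearMap.comp_apply, LinearEquiv.coe_coe] at h ⊢
    rw [split_mulXi, comm_leibniz, h]
  · intro i n m h
    simp only [LinearMap.comp_apply, LinearEquiv.coe_coe] at h ⊢
    rw [split_mulX, comm_leibniz, h]
  · intro e σ τ _ h
    simp only [LinearMap.comp_apply, LinearEquiv.coe_coe] at h ⊢
    rw [split_graftL, comm_leibniz, h]

theorem split_mapEdgesL (f : E → E') (x : TreeSpan d E) :
    split (mapEdgesL f x) = TensorProduct.map (mapEdgesL f) (mapEdgesL f) (split x) := by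
  have hX (i : Fin (d + 1)) (x : TreeSpan d E) :
      mapEdgesL f (mulX i x) = mulX i (mapEdgesL f x) :=
    mapEdgesL_nodeOp f (fun _ => false) _ _ (fun n m => by simp [raiseAt]) x
  have hΞ (x : TreeSpan d E) : mapEdgesL f (mulXi x) = mulXi (mapEdgesL f x) :=
    mapEdgesL_nodeOp f (fun _ => false) _ _ (fun n m => by simp) x
  refine LinearMap.congr_fun (f := split.comp (mapEdgesL f))
    (g := (TensorProduct.map (mapEdgesL f) (mapEdgesL f)).comp split)
    (TreeSpan.hom_induct' ?_ ?_ ?_ ?_) x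
  · simp [split_one]
  · intro m h
    simp only [LinearMap.comp_apply] at h ⊢
    rw [hΞ, split_mulXi, split_mulXi, h, leibniz_intertwine hΞ]
  · intro i n m h
    simp only [LinearMap.comp_apply] at h ⊢
    rw [hX, split_mulX, split_mulX, h, leibniz_intertwine (hX i)]
  · intro e σ τ _ h
    simp only [LinearMap.comp_apply] at h ⊢
    rw [mapEdgesL_graftL, split_graftL, split_graftL, h,
      leibniz_intertwine (fun x => mapEdgesL_graftL f e _ x)]

/-- The projection to the one-node trees. -/
noncomputable def rootProj : Module.End ℝ (TreeSpan d E) :=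
  Finsupp.linearCombination ℝ (recOn (fun n m => Finsupp.single (root n m) 1)
    (fun _ _ _ _ _ => 0) (fun _ _ _ _ _ _ _ _ => rfl))

theorem rootProj_root (n : Idx d) (m : ℕ) :
    rootProj (Finsupp.single (root n m : ETree d E) 1) = Finsupp.single (root n m) 1 := by
  simp [rootProj]

theorem rootProj_graftL (e : E) (x y : TreeSpan d E) : rootProj (graftL e x y) = 0 :=
  graftL_hom_ext (f := (graftL e).compr₂ rootProj) (g := 0)
    (fun σ τ => by simp [graftL_single, rootProj]) x y

/-- Splitting a one-node tree yields only pairs of one-node trees. Hence identities known on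
one-node trees can be applied to the legs. -/
theorem map_rootProj_split_root (n : Idx d) (m : ℕ) :
    TensorProduct.map rootProj rootProj (split (Finsupp.single (root n m : ETree d E) 1))
      = split (Finsupp.single (root n m) 1) := by
  have hX (i : Fin (d + 1)) (x : TreeSpan d E) : rootProj (mulX i x) = mulX i (rootProj x) :=
    LinearMap.congr_fun (f := rootProj.comp (mulX i)) (g := (mulX i).comp rootProj)
      (TreeSpan.hom_induct (fun n m => by
        simp only [LinearMap.comp_apply, mulX_root, rootProj_root]) fun e σ τ _ _ => by
        simp only [LinearMap.comp_apply, mulX_graftL, rootProj_graftL, map_zero]) x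
  have hΞ (x : TreeSpan d E) : rootProj (mulXi x) = mulXi (rootProj x) :=
    LinearMap.congr_fun (f := rootProj.comp mulXi) (g := mulXi.comp rootProj)
      (TreeSpan.hom_induct (fun n m => by
        simp only [LinearMap.comp_apply, mulXi_root, rootProj_root]) fun e σ τ _ _ => by
        simp only [LinearMap.comp_apply, mulXi_graftL, rootProj_graftL, map_zero]) x
  induction n using Idx.induction with
  | zero =>
    induction m with
    | zero => rw [split_one, TensorProduct.map_tmul, rootProj_root]
    | succ m ih => rw [← mulXi_root, split_mulXi, leibniz_intertwine hΞ, ih]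
  | succ n i ih => rw [← mulX_root, split_mulX, leibniz_intertwine (hX i), ih]

theorem map_split_root_eq_zero {W : Type*} [AddCommGroup W] [Module ℝ W]
    {f : TreeSpan d E →ₗ[ℝ] W} (hf : ∀ n m, f (Finsupp.single (root n m) 1) = 0) (n : Idx d)
    (m : ℕ) :
    TensorProduct.map f LinearMap.id (split (Finsupp.single (root n m : ETree d E) 1)) = 0 := by
  have h0 (x : TreeSpan d E) : f (rootProj x) = 0 :=
    LinearMap.congr_fun (f := f.comp rootProj) (g := 0)
      (TreeSpan.hom_induct (fun n m => by simp [rootProj_root, hf]) fun e σ τ _ _ => by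
        simp [rootProj_graftL]) x
  rw [← map_rootProj_split_root]
  induction split (Finsupp.single (root n m : ETree d E) 1) using TensorProduct.induction_on with
  | zero => simp
  | add z w hz hw => simp only [map_add, hz, hw, add_zero]
  | tmul x y => rw [TensorProduct.map_tmul, TensorProduct.map_tmul, h0, TensorProduct.zero_tmul]

theorem leibniz_nodeOp_split_root (op op' : E → Bool) (φ : Idx d → ℕ → TreeSpan d E) (n : Idx d)
    (m : ℕ) :
    leibniz (nodeOp op φ) (split (Finsupp.single (root n m) 1))
      = leibniz (nodeOp op' φ) (split (Finsupp.single (root n m) 1)) := by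
  have h0 (x : TreeSpan d E) : nodeOp op φ (rootProj x) = nodeOp op' φ (rootProj x) :=
    LinearMap.congr_fun (f := (nodeOp op φ).comp rootProj) (g := (nodeOp op' φ).comp rootProj)
      (TreeSpan.hom_induct (fun n m => by
        simp only [LinearMap.comp_apply, rootProj_root, nodeOp_root]) fun e σ τ _ _ => by
        simp only [LinearMap.comp_apply, rootProj_graftL, map_zero]) x
  rw [← map_rootProj_split_root]
  induction split (Finsupp.single (root n m : ETree d E) 1) using TensorProduct.induction_on with
  | zero => simp
  | add z w hz hw => simp only [map_add, hz, hw]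
  | tmul x y => rw [TensorProduct.map_tmul, leibniz_tmul, leibniz_tmul, h0, h0]

/-! ## The action of `U(𝒱_0)` and the coproduct -/

theorem mulXi_graftAtL (mk : Idx d → E) (a : Idx d) (s : TreeSpan d E) (n : Idx d) (m : ℕ) :
    mulXi (graftAtL mk a s n m) = graftAtL mk a s n (m + 1) := by
  rw [graftAtL_apply, graftAtL_apply, map_sum]
  exact Finset.sum_congr rfl fun l _ => by rw [map_smul, mulXi_graftL, mulXi_root]

theorem nodeOp_graftAtL_mulXi (mk : Idx d → E) (a : Idx d) (s x : TreeSpan d E) :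
    nodeOp (fun _ => false) (graftAtL mk a s) (mulXi x)
      = mulXi (nodeOp (fun _ => false) (graftAtL mk a s) x) := by
  have h := LinearMap.congr_fun (nodeOp_lie (fun _ => false) (fun _ => false) (graftAtL mk a s)
    (fun n m => Finsupp.single (root n (m + 1)) 1) 0 (fun n m => by
      rw [nodeOp_root, ← mulXi_graftAtL]; exact sub_self _)) x
  rw [map_zero] at h
  exact sub_eq_zero.mp h

theorem nodeOp_graftAtL_mulX (mk : Idx d → E) (a : Idx d) (s : TreeSpan d E) (i : Fin (d + 1))
    (x : TreeSpan d E) :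
    nodeOp (fun _ => false) (graftAtL mk a s) (mulX i x)
      = mulX i (nodeOp (fun _ => false) (graftAtL mk a s) x)
        + nodeOp (fun _ => false) (if a i = 0 then 0 else graftAtL mk (a - unitIdx i) s) x := by
  have h := LinearMap.congr_fun (nodeOp_lie (fun _ => false) (fun _ => false) (graftAtL mk a s)
    (raiseAt i) _ (nodeOp_graftAtL_raiseAt _ _ mk (fun _ => rfl) a s i)) x
  rw [add_comm]
  exact sub_eq_iff_eq_add.mp h

/-- The root is built from `1` by multiplications by `Ξ` and `X_i`. Commuting the grafting past
`X_i` produces the grafting with `a - e_i`, so the induction must range over all `a`. -/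
theorem split_graftAtL (mk : Idx d → E) (a : Idx d) (s : TreeSpan d E) (n : Idx d) (m : ℕ) :
    split (graftAtL mk a s n m)
      = leibniz (nodeOp (fun _ => false) (graftAtL mk a s)) (split (Finsupp.single (root n m) 1)) := by
  induction n using Idx.induction generalizing a with
  | zero =>
    induction m with
    | zero => rw [split_one, leibniz_tmul, nodeOp_root, graftAtL_zero, split_graftL, split_one,
        leibniz_tmul]
    | succ m ih => rw [← mulXi_graftAtL, split_mulXi, ih, ← mulXi_root, split_mulXi,
        leibniz_comm (nodeOp_graftAtL_mulXi mk a s)]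
  | succ n i ih =>
    rw [← nodeOp_root (fun _ => false) (graftAtL mk a s), ← mulX_root, nodeOp_graftAtL_mulX,
      map_add, split_mulX, nodeOp_root, nodeOp_root, ih, split_mulX,
      leibniz_lie (nodeOp_graftAtL_mulX mk a s i)]
    congr 1
    split_ifs with h
    · simp [leibniz]
    · exact ih _

theorem split_localOp (mk : Idx d → E) (inc : TreeSpan d (Idx d) →ₗ[ℝ] TreeSpan d E) (u : V d)
    (n : Idx d) (m : ℕ) :
    split (localOp mk inc u n m) = leibniz (nodeOp (fun _ => false) (localOp mk inc u))
      (split (Finsupp.single (root n m) 1)) := by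
  induction u using V.induction with
  | add u v hu hv =>
    simp only [map_add, Pi.add_apply, hu, hv, leibniz_add, LinearMap.add_apply]
  | smul c u hu => simp only [map_smul, Pi.smul_apply, hu, leibniz_smul, LinearMap.smul_apply]
  | X i =>
    rw [localOp_X, raiseAt, ← mulX_root, split_mulX]; rfl
  | planted a σ => rw [localOp_planted, split_graftAtL]

/-- A coderivation at one-node trees is one everywhere: attaching a branch also acts on the legs by
the Leibniz rule, and so does its commutator with the node sum. -/
theorem split_nodeOp (op : E → Bool) (φ : Idx d → ℕ → TreeSpan d E)
    (h : ∀ n m, split (φ n m)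
      = leibniz (nodeOp (fun _ => false) φ) (split (Finsupp.single (root n m) 1)))
    (x : TreeSpan d E) : split (nodeOp op φ x) = leibniz (nodeOp op φ) (split x) := by
  refine LinearMap.congr_fun (f := split.comp (nodeOp op φ)) (g := (leibniz (nodeOp op φ)).comp split)
    (TreeSpan.hom_induct (fun n m => ?_) fun e σ τ _ hτ => ?_) x
  · rw [LinearMap.comp_apply, LinearMap.comp_apply, nodeOp_root, h]
    exact leibniz_nodeOp_split_root _ _ _ _ _
  · simp only [LinearMap.comp_apply] at hτ ⊢
    rw [nodeOp_graftL, map_add, split_graftL, split_graftL, split_graftL, hτ,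
      leibniz_lie (A := nodeOp op φ) (B := graftL e (Finsupp.single σ 1))
        (C := graftL e (if op e = true then nodeOp op φ (Finsupp.single σ 1) else 0))
        (fun y => by rw [nodeOp_graftL, add_comm]), add_comm]

/-- Elements of `𝒱` act by coderivations, so a general `A` acts on the two legs through its
coproduct. -/
theorem split_oldRep (A : U d) (x : TreeSpan d (Idx d × Bool)) :
    split (oldRep A x) = U.tensorRep oldRep oldRep A (split x) :=
  U.intertwine oldRep (U.tensorRep oldRep oldRep) split (fun u w => by
    rw [U.tensorRep_incl, oldRep_incl, split_nodeOp _ _ (split_localOp _ _ u)]; rfl) A x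

theorem split_insertOp (A : U d) (x : TreeSpan d (Idx d)) :
    split (insertOp A x) = TensorProduct.map forgetL forgetL
      (U.tensorRep oldRep oldRep A (TensorProduct.map flagL flagL (split x))) := by
  rw [insertOp_apply, forgetL, split_mapEdgesL, split_oldRep, flagL, split_mapEdgesL]

/-! ## The pairing is multiplicative -/

theorem deriv_graftL (p : E × ETree d E) (e : E) (σ : ETree d E) (y : TreeSpan d E) :
    deriv p (graftL e (Finsupp.single σ 1) y)
      = graftL e (Finsupp.single σ 1) (deriv p y)
        + (open Classical in if (e, σ) = p then (1 : ℝ) else 0) • y := by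
  classical
  induction y using Finsupp.induction_linear with
  | zero => simp
  | add x y hx hy => simp only [map_add, hx, hy, smul_add]; abel
  | single τ c =>
    rw [← mul_one c, ← smul_eq_mul, ← Finsupp.smul_single, map_smul, map_smul, map_smul, map_smul,
      ← single_graft, deriv_graft, add_comm, smul_add]
    congr 1
    split_ifs <;> simp

/-- Dual to `(I_e(σ) ρ) ρ' = I_e(σ) (ρ ρ')`: of the two legs to which `split` sends a branch, only
the left one is differentiated. -/
theorem split_deriv (p : E × ETree d E) (x : TreeSpan d E) :
    split (deriv p x) = TensorProduct.map (deriv p) LinearMap.id (split x) := by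
  refine LinearMap.congr_fun (f := split.comp (deriv p))
    (g := (TensorProduct.map (deriv p) LinearMap.id).comp split)
    (TreeSpan.hom_induct (fun n m => ?_) fun e σ τ _ hτ => ?_) x
  · rw [LinearMap.comp_apply, LinearMap.comp_apply, deriv_root, map_zero,
      map_split_root_eq_zero (deriv_root p)]
  · simp only [LinearMap.comp_apply] at hτ ⊢
    rw [deriv_graftL, map_add, map_smul, split_graftL, hτ, split_graftL]
    induction split (Finsupp.single τ 1) using TensorProduct.induction_on with
    | zero => simp
    | add z w hz hw =>
      simp only [map_add, smul_add] at hz hw ⊢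
      rw [← hz, ← hw]; abel
    | tmul y z =>
      simp only [TensorProduct.map_tmul, leibniz_tmul, map_add, LinearMap.id_apply, deriv_graftL,
        TensorProduct.add_tmul, TensorProduct.smul_tmul']
      abel

/-- Both sides obey the same recursion when the tested tree is multiplied by `X_i` or `Ξ`: the
adjoints of these multiplications are derivations of the product of one-node trees. -/
theorem mul_pairing_root (n n' : Idx d) (m m' : ℕ) (x : TreeSpan d E) :
    pairing (root n m * root n' m' : ETree d E) x
      = LinearMap.mul' ℝ ℝ (TensorProduct.map (pairing (root n m)) (pairing (root n' m'))
          (split x)) := by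
  have hmul (n n' : Idx d) (m m' : ℕ) :
      (root n m * root n' m' : ETree d E) = root (n + n') (m + m') := rfl
  suffices H : ∀ τ : ETree d E, ∀ n n' m m', pairing (root n m * root n' m' : ETree d E)
      (Finsupp.single τ 1) = LinearMap.mul' ℝ ℝ (TensorProduct.map (pairing (root n m))
        (pairing (root n' m')) (split (Finsupp.single τ 1))) from
    LinearMap.congr_fun (f := pairing (root n m * root n' m' : ETree d E))
      (g := (LinearMap.mul' ℝ ℝ).comp ((TensorProduct.map (pairing (root n m))
        (pairing (root n' m'))).comp split)) (TreeSpan.hom_ext fun τ => H τ n n' m m') x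
  intro τ
  induction τ using ETree.induct with
  | hg e σ τ _ _ =>
    intro n n' m m'
    rw [hmul, single_graft, pairing_root_graftL, split_graftL]
    induction split (Finsupp.single τ 1) using TensorProduct.induction_on with
    | zero => simp
    | add z w hz hw => simp only [map_add, ← hz, ← hw, add_zero]
    | tmul y z => simp [leibniz_tmul, pairing_root_graftL]
  | hr k p =>
    induction k using Idx.induction with
    | succ k i ih =>
      intro n n' m m'
      have hX (n n' : Idx d) (m m' : ℕ) (z : TreeSpan d E ⊗[ℝ] TreeSpan d E) :
          LinearMap.mul' ℝ ℝ (TensorProduct.map (pairing (root n m)) (pairing (root n' m'))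
              (leibniz (mulX i) z))
            = n i * LinearMap.mul' ℝ ℝ (TensorProduct.map (pairing (root (n - unitIdx i) m))
                (pairing (root n' m')) z)
              + n' i * LinearMap.mul' ℝ ℝ (TensorProduct.map (pairing (root n m))
                (pairing (root (n' - unitIdx i) m')) z) := by
        induction z using TensorProduct.induction_on with
        | zero => simp
        | add z w hz hw => simp only [map_add, hz, hw]; ring
        | tmul y z =>
          simp only [leibniz_tmul, map_add, TensorProduct.map_tmul, LinearMap.mul'_apply,
            pairing_root_mulX]
          ring
      rw [← mulX_root, split_mulX, hX, ← ih, ← ih, hmul, hmul, hmul, pairing_root_mulX]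
      -- The truncated subtraction may be moved across the sum only when the exponent is nonzero;
      -- otherwise the coefficient in front vanishes. The same applies to `h2`.
      have h1 : (n i : ℝ) * pairing (root (n - unitIdx i + n') (m + m'))
            (Finsupp.single (root k p : ETree d E) 1)
          = n i * pairing (root (n + n' - unitIdx i) (m + m'))
            (Finsupp.single (root k p : ETree d E) 1) := by
        by_cases h : n i = 0
        · simp [h]
        · rw [tsub_add_eq_add_tsub (unitIdx_le.mpr h)]
      have h2 : (n' i : ℝ) * pairing (root (n + (n' - unitIdx i)) (m + m'))
            (Finsupp.single (root k p : ETree d E) 1)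
          = n' i * pairing (root (n + n' - unitIdx i) (m + m'))
            (Finsupp.single (root k p : ETree d E) 1) := by
        by_cases h : n' i = 0
        · simp [h]
        · rw [add_tsub_assoc_of_le (unitIdx_le.mpr h)]
      rw [h1, h2, Pi.add_apply]
      push_cast
      ring
    | zero =>
      induction p with
      | succ p ih =>
        intro n n' m m'
        have hΞ (n n' : Idx d) (m m' : ℕ) (z : TreeSpan d E ⊗[ℝ] TreeSpan d E) :
            LinearMap.mul' ℝ ℝ (TensorProduct.map (pairing (root n m)) (pairing (root n' m'))
                (leibniz mulXi z))
              = m * LinearMap.mul' ℝ ℝ (TensorProduct.map (pairing (root n (m - 1)))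
                  (pairing (root n' m')) z)
                + m' * LinearMap.mul' ℝ ℝ (TensorProduct.map (pairing (root n m))
                  (pairing (root n' (m' - 1))) z) := by
          induction z using TensorProduct.induction_on with
          | zero => simp
          | add z w hz hw => simp only [map_add, hz, hw]; ring
          | tmul y z =>
            simp only [leibniz_tmul, map_add, TensorProduct.map_tmul, LinearMap.mul'_apply,
              pairing_root_mulXi]
            ring
        rw [← mulXi_root, split_mulXi, hΞ, ← ih, ← ih, hmul, hmul, hmul, pairing_root_mulXi]
        cases m with
        | zero =>
          cases m' with
          | zero => simp
          | succ m' => simp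
        | succ m =>
          cases m' with
          | zero => simp
          | succ m' =>
            rw [show m + 1 + (m' + 1) - 1 = m + (m' + 1) by omega,
              show m + 1 - 1 + (m' + 1) = m + (m' + 1) by omega,
              show m + 1 + (m' + 1 - 1) = m + (m' + 1) by omega]
            push_cast
            ring
      | zero =>
        intro n n' m m'
        classical
        rw [split_one, hmul]
        simp only [TensorProduct.map_tmul, LinearMap.mul'_apply, pairing_apply,
          Finsupp.single_apply, root_inj, symFactor_root]
        by_cases h : 0 = n ∧ 0 = m
        · obtain ⟨rfl, rfl⟩ := h
          simp [idxFactorial]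
        · have h' : ¬ (0 = n + n' ∧ 0 = m + m') := fun hh => h
            ⟨(add_eq_zero.mp hh.1.symm).1.symm, by omega⟩
          rw [if_neg h, if_neg h']
          simp

/-- The branches of `ρ` are stripped off by derivatives of the left leg, those of `ρ'` likewise
after exchanging the legs, which leaves one-node trees. -/
theorem pairing_mul (ρ ρ' : ETree d E) (x : TreeSpan d E) :
    pairing (ρ * ρ') x
      = LinearMap.mul' ℝ ℝ (TensorProduct.map (pairing ρ) (pairing ρ') (split x)) := by
  have hgr (e : E) (σ τ ρ' : ETree d E) : graft e σ τ * ρ' = graft e σ (τ * ρ') := graft_mul _ _ _ _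
  induction ρ using ETree.induct generalizing x with
  | hg e σ τ _ ih =>
    rw [hgr, pairing_graft, ih, split_deriv]
    induction split x using TensorProduct.induction_on with
    | zero => simp
    | add z w hz hw => simp only [map_add, mul_add, hz, hw]
    | tmul y z =>
      simp only [TensorProduct.map_tmul, LinearMap.mul'_apply, pairing_graft, LinearMap.id_apply]
      ring
  | hr n m =>
    induction ρ' using ETree.induct generalizing x with
    | hr n' m' => exact mul_pairing_root n n' m m' x
    | hg e σ τ _ ih =>
      rw [mul_comm, hgr, pairing_graft, mul_comm τ, ih, ← comm_split (deriv _ x), split_deriv]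
      conv_rhs => rw [← comm_split x]
      induction split x using TensorProduct.induction_on with
      | zero => simp
      | add z w hz hw => simp only [map_add, mul_add, hz, hw]
      | tmul y z =>
        simp only [TensorProduct.map_tmul, LinearMap.mul'_apply, pairing_graft, LinearMap.id_apply,
          TensorProduct.comm_tmul]
        ring

/-! ## Coefficients of one-node trees and of planted trees -/

theorem graftL_apply_root (e : E) (x y : TreeSpan d E) (n : Idx d) (m : ℕ) :
    graftL e x y (root n m) = 0 :=
  graftL_hom_ext (f := (graftL e).compr₂ (Finsupp.lapply (root n m))) (g := 0)
    (fun σ τ => by simp [graftL_single, graft_ne_root]) x y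

open Classical in
theorem single_root_apply_root (k n : Idx d) (p m : ℕ) :
    (Finsupp.single (root k p) 1 : TreeSpan d E) (root n m) = if k = n ∧ p = m then 1 else 0 := by
  rw [Finsupp.single_apply]
  exact if_congr (root_inj _ _ _ _) rfl rfl

theorem mulX_apply_root (i : Fin (d + 1)) (x : TreeSpan d E) (n : Idx d) (m : ℕ) :
    mulX i x (root n m) = if n i = 0 then 0 else x (root (n - unitIdx i) m) := by
  classical
  have := LinearMap.congr_fun (f := (Finsupp.lapply (root n m)).comp (mulX i))
    (g := if n i = 0 then 0 else Finsupp.lapply (root (n - unitIdx i) m))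
    (TreeSpan.hom_induct (fun k p => ?_) fun e σ τ _ _ => ?_) x
  · refine this.trans ?_
    split_ifs <;> rfl
  · rw [LinearMap.comp_apply, mulX_root, Finsupp.lapply_apply, single_root_apply_root]
    simp only [add_unitIdx_eq_iff]
    by_cases h : n i = 0
    · simp [h]
    · simp [h, single_root_apply_root]
  · rw [LinearMap.comp_apply, mulX_graftL, Finsupp.lapply_apply, graftL_apply_root]
    split_ifs
    · rfl
    · exact (graftL_apply_root _ _ _ _ _).symm

theorem nodeOp_graftAtL_apply_root (mk : Idx d → E) (b : Idx d) (s x : TreeSpan d E) (n : Idx d)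
    (m : ℕ) : nodeOp (fun _ => false) (graftAtL mk b s) x (root n m) = 0 := by
  refine LinearMap.congr_fun (g := 0)
    (f := (Finsupp.lapply (root n m)).comp (nodeOp (fun _ => false) (graftAtL mk b s)))
    (TreeSpan.hom_induct (fun k p => ?_) fun e σ τ _ _ => ?_) x
  · rw [LinearMap.comp_apply, nodeOp_root, graftAtL_apply, map_sum]
    exact Finset.sum_eq_zero fun l _ => by
      rw [map_smul, Finsupp.lapply_apply, graftL_apply_root, smul_zero]
  · rw [LinearMap.comp_apply, nodeOp_graftL_of_false _ rfl, Finsupp.lapply_apply,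
      graftL_apply_root, LinearMap.zero_apply]

theorem rootRep_X (i : Fin (d + 1)) : rootRep (U.incl (V.X i) : U d) = mulX i := by
  rw [rootRep_incl, localOp_X]; rfl

theorem rootRep_planted (a : Idx d) (x : TreeSpan d (Idx d)) :
    rootRep (U.incl (V.planted a x)) = nodeOp (fun _ => false) (graftAtL id a x) := by
  rw [rootRep_incl, localOp_planted]; rfl

-- Only the `X_i` can yield a tree without branches, and they shift the root decoration and keep the
-- noises; so the coefficient depends on `n - k` alone.
open Classical in
theorem rootRep_root_apply_root (A : U d) (k n : Idx d) (p m : ℕ) :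
    rootRep A (Finsupp.single (root k p) 1) (root n m)
      = if k ≤ n ∧ p = m then rootRep A (Finsupp.single (root 0 0) 1) (root (n - k) 0) else 0 := by
  induction A using U.left_induction generalizing n with
  | one =>
    simp only [map_one, Module.End.one_apply, single_root_apply_root]
    by_cases h : k ≤ n
    · have : k = n ↔ 0 = n - k := by
        rw [eq_comm (a := 0), tsub_eq_zero_iff_le]
        exact ⟨fun h' => h'.ge, fun h' => le_antisymm h h'⟩
      by_cases hp : p = m <;> simp [h, hp, this]
    · rw [if_neg fun h' => h h'.1.le, if_neg fun h' => h h'.1]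
  | add A B hA hB =>
    simp only [map_add, LinearMap.add_apply, Finsupp.add_apply, hA, hB]
    split_ifs <;> simp
  | smul c A hA =>
    simp only [map_smul, LinearMap.smul_apply, Finsupp.smul_apply, hA]
    split_ifs <;> simp
  | incl_mul u A hA =>
    rw [map_mul, Module.End.mul_apply, Module.End.mul_apply]
    induction u using V.induction with
    | add u v hu hv =>
      simp only [map_add, LinearMap.add_apply, Finsupp.add_apply, hu, hv]
      split_ifs <;> simp
    | smul c u hu =>
      simp only [map_smul, LinearMap.smul_apply, Finsupp.smul_apply, hu]
      split_ifs <;> simp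
    | planted a σ => simp [rootRep_planted, nodeOp_graftAtL_apply_root]
    | X i =>
      rw [rootRep_X, mulX_apply_root, mulX_apply_root, hA]
      by_cases hn : n i = 0
      · simp [hn]
      by_cases hp : p = m
      · have h : k ≤ n - unitIdx i ↔ k ≤ n ∧ (n - k) i ≠ 0 := by
          rw [← unitIdx_le]
          have hle := unitIdx_le.mpr hn
          rw [le_tsub_iff_right hle]
          refine ⟨fun h => ⟨le_of_add_le_left h, le_tsub_of_add_le_left h⟩, fun h => ?_⟩
          exact (le_tsub_iff_left h.1).mp h.2
        by_cases hk : k ≤ n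
        · by_cases hi : (n - k) i = 0
          · simp [h, hi]
          · rw [tsub_right_comm (a := n) (b := k)]
            simp [h, hp, hn, hk]
        · simp [h, hk]
      · simp [hp]

/-- Every element of `𝒱` adds a decoration or a branch, so only the scalar part of `A` contributes
to the tree `1`. -/
theorem rootRep_apply_root_zero (A : U d) (x : TreeSpan d (Idx d)) :
    rootRep A x (root 0 0) = U.counit A * x (root 0 0) := by
  induction A using U.left_induction generalizing x with
  | one => simp
  | add A B hA hB => simp [hA, hB, add_mul]
  | smul c A hA => simp [hA, mul_assoc]
  | incl_mul u A hA =>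
    rw [map_mul, map_mul, U.counit_incl, zero_mul, zero_mul, Module.End.mul_apply]
    induction u using V.induction with
    | add u v hu hv => simp [hu, hv]
    | smul c u hu => simp [hu]
    | planted a σ => rw [rootRep_planted, nodeOp_graftAtL_apply_root]
    | X i => simp [rootRep_X, mulX_apply_root]

theorem insertOp_graftL_apply_root (A : U d) (a : Idx d) (x y : TreeSpan d (Idx d)) (n : Idx d)
    (m : ℕ) : insertOp A (graftL a x y) (root n m) = 0 := by
  rw [insertOp_graftL]
  induction TensorProduct.map (insertOp.flip x) (insertOp.flip y) (U.comul A)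
    using TensorProduct.induction_on with
  | zero => simp
  | add z w hz hw => rw [map_add, Finsupp.add_apply, hz, hw, add_zero]
  | tmul s t => rw [TensorProduct.lift.tmul, graftL_apply_root]

theorem insertOp_apply_root_zero (A : U d) (x : TreeSpan d (Idx d)) :
    insertOp A x (root 0 0) = U.counit A * x (root 0 0) := by
  refine LinearMap.congr_fun (f := (Finsupp.lapply (root 0 0)).comp (insertOp A))
    (g := U.counit A • Finsupp.lapply (root 0 0))
    (TreeSpan.hom_induct (fun n m => ?_) fun e σ τ _ _ => ?_) x
  · rw [LinearMap.comp_apply, insertOp_root]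
    exact rootRep_apply_root_zero _ _
  · rw [LinearMap.comp_apply, Finsupp.lapply_apply, insertOp_graftL_apply_root,
      LinearMap.smul_apply, Finsupp.lapply_apply, graftL_apply_root, smul_zero]

theorem plant_injective (a : E) : Function.Injective (plant a : ETree d E → ETree d E) :=
  fun _ _ h => ((graft_eq_plant _ _ _ _ _).mp h).2.1

/-- The component of the trees `I_a(τ)`. -/
noncomputable def branch (a : E) : Module.End ℝ (TreeSpan d E) :=
  Finsupp.lcomapDomain (plant a) (plant_injective a)

theorem branch_apply (a : E) (x : TreeSpan d E) (τ : ETree d E) : branch a x τ = x (plant a τ) := rfl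

theorem symFactor_plant (a : E) (τ : ETree d E) : symFactor (plant a τ) = symFactor τ := by
  simp [symFactor, plant, idxFactorial]

theorem pairing_plant (a : E) (τ : ETree d E) (x : TreeSpan d E) :
    pairing (plant a τ) x = pairing τ (branch a x) := by
  rw [pairing_apply, pairing_apply, symFactor_plant, branch_apply]

theorem branch_root (a : E) (n : Idx d) (m : ℕ) :
    branch a (Finsupp.single (root n m : ETree d E) 1) = 0 := by
  ext τ
  simp [branch_apply, plant, graft_ne_root]

open Classical in
theorem branch_graftL (a b : E) (x y : TreeSpan d E) :
    branch a (graftL b x y) = (if b = a then y (root 0 0) else 0) • x := by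
  have := graftL_hom_ext (f := (graftL b).compr₂ (branch a))
    (g := if b = a then (LinearMap.lsmul ℝ _ ∘ₗ Finsupp.lapply (root 0 0)).flip else 0)
    (fun σ τ => ?_) x y
  · refine this.trans ?_
    split_ifs <;> simp
  · ext ρ
    rw [LinearMap.compr₂_apply, graftL_single, branch_apply, Finsupp.single_apply]
    simp only [graft_eq_plant]
    by_cases h : b = a
    · by_cases h' : τ = root 0 0
      · simp [h, h', Finsupp.single_apply]
      · simp [h, h']
    · simp [h]

theorem branch_mulX (a : E) (i : Fin (d + 1)) (x : TreeSpan d E) : branch a (mulX i x) = 0 := by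
  classical
  refine LinearMap.congr_fun (f := (branch a).comp (mulX i)) (g := 0)
    (TreeSpan.hom_induct (fun n m => ?_) fun e σ τ _ _ => ?_) x
  · rw [LinearMap.comp_apply, mulX_root, branch_root, LinearMap.zero_apply]
  · rw [LinearMap.comp_apply, mulX_graftL, branch_graftL, mulX_apply_root]
    simp

open Classical in
theorem branch_nodeOp_graftAtL (a b : Idx d) (s x : TreeSpan d (Idx d)) :
    branch a (nodeOp (fun _ => false) (graftAtL id b s) x)
      = (if a ≤ b then x (root (b - a) 0) else 0) • s := by
  have := LinearMap.congr_fun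
    (f := (branch a).comp (nodeOp (fun _ => false) (graftAtL id b s)))
    (g := if a ≤ b then (Finsupp.lapply (root (b - a) 0)).smulRight s else 0)
    (TreeSpan.hom_induct (fun n m => ?_) fun e σ τ _ _ => ?_) x
  · refine this.trans ?_
    split_ifs <;> simp
  · rw [LinearMap.comp_apply, nodeOp_root, graftAtL_apply, map_sum]
    simp only [map_smul, branch_graftL, id, single_root_apply_root]
    by_cases h : a ≤ b
    · rw [Finset.sum_eq_single (b - a)]
      · rw [tsub_tsub_cancel_of_le h, if_pos rfl, if_pos h, LinearMap.smulRight_apply,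
          Finsupp.lapply_apply, single_root_apply_root, smul_smul]
        congr 1
        by_cases h1 : b - a ≤ n
        · have h2 : n - (b - a) = 0 ↔ n = b - a :=
            tsub_eq_zero_iff_le.trans ⟨fun h' => le_antisymm h' h1, fun h' => h'.le⟩
          by_cases h3 : n = b - a
          · simp [h3, idxChoose]
          · simp [h2, h3]
        · simp [idxChoose_eq_zero h1, show ¬ n = b - a from fun h' => h1 h'.ge]
      · intro l hl hne
        rw [if_neg fun h' => hne ?_, zero_smul, smul_zero]
        rw [← h', tsub_tsub_cancel_of_le (Finset.mem_Iic.mp hl)]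
      · intro h'
        exact absurd (Finset.mem_Iic.mpr tsub_le_self) h'
    · rw [if_neg h, LinearMap.zero_apply]
      refine Finset.sum_eq_zero fun l _ => ?_
      rw [if_neg fun h' : b - l = a => h (h' ▸ tsub_le_self), zero_smul, smul_zero]
  · rw [LinearMap.comp_apply, nodeOp_graftL_of_false _ rfl, branch_graftL,
      nodeOp_graftAtL_apply_root, ite_self, zero_smul]
    split_ifs
    · rw [LinearMap.smulRight_apply, Finsupp.lapply_apply, graftL_apply_root, zero_smul]
    · rfl

/-- To turn `X^k` into a planted tree, the whole decoration must be absorbed by the grafted edge,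
which lowers `a + k` to `a`. This is the origin of the terms `X^ℓ / ℓ! ⊗ I_{a+ℓ}(τ)` of `Δ₂`. -/
theorem branch_rootRep_root (A : U d) (a k : Idx d) (p : ℕ) :
    branch a (rootRep A (Finsupp.single (root k p) 1))
      = if p = 0 then branch (a + k) (rootRep A (Finsupp.single (root 0 0) 1)) else 0 := by
  induction A using U.left_induction with
  | one => simp [branch_root]
  | add A B hA hB =>
    simp only [map_add, LinearMap.add_apply, hA, hB]
    split_ifs <;> simp
  | smul c A hA =>
    simp only [map_smul, LinearMap.smul_apply, hA]
    split_ifs <;> simp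
  | incl_mul u A _ =>
    rw [map_mul, Module.End.mul_apply, Module.End.mul_apply]
    induction u using V.induction with
    | add u v hu hv =>
      simp only [map_add, LinearMap.add_apply, hu, hv]
      split_ifs <;> simp
    | smul c u hu =>
      simp only [map_smul, LinearMap.smul_apply, hu]
      split_ifs <;> simp
    | X i => simp [rootRep_X, branch_mulX]
    | planted b σ =>
      simp only [rootRep_planted, branch_nodeOp_graftAtL, rootRep_root_apply_root A k]
      by_cases hp : p = 0
      · by_cases h : a ≤ b
        · have h1 : k ≤ b - a ↔ a + k ≤ b := le_tsub_iff_left h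
          rw [tsub_tsub, if_pos hp, if_pos h]
          by_cases hk : a + k ≤ b
          · rw [if_pos ⟨h1.mpr hk, hp⟩, if_pos hk]
          · rw [if_neg fun h' => hk (h1.mp h'.1), if_neg hk]
        · have h' : ¬ a + k ≤ b := fun h' => h (le_of_add_le_left h')
          simp [h, h']
      · simp [hp]

/-- For the result to stay planted, the leg of `A` acting on `y` may contribute only its counit; all
of `A` then acts inside `x`. -/
theorem branch_insertOp_graftL (A : U d) (a b : Idx d) (x y : TreeSpan d (Idx d)) :
    branch a (insertOp A (graftL b x y)) = insertOp A (branch a (graftL b x y)) := by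
  classical
  have h (z : U d ⊗[ℝ] U d) :
      branch a (TensorProduct.lift (graftL b)
        (TensorProduct.map (insertOp.flip x) (insertOp.flip y) z))
      = (if b = a then y (root 0 0) else 0)
        • insertOp (TensorProduct.rid ℝ _ (U.counit.toLinearMap.lTensor _ z)) x := by
    induction z using TensorProduct.induction_on with
    | zero => simp
    | add z w hz hw => simp only [map_add, hz, hw, LinearMap.add_apply, smul_add]
    | tmul B C =>
      simp only [TensorProduct.map_tmul, TensorProduct.lift.tmul, branch_graftL,
        LinearMap.flip_apply, insertOp_apply_root_zero, LinearMap.lTensor_tmul,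
        TensorProduct.rid_tmul, AlgHom.toLinearMap_apply, map_smul, LinearMap.smul_apply,
        smul_smul]
      split_ifs <;> simp [mul_comm]
  have hc : U.counit.toLinearMap.lTensor (U d) (U.comul A) = A ⊗ₜ 1 :=
    Coalgebra.lTensor_counit_comul A
  rw [insertOp_graftL, h, hc, branch_graftL, map_smul, TensorProduct.rid_tmul, one_smul]
  congr

/-- A planted tree arises in two ways: by insertions above an existing planted edge, or from a bare
root `X^l` absorbed by a new edge. The bound `N` only has to exceed the decorations of the one-node
trees in `x`, so it does not depend on `A`. -/
theorem eventually_branch_insertOp (a : Idx d) (x : TreeSpan d (Idx d)) :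
    ∀ᶠ N : ℕ in Filter.atTop, ∀ A : U d, branch a (insertOp A x) = insertOp A (branch a x)
      + ∑ l ∈ Finset.Iic (fun _ => N : Idx d),
          x (root l 0) • branch (a + l) (rootRep A (Finsupp.single (root 0 0) 1)) := by
  classical
  induction x using Finsupp.induction_linear with
  | zero => simp
  | add x y hx hy =>
    filter_upwards [hx, hy] with N hx hy A
    simp only [map_add, hx, hy, Finsupp.add_apply, add_smul, Finset.sum_add_distrib]
    abel
  | single τ c =>
    have hs : (Finsupp.single τ c : TreeSpan d (Idx d)) = c • Finsupp.single τ 1 := by simp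
    suffices H : ∀ᶠ N : ℕ in Filter.atTop, ∀ A : U d, branch a (insertOp A (Finsupp.single τ 1))
        = insertOp A (branch a (Finsupp.single τ 1)) + ∑ l ∈ Finset.Iic (fun _ => N : Idx d),
          (Finsupp.single τ 1 : TreeSpan d (Idx d)) (root l 0)
            • branch (a + l) (rootRep A (Finsupp.single (root 0 0) 1)) by
      filter_upwards [H] with N H A
      rw [hs, map_smul, map_smul, H, map_smul, map_smul, smul_add, Finset.smul_sum]
      simp only [Finsupp.smul_apply, smul_eq_mul, mul_smul]
    induction τ using ETree.induct with
    | hg b σ τ _ _ =>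
      refine Filter.Eventually.of_forall fun N A => ?_
      rw [single_graft, branch_insertOp_graftL]
      simp [graftL_apply_root]
    | hr k p =>
      filter_upwards [Filter.eventually_ge_atTop (∑ i, k i)] with N hN A
      have hk : k ∈ Finset.Iic (fun _ => N : Idx d) := Finset.mem_Iic.mpr fun i =>
        (Finset.single_le_sum (fun _ _ => Nat.zero_le _) (Finset.mem_univ i)).trans hN
      rw [insertOp_root, branch_root, map_zero, zero_add, branch_rootRep_root,
        Finset.sum_eq_single_of_mem k hk]
      · split_ifs with h <;> simp [single_root_apply_root, h]
      · intro l _ hl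
        rw [single_root_apply_root, if_neg fun h => hl h.1.symm, zero_smul]

/-! ## Duality -/

/-- The matrix coefficients `A ↦ ⟨ρ, A · x⟩` of the insertion operators, in the convolution
algebra dual to `U(𝒱_0)`. -/
noncomputable def insertCoeff (ρ : Tree d) :
    TreeSpan d (Idx d) →ₗ[ℝ] WithConv (U d →ₗ[ℝ] ℝ) where
  toFun x := toConv ((pairing ρ).comp (insertOp.flip x))
  map_add' x y := WithConv.ext (LinearMap.ext fun A => by simp)
  map_smul' c x := WithConv.ext (LinearMap.ext fun A => by simp)

theorem insertCoeff_apply (ρ : Tree d) (x : TreeSpan d (Idx d)) (A : U d) :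
    (insertCoeff ρ x).ofConv A = pairing ρ (insertOp A x) := rfl

/-- The pairing turns the product of `ρ` and `ρ'` into `split`, on whose legs `A` acts by its
coproduct; this is a convolution product. -/
theorem insertCoeff_mul (ρ ρ' : Tree d) (x : TreeSpan d (Idx d)) :
    insertCoeff (ρ * ρ') x = LinearMap.mul' ℝ (WithConv (U d →ₗ[ℝ] ℝ))
      (TensorProduct.map (insertCoeff ρ) (insertCoeff ρ') (split x)) := by
  refine WithConv.ext (LinearMap.ext fun A => ?_)
  rw [insertCoeff_apply, pairing_mul, split_insertOp]
  induction split x using TensorProduct.induction_on with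
  | zero => simp
  | add z w hz hw => simp only [map_add, hz, hw, ofConv_add, LinearMap.add_apply]
  | tmul y z =>
    rw [TensorProduct.map_tmul, U.tensorRep_tmul, TensorProduct.map_tmul, LinearMap.mul'_apply,
      conv_apply]
    induction U.comul A using TensorProduct.induction_on with
    | zero => simp
    | add z w hz hw => simp only [map_add, hz, hw]
    | tmul B C => rfl

/-- The functional `x ↦ ∑ ⟨τ, x⟩ ⟨σ, A · 1⟩` attached to `∑ τ ⊗ σ`. -/
noncomputable def deltaEval : MonoidAlgebra ℝ (Tree d × Tree d) →ₗ[ℝ]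
    TreeSpan d (Idx d) →ₗ[ℝ] WithConv (U d →ₗ[ℝ] ℝ) :=
  (Finsupp.linearCombination ℝ fun p : Tree d × Tree d =>
    (pairing p.1).smulRight (insertCoeff p.2 (Finsupp.single (root 0 0) 1))).comp
    (MonoidAlgebra.coeffLinearEquiv ℝ).toLinearMap

theorem deltaEval_single (p : Tree d × Tree d) (c : ℝ) (x : TreeSpan d (Idx d)) :
    deltaEval (MonoidAlgebra.single p c) x
      = c • pairing p.1 x • insertCoeff p.2 (Finsupp.single (root 0 0) 1) := by
  simp [deltaEval]

theorem deltaEval_mul (P Q : MonoidAlgebra ℝ (Tree d × Tree d)) (x : TreeSpan d (Idx d)) :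
    deltaEval (P * Q) x = LinearMap.mul' ℝ (WithConv (U d →ₗ[ℝ] ℝ))
      (TensorProduct.map (deltaEval P) (deltaEval Q) (split x)) := by
  induction P using MonoidAlgebra.induction_linear with
  | zero => simp
  | add P P' hP hP' =>
    simp only [add_mul, map_add, LinearMap.add_apply, hP, hP', TensorProduct.map_add_left]
  | single p c =>
    induction Q using MonoidAlgebra.induction_linear with
    | zero => simp
    | add Q Q' hQ hQ' =>
      simp only [mul_add, map_add, LinearMap.add_apply, hQ, hQ', TensorProduct.map_add_right]
    | single q c' =>
      rw [MonoidAlgebra.single_mul_single, deltaEval_single, Prod.fst_mul, Prod.snd_mul,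
        insertCoeff_mul, split_one, pairing_mul]
      induction split x using TensorProduct.induction_on with
      | zero => simp
      | add z w hz hw => simp only [map_add, ← hz, ← hw, add_smul, smul_add]
      | tmul y z =>
        simp only [TensorProduct.map_tmul, LinearMap.mul'_apply, deltaEval_single, smul_mul_assoc,
          mul_smul_comm, smul_smul]
        congr 1
        ring

theorem deltaEval_mapDomain_plant (a : Idx d) (P : MonoidAlgebra ℝ (Tree d × Tree d))
    (x : TreeSpan d (Idx d)) :
    deltaEval (MonoidAlgebra.mapDomain (Prod.map (plant a) id) P) x
      = deltaEval P (branch a x) := by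
  induction P using MonoidAlgebra.induction_linear with
  | zero => simp
  | add P Q hP hQ => rw [MonoidAlgebra.mapDomain_add, map_add, map_add, LinearMap.add_apply,
      LinearMap.add_apply, hP, hQ]
  | single p c =>
    rw [MonoidAlgebra.mapDomain_single, deltaEval_single, deltaEval_single, Prod.map_fst,
      Prod.map_snd, pairing_plant, id]

theorem idxChoose_mul_factorial {n j : Idx d} (h : j ≤ n) :
    idxChoose n j * (idxFactorial j * idxFactorial (n - j)) = idxFactorial n := by
  rw [idxChoose, idxFactorial, idxFactorial, idxFactorial, ← Finset.prod_mul_distrib,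
    ← Finset.prod_mul_distrib]
  exact Finset.prod_congr rfl fun i _ => by
    rw [← mul_assoc, Pi.sub_apply, Nat.choose_mul_factorial_mul_factorial (h i)]

/-- From `X^k` to `X^n` there remains the coefficient of `X^{n-k}` in `A · 1`. The normalizations
match because `n! = (n choose k) k! (n - k)!`. -/
theorem insertCoeff_root (N : ℕ) (n : Idx d) (m : ℕ) :
    insertCoeff (root n m) = deltaEval (deltaTwo N (root n m)) := by
  classical
  have hd : deltaTwo N (root n m : Tree d) = ∑ j ∈ Finset.Iic n,
      MonoidAlgebra.single (root j m, root (n - j) 0) (idxChoose n j : ℝ) := rfl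
  refine TreeSpan.hom_induct (fun k p => ?_) fun b σ τ _ _ => ?_
  · refine WithConv.ext (LinearMap.ext fun A => ?_)
    rw [insertCoeff_apply, hd, map_sum, LinearMap.sum_apply, ofConv_sum, LinearMap.sum_apply,
      insertOp_root, pairing_apply, rootRep_root_apply_root]
    simp only [deltaEval_single, ofConv_smul, LinearMap.smul_apply, insertCoeff_apply,
      insertOp_root, pairing_apply, single_root_apply_root, smul_eq_mul, symFactor_root]
    by_cases h : k ≤ n ∧ p = m
    · obtain ⟨hk, rfl⟩ := h
      rw [Finset.sum_eq_single_of_mem k (Finset.mem_Iic.mpr hk), if_pos ⟨hk, rfl⟩,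
        if_pos ⟨rfl, rfl⟩, ← idxChoose_mul_factorial hk]
      · push_cast
        simp
        ring
      · intro j _ hj
        rw [if_neg fun h => hj h.1.symm]
        simp
    · rw [if_neg h, mul_zero, Finset.sum_eq_zero]
      intro j hj
      rw [if_neg fun h' => h ⟨h'.1.le.trans (Finset.mem_Iic.mp hj), h'.2⟩]
      simp
  · have h1 : insertCoeff (root n m) (graftL b (Finsupp.single σ 1) (Finsupp.single τ 1)) = 0 :=
      WithConv.ext (LinearMap.ext fun A => by
        rw [insertCoeff_apply, pairing_apply, insertOp_graftL_apply_root, mul_zero]; rfl)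
    rw [h1, hd, map_sum, LinearMap.sum_apply]
    refine (Finset.sum_eq_zero fun j _ => ?_).symm
    rw [deltaEval_single, pairing_root_graftL, zero_smul, smul_zero]

/-- The two origins of a planted tree are the two terms of `Δ₂ I_a(ρ)`; the coefficient `1 / ℓ!`
cancels the `ℓ!` in the pairing with `X^ℓ`. -/
theorem eventually_insertCoeff_plant (a : Idx d) (ρ : Tree d) (x : TreeSpan d (Idx d))
    (h : ∀ᶠ N : ℕ in Filter.atTop,
      insertCoeff ρ (branch a x) = deltaEval (deltaTwo N ρ) (branch a x)) :
    ∀ᶠ N : ℕ in Filter.atTop, insertCoeff (plant a ρ) x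
      = deltaEval (MonoidAlgebra.mapDomain (Prod.map (plant a) id) (deltaTwo N ρ)
          + ∑ l ∈ Finset.Iic (fun _ => N : Idx d),
            MonoidAlgebra.single (root l 0, plant (a + l) ρ) ((idxFactorial l : ℝ)⁻¹)) x := by
  filter_upwards [h, eventually_branch_insertOp a x] with N h hN
  rw [map_add, LinearMap.add_apply, deltaEval_mapDomain_plant, ← h, map_sum, LinearMap.sum_apply]
  refine WithConv.ext (LinearMap.ext fun A => ?_)
  rw [insertCoeff_apply, pairing_plant, hN, map_add, map_sum, ofConv_add, LinearMap.add_apply,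
    ofConv_sum, LinearMap.sum_apply, insertCoeff_apply]
  congr 1
  refine Finset.sum_congr rfl fun l _ => ?_
  have hl : (idxFactorial l : ℝ) ≠ 0 :=
    Nat.cast_ne_zero.mpr (Finset.prod_ne_zero_iff.mpr fun i _ => Nat.factorial_ne_zero _)
  rw [deltaEval_single, ofConv_smul, ofConv_smul, LinearMap.smul_apply, LinearMap.smul_apply,
    insertCoeff_apply, insertOp_root, pairing_plant, pairing_apply (root l 0), symFactor_root,
    map_smul]
  simp only [smul_eq_mul, Nat.factorial_zero, mul_one]
  field_simp

/-- Both sides are multiplicative in `ρ` through `split x`, a finite sum of tensors, so finitely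
many bounds on `N` are combined. -/
theorem eventually_insertCoeff (ρ : Tree d) (x : TreeSpan d (Idx d)) :
    ∀ᶠ N : ℕ in Filter.atTop, insertCoeff ρ x = deltaEval (deltaTwo N ρ) x := by
  induction ρ using ETree.induct generalizing x with
  | hr n m => exact Filter.Eventually.of_forall fun N => by rw [insertCoeff_root N]
  | hg a ρ ρ' h h' =>
    have hmul : graft a ρ ρ' = plant a ρ * ρ' :=
      ((graft_mul _ _ _ _).trans (congrArg _ (one_mul ρ'))).symm
    have hd (N : ℕ) : deltaTwo N (graft a ρ ρ')
        = (MonoidAlgebra.mapDomain (Prod.map (plant a) id) (deltaTwo N ρ)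
          + ∑ l ∈ Finset.Iic (fun _ => N : Idx d),
            MonoidAlgebra.single (root l 0, plant (a + l) ρ) ((idxFactorial l : ℝ)⁻¹))
          * deltaTwo N ρ' := recOn_graft _ _ _ _ _ _
    simp only [hd, deltaEval_mul]
    rw [hmul, insertCoeff_mul]
    induction split x using TensorProduct.induction_on with
    | zero => simp
    | add z w hz hw =>
      filter_upwards [hz, hw] with N hz hw
      simp only [map_add] at hz hw ⊢
      rw [hz, hw]
    | tmul y z =>
      filter_upwards [eventually_insertCoeff_plant a ρ y (h _), h' z] with N hy hz
      rw [TensorProduct.map_tmul, TensorProduct.map_tmul, hy, hz]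

/-- Evaluation at `A = pbw σ` reads off one coefficient, because `A · 1 = σ` when the root of `σ`
carries no noise. -/
theorem deltaEval_single_pbw (σ τ : Tree d) (hσ : rootNoise σ = 0)
    (P : MonoidAlgebra ℝ (Tree d × Tree d)) :
    (deltaEval P (Finsupp.single τ 1)).ofConv (pbw (Finsupp.single σ 1))
      = symFactor τ * symFactor σ * P.coeff (τ, σ) := by
  classical
  induction P using MonoidAlgebra.induction_linear with
  | zero => simp
  | add P Q hP hQ =>
    rw [map_add, LinearMap.add_apply, ofConv_add, LinearMap.add_apply, hP, hQ,
      MonoidAlgebra.coeff_add, Finsupp.add_apply, mul_add]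
  | single p c =>
    obtain ⟨τ', σ'⟩ := p
    rw [deltaEval_single, ofConv_smul, ofConv_smul, LinearMap.smul_apply, LinearMap.smul_apply,
      insertCoeff_apply, insertOp_root, rootRep_pbw _ (single_mem_positiveSpan hσ 1),
      pairing_apply, pairing_apply, MonoidAlgebra.coeff_single, Finsupp.single_apply,
      Finsupp.single_apply, Finsupp.single_apply]
    by_cases h1 : τ = τ'
    · by_cases h2 : σ = σ'
      · subst h1 h2
        simp
        ring
      · simp [h2, Ne.symm h2]
    · simp [h1, Ne.symm h1]

theorem isDualToDeltaTwo_starTwo : IsDualToDeltaTwo (d := d) starTwo := by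
  intro σ τ ρ hσ
  filter_upwards [eventually_insertCoeff ρ (Finsupp.single τ 1)] with N hN
  rw [← deltaEval_single_pbw σ τ hσ, ← hN, insertCoeff_apply, ← starTwo_eq_insertOp, pairing_apply]

end RegTrees

/-! ### The four statements together -/

theorem mainTheorem2 (d : ℕ) :
    ∃ T : RegTrees.U d →ₗ[ℝ] RegTrees.U d →ₗ[ℝ] RegTrees.U d,
      (RegTrees.IsPostLieExtension T ∧ ∀ T', RegTrees.IsPostLieExtension T' → T' = T) ∧
      RegTrees.IsDualToDeltaTwo (d := d) RegTrees.starTwo ∧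
      (Function.Bijective (RegTrees.pbw.domRestrict (RegTrees.positiveSpan d)) ∧
        ∀ σ ∈ RegTrees.positiveSpan d, ∀ τ ∈ RegTrees.positiveSpan d,
          RegTrees.starTwo σ τ ∈ RegTrees.positiveSpan d ∧
          RegTrees.pbw (RegTrees.starTwo σ τ)
            = RegTrees.postLieStar T (RegTrees.pbw σ) (RegTrees.pbw τ)) ∧
      (∀ (b : RegTrees.Idx d), ∀ σ ∈ RegTrees.positiveSpan d,
        ∀ τ : RegTrees.TreeSpan d (RegTrees.Idx d),
          RegTrees.U.incl (RegTrees.V.planted b (RegTrees.starTwo σ τ))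
            = T (RegTrees.pbw σ) (RegTrees.U.incl (RegTrees.V.planted b τ))) := by
  refine ⟨RegTrees.postLieExt, ⟨RegTrees.isPostLieExtension_postLieExt,
    fun T' hT' => hT'.eq_postLieExt⟩, RegTrees.isDualToDeltaTwo_starTwo,
    ⟨RegTrees.pbw_bijective, fun σ _ τ hτ => ?_⟩, fun b σ _ τ => ?_⟩
  · rw [RegTrees.starTwo_eq_insertOp]
    exact ⟨RegTrees.insertOp_mem_positiveSpan _ τ hτ, RegTrees.pbw_insertOp _ τ hτ⟩
  -- By construction, `A ▷ I_b(τ)` is `I_b` of the insertion of `A` into `τ`.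
  · rw [RegTrees.starTwo_eq_insertOp, RegTrees.postLieExt_incl, RegTrees.envAct_planted]
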